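/- Let $\Gamma_1,\dots,\Gamma_7$ be purely imaginary antisymmetric $8\times8$ matrices with $\Gamma_m\Gamma_n+\Gamma_n\Gamma_m=2\delta_{mn}\mathbb 1$ and $\Gamma_1\Gamma_2\cdots\Gamma_7=i\,\mathbb 1$, and let $f_{mnk}$ be the totally antisymmetric octonion structure constants with $f_{165}=f_{134}=f_{127}=f_{235}=f_{246}=f_{367}=f_{475}=1$ and all other components not related to these by antisymmetry equal to $0$. Let $Spin(7)$ be the group generated by the matrices $\exp\{i\,\omega_{mn}\Sigma_{mn}\}$, $\omega_{mn}\in\mathbb R$, $\Sigma_{mn}=\frac i2[\Gamma_m,\Gamma_n]$; it is contained in $SO(8)$. For $\vec\alpha\in\mathbb R^7$ with $\alpha=\|\vec\alpha\|\le\pi$ put $$g_7(\vec\alpha)=\exp\Big\{-\tfrac12\,\alpha_m f_{mnk}\Gamma_n\Gamma_k\Big\}.$$ Through $\vec x=\frac{\sin\alpha}{\alpha}\,\vec\alpha$, $x_8=\cos\alpha$ this is a well-defined smooth map $g_7:S^7\to Spin(7)\subset SO(8)$ on the unit sphere of $\mathbb R^8$. For a smooth map $g:S^7\to SO(8)$ let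 $A=i\,g^{-1}dg$ and $$q[g]=-\frac1{2^7\cdot3\cdot35\,\pi^4}\int_{S^7}\mathrm{Tr}\,(g^{-1}dg)^7,$$ $$\tilde q[g]=-\frac{i}{3\cdot2^{11}\cdot35\,\pi^4}\,\varepsilon^{abcdefgh}\int_{S^7}A^{ab}\wedge(A\wedge A)^{cd}\wedge(A\wedge A)^{ef}\wedge(A\wedge A)^{gh},$$ where $\varepsilon^{12345678}=1$, products of forms are wedge products, and $S^7$ is oriented as the boundary of the unit ball of $\mathbb R^8$ with coordinates $(x_1,\dots,x_8)$. (i) The density of $q[g_7]$ with respect to the surface measure of $S^7$ depends only on the polar angle $\alpha=\arccos x_8$; multiplied by the volume of the unit sphere $S^6$ it equals $\frac{512}{75\pi}\cos^2\alpha\,(2\cos^4\alpha+5\cos^2\alpha+2)$, and $$q[g_7]=\frac{512}{75\pi}\int_0^\pi\sin^6\alpha\,\cos^2\alpha\,(2\cos^4\alpha+5\cos^2\alpha+2)\,d\alpha=1.$$ (ii) Suppose that the $\Gamma_m$ are the matrices $\Gamma_1=-\sigma_2\otimes\sigma_2\otimes\sigma_2$, $\Gamma_2=\mathbb 1\otimes\sigma_1\otimes\sigma_2$,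 $\Gamma_3=\mathbb 1\otimes\sigma_3\otimes\sigma_2$, $\Gamma_4=-\sigma_1\otimes\sigma_2\otimes\mathbb 1$, $\Gamma_5=\sigma_3\otimes\sigma_2\otimes\mathbb 1$, $\Gamma_6=\sigma_2\otimes\mathbb 1\otimes\sigma_1$, $\Gamma_7=\sigma_2\otimes\mathbb 1\otimes\sigma_3$ (with $\sigma_j$ the Pauli matrices and the tensor basis in lexicographic order), or, more generally, $R\,\Gamma_mR^{T}$ for these $\Gamma_m$ and some $R\in SO(8)$. Then the density of $\tilde q[g_7]$, multiplied by the volume of $S^6$, equals $-\frac{512}{25\pi}\cos^2\alpha\,(2\cos^4\alpha+5\cos^2\alpha+2)$, and $$\tilde q[g_7]=-\frac{512}{25\pi}\int_0^\pi\sin^6\alpha\,\cos^2\alpha\,(2\cos^4\alpha+5\cos^2\alpha+2)\,d\alpha=-3.$$ -/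

import Mathlib

open Matrix MeasureTheory
open scoped Kronecker

noncomputable section

/-! ### Gamma matrices -/

/-- `8 × 8` complex matrices. -/
abbrev Mat8 : Type := Matrix (Fin 8) (Fin 8) ℂ

/-- Seven purely imaginary antisymmetric `8 × 8` matrices (numbered `0, …, 6`) that satisfy the
Clifford relations `Γ_m Γ_n + Γ_n Γ_m = 2 δ_{mn}` and `Γ_1 Γ_2 ⋯ Γ_7 = i`. -/
structure IsGammaSystem (Γ : Fin 7 → Mat8) : Prop where
  imaginary : ∀ m i j, (Γ m i j).re = 0
  antisymm : ∀ m, (Γ m)ᵀ = -Γ m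
  clifford : ∀ m n, Γ m * Γ n + Γ n * Γ m = if m = n then 2 else 0
  prod_eq : Γ 0 * Γ 1 * Γ 2 * Γ 3 * Γ 4 * Γ 5 * Γ 6 = Complex.I • (1 : Mat8)

def pauli1 : Matrix (Fin 2) (Fin 2) ℂ := !![0, 1; 1, 0]
def pauli2 : Matrix (Fin 2) (Fin 2) ℂ := !![0, -Complex.I; Complex.I, 0]
def pauli3 : Matrix (Fin 2) (Fin 2) ℂ := !![1, 0; 0, -1]

/-- The lexicographic numbering `(a, b, c) ↦ 4 a + 2 b + c` of triples of bits. -/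
def bits : Fin 2 × Fin 2 × Fin 2 ≃ Fin 8 :=
  ((Equiv.refl (Fin 2)).prodCongr finProdFinEquiv).trans finProdFinEquiv

/-- The triple tensor product `A ⊗ B ⊗ C` as an `8 × 8` matrix. -/
def tensor3 (A B C : Matrix (Fin 2) (Fin 2) ℂ) : Mat8 :=
  Matrix.reindex bits bits (A ⊗ₖ (B ⊗ₖ C))

/-- The explicit standard gamma matrices. -/
def standardGamma : Fin 7 → Mat8 :=
  ![-tensor3 pauli2 pauli2 pauli2,
    tensor3 1 pauli1 pauli2,
    tensor3 1 pauli3 pauli2,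
    -tensor3 pauli1 pauli2 1,
    tensor3 pauli3 pauli2 1,
    tensor3 pauli2 1 pauli1,
    tensor3 pauli2 1 pauli3]

/-! ### The map `g₇` -/

/-- The oriented Fano lines `165, 134, 127, 235, 246, 367, 475`, with `1, …, 7` written as
`0, …, 6`. -/
def fanoLine : Fin 7 → Fin 3 → Fin 7 :=
  ![![0, 5, 4], ![0, 2, 3], ![0, 1, 6], ![1, 2, 4], ![1, 3, 5], ![2, 5, 6], ![3, 6, 4]]

/-- The structure constants `f_{mnk}` of the octonions: totally antisymmetric, equal to `1` on the
oriented Fano lines, and zero off the lines. -/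
def octonionF (m n k : Fin 7) : ℤ :=
  ∑ l : Fin 7, ∑ σ : Equiv.Perm (Fin 3),
    if fanoLine l (σ 0) = m ∧ fanoLine l (σ 1) = n ∧ fanoLine l (σ 2) = k
    then (Equiv.Perm.sign σ : ℤ) else 0

/-- `exp{-(1/2) α_m f_{mnk} Γ_n Γ_k}`. -/
def expMap (Γ : Fin 7 → Mat8) (a : EuclideanSpace ℝ (Fin 7)) : Mat8 :=
  NormedSpace.exp
    (-(1 / 2 : ℂ) • ∑ m, ∑ n, ∑ k, ((a m : ℂ) * (octonionF m n k : ℂ)) • (Γ n * Γ k))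

abbrev E8 : Type := EuclideanSpace ℝ (Fin 8)

/-- The unit sphere `S⁷` in `ℝ⁸`. -/
abbrev S7 : Type := Metric.sphere (0 : E8) 1

/-- The first seven coordinates of a point of `ℝ⁸`. -/
def firstSeven (x : E8) : EuclideanSpace ℝ (Fin 7) :=
  WithLp.toLp 2 fun m => x m.castSucc

/-- The vector `α` of length at most `π` that belongs to a point of the sphere,
`α_m = (x_m / ‖(x_1, …, x_7)‖) arccos x_8`. At the two poles `(x_1, …, x_7) = 0` the direction of
`α` is not determined and is taken to be the first axis; the value of `g₇` there does not depend on
this choice, because all vectors of length `π` have the same image under `expMap`. -/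
def alphaVec (x : S7) : EuclideanSpace ℝ (Fin 7) :=
  if firstSeven x = 0 then Real.arccos (x.1 7) • EuclideanSpace.single 0 1
  else (Real.arccos (x.1 7) / ‖firstSeven x‖) • firstSeven x

/-- The map `g₇` on `S⁷`. -/
def g7 (Γ : Fin 7 → Mat8) (x : S7) : Mat8 := expMap Γ (alphaVec x)

/-- The generators `Σ_{mn} = (i/2) [Γ_m, Γ_n]`. -/
def sigmaGen (Γ : Fin 7 → Mat8) (m n : Fin 7) : Mat8 :=
  (Complex.I / 2) • (Γ m * Γ n - Γ n * Γ m)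

/-- `Spin(7)` in its real eight-dimensional spinor representation: the (connected) group generated
by the exponentials `exp{i ω_{mn} Σ_{mn}}` with real `ω`. It is closed under inverses, since
the generating set is. -/
def spin7 (Γ : Fin 7 → Mat8) : Submonoid Mat8 :=
  Submonoid.closure
    (Set.range fun ω : Fin 7 → Fin 7 → ℝ =>
      NormedSpace.exp (Complex.I • ∑ m, ∑ n, (ω m n : ℂ) • sigmaGen Γ m n))

/-! ### Integration over `S⁷` and the two charges -/

/-- The extension of a map on `S⁷` to `ℝ⁸ \ {0}` that is constant along rays. -/
def radialExt (g : S7 → Mat8) (x : E8) : Mat8 :=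
  if h : x = 0 then 0
  else g ⟨‖x‖⁻¹ • x, by simp [norm_smul, h]⟩

/-- The differential `dg` at `x ∈ S⁷`, applied to `v ∈ ℝ⁸` (for `v` tangent to the sphere this is
the derivative of `g` along `v`; the radial direction is sent to zero). -/
def differential (g : S7 → Mat8) (x : S7) (v : E8) : Mat8 :=
  Matrix.of fun i j => fderiv ℝ (fun y => radialExt g y i j) x.1 v

/-- The matrix-valued one-form `g⁻¹ dg`. -/
def maurerCartan (g : S7 → Mat8) (x : S7) (v : E8) : Mat8 :=
  (g x)⁻¹ * differential g x v

/-- The pure gauge potential `A = i g⁻¹ dg`. -/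
def gaugePot (g : S7 → Mat8) (x : S7) (v : E8) : Mat8 :=
  Complex.I • maurerCartan g x v

/-- Total antisymmetrization, without a normalizing factor: the value on `v_1, …, v_7` of the wedge
product of one-forms `θ_1 ∧ ⋯ ∧ θ_7` is obtained from `F v = θ_1(v_1) ⋯ θ_7(v_7)`. -/
def wedge7 (F : (Fin 7 → E8) → ℂ) (v : Fin 7 → E8) : ℂ :=
  ∑ σ : Equiv.Perm (Fin 7), ((Equiv.Perm.sign σ : ℤ) : ℂ) * F (v ∘ σ)

/-- The seven-form `Tr (g⁻¹ dg)^7`. -/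
def chernForm (g : S7 → Mat8) (x : S7) : (Fin 7 → E8) → ℂ :=
  wedge7 fun v =>
    Matrix.trace
      (maurerCartan g x (v 0) * maurerCartan g x (v 1) * maurerCartan g x (v 2) *
        maurerCartan g x (v 3) * maurerCartan g x (v 4) * maurerCartan g x (v 5) *
        maurerCartan g x (v 6))

/-- The seven-form `ε^{abcdefgh} A^{ab} ∧ (A ∧ A)^{cd} ∧ (A ∧ A)^{ef} ∧ (A ∧ A)^{gh}`. -/
def eulerForm (g : S7 → Mat8) (x : S7) : (Fin 7 → E8) → ℂ :=
  wedge7 fun v =>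
    ∑ τ : Equiv.Perm (Fin 8), ((Equiv.Perm.sign τ : ℤ) : ℂ) *
      (gaugePot g x (v 0) (τ 0) (τ 1) *
        (gaugePot g x (v 1) * gaugePot g x (v 2)) (τ 2) (τ 3) *
        (gaugePot g x (v 3) * gaugePot g x (v 4)) (τ 4) (τ 5) *
        (gaugePot g x (v 5) * gaugePot g x (v 6)) (τ 6) (τ 7))

/-- The density, with respect to the surface measure, of a seven-form `ω` at the point `x` of `S⁷`:
the value of `x ∧ ω` (`x` as the outward conormal) on the standard basis of `ℝ⁸`. In coordinates
this is `ε_{M N_1 ⋯ N_7} x_M θ_{N_1} ⋯ θ_{N_7}` for `ω = θ ∧ ⋯ ∧ θ`, with `ε_{12345678} = 1`, so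
that `S⁷` is oriented as the boundary of the ball. -/
def formDensity (x : S7) (ω : (Fin 7 → E8) → ℂ) : ℂ :=
  ∑ M : Fin 8, (-1) ^ (M : ℕ) * (x.1 M : ℂ) *
    ω fun k => EuclideanSpace.single (M.succAbove k) (1 : ℝ)

/-- The surface measure of `S⁷`. -/
def surfaceS7 : Measure S7 := (volume : Measure E8).toSphere

/-- The volume of the unit sphere `S⁶`. -/
def volS6 : ℝ := ((volume : Measure (EuclideanSpace ℝ (Fin 7))).toSphere).real Set.univ

/-- The density of `-1/(2^7·3·35 π^4) Tr (g⁻¹ dg)^7`. -/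
def chernDensity (g : S7 → Mat8) (x : S7) : ℂ :=
  -(1 / (2 ^ 7 * 3 * 35 * (Real.pi : ℂ) ^ 4)) * formDensity x (chernForm g x)

/-- The density of
`-i/(3·2^11·35 π^4) ε^{abcdefgh} A^{ab} ∧ (A ∧ A)^{cd} ∧ (A ∧ A)^{ef} ∧ (A ∧ A)^{gh}`. -/
def eulerDensity (g : S7 → Mat8) (x : S7) : ℂ :=
  -(Complex.I / (3 * 2 ^ 11 * 35 * (Real.pi : ℂ) ^ 4)) * formDensity x (eulerForm g x)

/-- The Chern-type charge `q`. -/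
def chernCharge (g : S7 → Mat8) : ℂ := ∫ x, chernDensity g x ∂surfaceS7

/-- The Euler-type charge `q̃`. -/
def eulerCharge (g : S7 → Mat8) : ℂ := ∫ x, eulerDensity g x ∂surfaceS7

end

noncomputable section

/-! ### Real gamma matrices -/

/-! Write Γ_m = iγ_m with γ_m real, skew and of square −1. A common eigenvector η of three commuting
triple products γ_aγ_bγ_c turns the spinor space into the octonions: γ_aγ_bη = γ_cη on every
oriented Fano line, so γ_0η, …, γ_6η, η is an orthonormal basis in which the γ_m are the
multiplications by imaginary units. Every gamma system is therefore orthogonally conjugate to one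
explicit model (`IsRealGammaSystem.exists_orthogonal`). In this model the exponent belonging to a
unit vector n has square −9 on the plane of n and η and square −1 on its complement. So g₇ turns the
plane by 3α and the complement by α, and the triple angle formulas make it a cubic polynomial in x
(`exp_smul_octX`), smooth at the poles as well.

Octonion automorphisms act transitively on the directions of the first seven coordinates, and g₇ is
equivariant under them (`exists_isOctAut`, `IsOctAut.octG8`), so a point may be moved to the
meridian through the first axis. There g₇ = h² with h at half the polar angle, and in an adapted
oriented orthonormal frame dg₇ = hθh. Thus g₇⁻¹dg₇ is conjugate to θ, whose components are monomial
matrices with entries affine in c = cos α (`exists_frame`). A density can be evaluated in such a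
frame (`formDensity_wedge7`), so q reduces to the trace of the alternating product of seven explicit
matrices. This is a polynomial in c of degree at most six, and its values at seven integers
determine it (`trace_octTheta`). The integral over S⁷ follows from the moments of one coordinate,
which come from Gaussian integrals (`moment_surfaceS7`).

For q̃ the key fact is a quartic identity on spin(7) ⊂ so(8): for X orthogonal to the standard γ_m,
the contraction εXXXX equals −48 Tr X⁴ + 12 (Tr X²)² (`pfaffSum_self_eq_trace`). After polarization
it applies to one component of θ and three commutators. Antisymmetrization kills the double trace
and leaves −48 times the alternating trace (`eulerSum_eq_trace_altProd`), so the density of q̃ is −3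
times that of q at every point. Under a change of spinor basis the contraction with ε is multiplied
by the determinant, which is why R has to lie in SO(8). -/

/-- Real antisymmetric matrices `γ_m` such that the `i γ_m` form a gamma system. -/
structure IsRealGammaSystem (γ : Fin 7 → Matrix (Fin 8) (Fin 8) ℝ) : Prop where
  antisymm : ∀ m, (γ m)ᵀ = -γ m
  clifford : ∀ m n, γ m * γ n + γ n * γ m = if m = n then -2 else 0
  prod_eq : γ 0 * γ 1 * γ 2 * γ 3 * γ 4 * γ 5 * γ 6 = -1

/-- The complexification of a real matrix. -/
abbrev complexify : Matrix (Fin 8) (Fin 8) ℝ →+* Mat8 := Complex.ofRealHom.mapMatrix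

theorem complexify_injective : Function.Injective complexify := by
  intro A B h
  ext i j
  have := congrFun (congrFun h i) j
  simpa using this

theorem complexify_smul (r : ℝ) (A : Matrix (Fin 8) (Fin 8) ℝ) :
    complexify (r • A) = (r : ℂ) • complexify A := by
  ext i j
  simp

theorem complexify_transpose (A : Matrix (Fin 8) (Fin 8) ℝ) :
    complexify Aᵀ = (complexify A)ᵀ := by
  ext i j
  simp

/-- γ_m is the imaginary part of Γ_m. The product relation becomes γ_1⋯γ_7 = −1 because i⁷ = −i. -/
theorem IsGammaSystem.exists_real {Γ : Fin 7 → Mat8} (hΓ : IsGammaSystem Γ) :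
    ∃ γ : Fin 7 → Matrix (Fin 8) (Fin 8) ℝ, IsRealGammaSystem γ ∧
      ∀ m, Γ m = Complex.I • complexify (γ m) := by
  have hrep : ∀ m, Γ m = Complex.I • complexify (Matrix.of fun i j => (Γ m i j).im) := by
    intro m
    ext i j
    apply Complex.ext <;> simp [hΓ.imaginary m i j]
  refine ⟨fun m => Matrix.of fun i j => (Γ m i j).im, ⟨?_, ?_, ?_⟩, hrep⟩
  · intro m
    ext i j
    have := congrFun (congrFun (hΓ.antisymm m) i) j
    simpa using congrArg Complex.im this
  · intro m n
    apply complexify_injective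
    have h := hΓ.clifford m n
    rw [hrep m, hrep n] at h
    simp only [smul_mul_smul_comm, Complex.I_mul_I, neg_smul, one_smul] at h
    rw [map_add, map_mul, map_mul, ← neg_inj, neg_add, h]
    split_ifs
    · rw [map_neg, neg_neg, map_ofNat]
    · simp
  · apply complexify_injective
    have h := hΓ.prod_eq
    rw [hrep 0, hrep 1, hrep 2, hrep 3, hrep 4, hrep 5, hrep 6] at h
    simp only [smul_mul_smul_comm, Complex.I_mul_I] at h
    have h2 : Complex.I • complexify ((Matrix.of fun i j => (Γ 0 i j).im) *
        (Matrix.of fun i j => (Γ 1 i j).im) * (Matrix.of fun i j => (Γ 2 i j).im) *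
        (Matrix.of fun i j => (Γ 3 i j).im) * (Matrix.of fun i j => (Γ 4 i j).im) *
        (Matrix.of fun i j => (Γ 5 i j).im) * (Matrix.of fun i j => (Γ 6 i j).im)) =
        Complex.I • complexify (-1) := by
      simp only [map_mul, map_neg, map_one]
      rw [smul_neg, ← h]
      rw [← neg_smul]
      congr 1
      linear_combination (Complex.I - Complex.I ^ 3) * Complex.I_sq
    simpa using congrArg (fun A => (-Complex.I) • A) h2

/-! ### Spinors that reproduce the octonion multiplication table -/

namespace IsRealGammaSystem

variable {γ : Fin 7 → Matrix (Fin 8) (Fin 8) ℝ}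

theorem sq (hγ : IsRealGammaSystem γ) (m : Fin 7) : γ m * γ m = -1 := by
  have h := hγ.clifford m m
  rw [if_pos rfl, ← two_smul ℝ] at h
  have := congrArg (fun A => (1 / 2 : ℝ) • A) h
  simp only [smul_smul] at this
  norm_num at this
  rw [this]
  ext i j
  by_cases hij : i = j
  · subst hij
    simp [Matrix.ofNat_apply]
  · simp [Matrix.ofNat_apply, hij]

/-- Together with `sq`, `sq_mul` and `swap_mul` this sorts every word in the γ_m by increasing
index. The condition `n < m` orients the rule, so that rewriting stops at a normal form. -/
theorem swap (hγ : IsRealGammaSystem γ) {m n : Fin 7} (h : n < m) : γ m * γ n = -(γ n * γ m) := by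
  have := hγ.clifford m n
  rw [if_neg h.ne'] at this
  exact eq_neg_of_add_eq_zero_left this

theorem sq_mul (hγ : IsRealGammaSystem γ) (m : Fin 7) (A : Matrix (Fin 8) (Fin 8) ℝ) :
    γ m * (γ m * A) = -A := by
  rw [← mul_assoc, hγ.sq, neg_one_mul]

theorem swap_mul (hγ : IsRealGammaSystem γ) {m n : Fin 7} (h : n < m)
    (A : Matrix (Fin 8) (Fin 8) ℝ) : γ m * (γ n * A) = -(γ n * (γ m * A)) := by
  rw [← mul_assoc, hγ.swap h, neg_mul, mul_assoc]

/-- If the involution `K` anticommutes with the invertible `Y`, then a nonzero vector can be moved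
into the eigenspace of `K` for `-1` without leaving those of matrices commuting with both. -/
theorem exists_eigenvector_step {K Y Z : Matrix (Fin 8) (Fin 8) ℝ} (hK : K * K = 1)
    (hKY : K * Y = -(Y * K)) (hY : Z * Y = -1) {w : Fin 8 → ℝ} (hw : w ≠ 0) :
    ∃ w' : Fin 8 → ℝ, w' ≠ 0 ∧ K *ᵥ w' = -w' ∧ ∀ M, M * K = K * M → M * Y = Y * M →
      M *ᵥ w = -w → M *ᵥ w' = -w' := by
  -- As K² = 1, the vector Kw − w always lies in the eigenspace for −1. If it vanishes, w has
  -- eigenvalue 1 and Yw has eigenvalue −1.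
  by_cases h : K *ᵥ w - w = 0
  · refine ⟨Y *ᵥ w, fun h0 => hw ?_, ?_, ?_⟩
    · have : Z *ᵥ (Y *ᵥ w) = 0 := by rw [h0, mulVec_zero]
      rwa [mulVec_mulVec, hY, neg_mulVec, one_mulVec, neg_eq_zero] at this
    · rw [mulVec_mulVec, hKY, neg_mulVec, ← mulVec_mulVec, sub_eq_zero.1 h]
    · intro M _ hM hMw
      rw [mulVec_mulVec, hM, ← mulVec_mulVec, hMw, mulVec_neg]
  · refine ⟨K *ᵥ w - w, h, ?_, ?_⟩
    · rw [mulVec_sub, mulVec_mulVec, hK, one_mulVec, neg_sub]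
    · intro M hM _ hMw
      rw [mulVec_sub, mulVec_mulVec, hM, ← mulVec_mulVec, hMw, mulVec_neg]
      abel

-- Products of the γ's along Fano lines are commuting involutions. Each new one anticommutes with
-- some γ that commutes with those already treated: γ_1, then γ_5, then γ_0. The initial vector is
-- arbitrary.
set_option linter.unusedSimpArgs false in
theorem exists_vacuum (hγ : IsRealGammaSystem γ) : ∃ η : Fin 8 → ℝ, η ≠ 0 ∧
    (γ 0 * γ 5 * γ 4) *ᵥ η = -η ∧
    (γ 0 * γ 2 * γ 3) *ᵥ η = -η ∧ (γ 1 * γ 2 * γ 4) *ᵥ η = -η := by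
  have hone : (1 : Fin 8 → ℝ) ≠ 0 := one_ne_zero
  obtain ⟨w1, h1, h1a, -⟩ := exists_eigenvector_step (K := γ 0 * γ 5 * γ 4) (Y := γ 1) (Z := γ 1)
    (by simp (disch := decide) only [mul_assoc, hγ.swap, hγ.swap_mul, hγ.sq, hγ.sq_mul, mul_neg,
          neg_mul, neg_neg, mul_one])
    (by simp (disch := decide) only [mul_assoc, hγ.swap, hγ.swap_mul, hγ.sq, hγ.sq_mul, mul_neg,
          neg_mul, neg_neg, mul_one]) (hγ.sq 1) hone
  obtain ⟨w2, h2, h2a, h2b⟩ := exists_eigenvector_step (K := γ 0 * γ 2 * γ 3) (Y := γ 5) (Z := γ 5)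
    (by simp (disch := decide) only [mul_assoc, hγ.swap, hγ.swap_mul, hγ.sq, hγ.sq_mul, mul_neg,
          neg_mul, neg_neg, mul_one])
    (by simp (disch := decide) only [mul_assoc, hγ.swap, hγ.swap_mul, hγ.sq, hγ.sq_mul, mul_neg,
          neg_mul, neg_neg, mul_one]) (hγ.sq 5) h1
  have h2c := h2b (γ 0 * γ 5 * γ 4)
    (by simp (disch := decide) only [mul_assoc, hγ.swap, hγ.swap_mul, hγ.sq, hγ.sq_mul, mul_neg,
          neg_mul, neg_neg, mul_one])
    (by simp (disch := decide) only [mul_assoc, hγ.swap, hγ.swap_mul, hγ.sq, hγ.sq_mul, mul_neg,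
          neg_mul, neg_neg, mul_one]) h1a
  obtain ⟨w3, h3, h3a, h3b⟩ := exists_eigenvector_step (K := γ 1 * γ 2 * γ 4) (Y := γ 0) (Z := γ 0)
    (by simp (disch := decide) only [mul_assoc, hγ.swap, hγ.swap_mul, hγ.sq, hγ.sq_mul, mul_neg,
          neg_mul, neg_neg, mul_one])
    (by simp (disch := decide) only [mul_assoc, hγ.swap, hγ.swap_mul, hγ.sq, hγ.sq_mul, mul_neg,
          neg_mul, neg_neg, mul_one]) (hγ.sq 0) h2
  exact ⟨w3, h3,
    h3b (γ 0 * γ 5 * γ 4)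
      (by simp (disch := decide) only [mul_assoc, hγ.swap, hγ.swap_mul, hγ.sq, hγ.sq_mul, mul_neg,
          neg_mul, neg_neg, mul_one])
      (by simp (disch := decide) only [mul_assoc, hγ.swap, hγ.swap_mul, hγ.sq, hγ.sq_mul, mul_neg,
          neg_mul, neg_neg, mul_one]) h2c,
    h3b (γ 0 * γ 2 * γ 3)
      (by simp (disch := decide) only [mul_assoc, hγ.swap, hγ.swap_mul, hγ.sq, hγ.sq_mul, mul_neg,
          neg_mul, neg_neg, mul_one])
      (by simp (disch := decide) only [mul_assoc, hγ.swap, hγ.swap_mul, hγ.sq, hγ.sq_mul, mul_neg,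
          neg_mul, neg_neg, mul_one]) h2a, h3a⟩

theorem sq_mulVec (hγ : IsRealGammaSystem γ) (m : Fin 7) (w : Fin 8 → ℝ) :
    γ m *ᵥ (γ m *ᵥ w) = -w := by
  rw [mulVec_mulVec, hγ.sq, neg_mulVec, one_mulVec]

theorem swap_mulVec (hγ : IsRealGammaSystem γ) {m n : Fin 7} (h : m ≠ n) (w : Fin 8 → ℝ) :
    γ m *ᵥ (γ n *ᵥ w) = -(γ n *ᵥ (γ m *ᵥ w)) := by
  have := hγ.clifford m n
  rw [if_neg h] at this
  rw [mulVec_mulVec, eq_neg_of_add_eq_zero_left this, neg_mulVec, mulVec_mulVec]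

/-- The multiplication rule `γ_a γ_b η = γ_c η` gives the ones for the other orders of the line. -/
theorem line_rules (hγ : IsRealGammaSystem γ) {a b c : Fin 7} (hab : a ≠ b) (hac : a ≠ c)
    {η : Fin 8 → ℝ}
    (h : γ a *ᵥ (γ b *ᵥ η) = γ c *ᵥ η) :
    γ a *ᵥ (γ b *ᵥ η) = γ c *ᵥ η ∧ γ b *ᵥ (γ a *ᵥ η) = -(γ c *ᵥ η) ∧
      γ b *ᵥ (γ c *ᵥ η) = γ a *ᵥ η ∧ γ c *ᵥ (γ b *ᵥ η) = -(γ a *ᵥ η) ∧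
      γ c *ᵥ (γ a *ᵥ η) = γ b *ᵥ η ∧ γ a *ᵥ (γ c *ᵥ η) = -(γ b *ᵥ η) := by
  have h1 : γ b *ᵥ (γ a *ᵥ η) = -(γ c *ᵥ η) := by rw [hγ.swap_mulVec hab.symm, h]
  have h2 : γ b *ᵥ (γ c *ᵥ η) = γ a *ᵥ η := by
    rw [← h, hγ.swap_mulVec hab.symm, hγ.sq_mulVec, mulVec_neg, neg_neg]
  have h3 : γ a *ᵥ (γ c *ᵥ η) = -(γ b *ᵥ η) := by rw [← h, hγ.sq_mulVec]
  have h4 : γ c *ᵥ (γ a *ᵥ η) = γ b *ᵥ η := by rw [hγ.swap_mulVec hac.symm, h3, neg_neg]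
  have h5 : γ c *ᵥ (γ b *ᵥ η) = -(γ a *ᵥ η) := by
    rw [← h4, hγ.sq_mulVec]
  exact ⟨h, h1, h2, h5, h4, h3⟩

/-- Moving γ_c to the front passes two anticommuting factors, so γ_cγ_aγ_bη = −η. Applying γ_c once
more gives the claim. -/
theorem mulVec_of_triple (hγ : IsRealGammaSystem γ) {a b c : Fin 7} (hbc : b ≠ c) (hac : a ≠ c)
    {η : Fin 8 → ℝ}
    (h : (γ a * γ b * γ c) *ᵥ η = -η) : γ a *ᵥ (γ b *ᵥ η) = γ c *ᵥ η := by
  rw [← mulVec_mulVec, ← mulVec_mulVec, hγ.swap_mulVec hbc, mulVec_neg, hγ.swap_mulVec hac,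
    neg_neg] at h
  rw [← neg_inj, ← hγ.sq_mulVec c, h, mulVec_neg]

/-- The products `γ_m γ_l η` follow the octonion multiplication table. -/
theorem exists_octonion_vacuum (hγ : IsRealGammaSystem γ) : ∃ η : Fin 8 → ℝ, η ⬝ᵥ η = 1 ∧
    γ 0 *ᵥ (γ 5 *ᵥ η) = γ 4 *ᵥ η ∧ γ 0 *ᵥ (γ 2 *ᵥ η) = γ 3 *ᵥ η ∧
    γ 0 *ᵥ (γ 1 *ᵥ η) = γ 6 *ᵥ η ∧ γ 1 *ᵥ (γ 2 *ᵥ η) = γ 4 *ᵥ η ∧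
    γ 1 *ᵥ (γ 3 *ᵥ η) = γ 5 *ᵥ η ∧ γ 2 *ᵥ (γ 5 *ᵥ η) = γ 6 *ᵥ η ∧
    γ 3 *ᵥ (γ 6 *ᵥ η) = γ 4 *ᵥ η := by
  obtain ⟨ξ, hξ, h0, h1, h3⟩ := hγ.exists_vacuum
  have hpos : 0 < ξ ⬝ᵥ ξ := by
    have h := dotProduct_star_self_pos_iff (v := ξ)
    simpa using h.2 hξ
  obtain ⟨η, hη, h0, h1, h3⟩ : ∃ η : Fin 8 → ℝ, η ⬝ᵥ η = 1 ∧ (γ 0 * γ 5 * γ 4) *ᵥ η = -η ∧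
      (γ 0 * γ 2 * γ 3) *ᵥ η = -η ∧ (γ 1 * γ 2 * γ 4) *ᵥ η = -η := by
    refine ⟨(Real.sqrt (ξ ⬝ᵥ ξ))⁻¹ • ξ, ?_, ?_, ?_, ?_⟩
    · rw [smul_dotProduct, dotProduct_smul, smul_smul, ← mul_inv, Real.mul_self_sqrt hpos.le,
        smul_eq_mul, inv_mul_cancel₀ hpos.ne']
    all_goals simp only [mulVec_smul, h0, h1, h3, smul_neg]
  have e0 := hγ.mulVec_of_triple (by decide) (by decide) h0
  have e1 := hγ.mulVec_of_triple (by decide) (by decide) h1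
  have e3 := hγ.mulVec_of_triple (by decide) (by decide) h3
  obtain ⟨-, a1, a2, a3, a4, a5⟩ := hγ.line_rules (by decide) (by decide) e0
  obtain ⟨-, b1, b2, b3, b4, b5⟩ := hγ.line_rules (by decide) (by decide) e1
  obtain ⟨-, c1, c2, c3, c4, c5⟩ := hγ.line_rules (by decide) (by decide) e3
  -- This is where the product relation enters. With γ_6 moved to the third place, the remaining
  -- tail γ_2γ_3γ_4γ_5η collapses to η by the rules of the first two lines. The opposite sign of the
  -- full product would reverse this line.
  have e2 : γ 0 *ᵥ (γ 1 *ᵥ η) = γ 6 *ᵥ η := by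
    apply hγ.mulVec_of_triple (by decide) (by decide)
    have h : (γ 0 * γ 1 * γ 2 * γ 3 * γ 4 * γ 5 * γ 6) *ᵥ η = (-1 : Matrix _ _ ℝ) *ᵥ η := by
      rw [hγ.prod_eq]
    simp only [← mulVec_mulVec, neg_mulVec, one_mulVec] at h ⊢
    rw [hγ.swap_mulVec (show (5 : Fin 7) ≠ 6 by decide), mulVec_neg,
      hγ.swap_mulVec (show (4 : Fin 7) ≠ 6 by decide), neg_neg,
      hγ.swap_mulVec (show (3 : Fin 7) ≠ 6 by decide), mulVec_neg,
      hγ.swap_mulVec (show (2 : Fin 7) ≠ 6 by decide), mulVec_neg] at h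
    simp only [mulVec_neg] at h
    rw [a3] at h
    simp only [mulVec_neg, neg_neg] at h
    rw [b4] at h
    rw [show γ 2 *ᵥ (γ 2 *ᵥ η) = -η from hγ.sq_mulVec 2 η] at h
    simpa only [neg_neg, mulVec_neg] using h
  have e4 : γ 1 *ᵥ (γ 3 *ᵥ η) = γ 5 *ᵥ η := by
    rw [← e1, hγ.swap_mulVec (by decide), e3, a5, neg_neg]
  have e5 : γ 2 *ᵥ (γ 5 *ᵥ η) = γ 6 *ᵥ η := by
    rw [← e4, hγ.swap_mulVec (by decide), b2, ← hγ.swap_mulVec (by decide), e2]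
  have e6 : γ 3 *ᵥ (γ 6 *ᵥ η) = γ 4 *ᵥ η := by
    rw [← e2, hγ.swap_mulVec (by decide), hγ.swap_mulVec (show (3 : Fin 7) ≠ 1 by decide),
      mulVec_neg, neg_neg, e4, e0]
  exact ⟨η, hη, e0, e1, e2, e3, e4, e5, e6⟩

end IsRealGammaSystem

/-! ### The octonionic model -/

/-- The index of the imaginary unit that takes the `j`-th spinor basis vector to the `i`-th one. -/
def octIndex : Fin 8 → Fin 8 → Fin 7 :=
  ![![0, 6, 3, 2, 5, 4, 1, 0],
    ![6, 0, 4, 5, 2, 3, 0, 1],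
    ![3, 4, 0, 0, 1, 6, 5, 2],
    ![2, 5, 0, 0, 6, 1, 4, 3],
    ![5, 2, 1, 6, 0, 0, 3, 4],
    ![4, 3, 6, 1, 0, 0, 2, 5],
    ![1, 0, 5, 4, 3, 2, 0, 6],
    ![0, 1, 2, 3, 4, 5, 6, 0]]

/-- The coefficients of the exponent of `g₇` in the octonionic spinor basis. -/
def octSign : Fin 8 → Fin 8 → ℤ :=
  ![![0, 1, 1, -1, -1, 1, -1, 3],
    ![-1, 0, 1, 1, -1, -1, 1, 3],
    ![-1, -1, 0, 1, 1, 1, -1, 3],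
    ![1, -1, -1, 0, -1, 1, 1, 3],
    ![1, 1, -1, 1, 0, -1, -1, 3],
    ![-1, 1, -1, -1, 1, 0, 1, 3],
    ![1, -1, 1, -1, 1, -1, 0, 3],
    ![-3, -3, -3, -3, -3, -3, -3, 0]]

/-- The coefficients of the multiplication by an imaginary octonion. -/
def octMulSign : Fin 8 → Fin 8 → ℤ :=
  ![![0, -1, -1, 1, 1, -1, 1, 1],
    ![1, 0, -1, -1, 1, 1, -1, 1],
    ![1, 1, 0, -1, -1, -1, 1, 1],
    ![-1, 1, 1, 0, 1, -1, -1, 1],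
    ![-1, -1, 1, -1, 0, 1, 1, 1],
    ![1, -1, 1, 1, -1, 0, -1, 1],
    ![-1, 1, -1, 1, -1, 1, 0, 1],
    ![-1, -1, -1, -1, -1, -1, -1, 0]]

/-- The exponent of `g₇` in the octonionic spinor basis. -/
def octX {R : Type*} [CommRing R] (v : Fin 7 → R) : Matrix (Fin 8) (Fin 8) R :=
  Matrix.of fun i j => (octSign i j : R) * v (octIndex i j)

/-- The model gamma matrices: multiplication by the imaginary octonion units. -/
def octGamma (R : Type*) [CommRing R] (m : Fin 7) : Matrix (Fin 8) (Fin 8) R :=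
  Matrix.of fun i j => if octIndex i j = m then (octMulSign i j : R) else 0

theorem octX_explicit {R : Type*} [CommRing R] (v : Fin 7 → R) : octX v =
  !![0, v 6, v 3, -v 2, -v 5, v 4, -v 1, 3 * v 0;
    -v 6, 0, v 4, v 5, -v 2, -v 3, v 0, 3 * v 1;
    -v 3, -v 4, 0, v 0, v 1, v 6, -v 5, 3 * v 2;
    v 2, -v 5, -v 0, 0, -v 6, v 1, v 4, 3 * v 3;
    v 5, v 2, -v 1, v 6, 0, -v 0, -v 3, 3 * v 4;
    -v 4, v 3, -v 6, -v 1, v 0, 0, v 2, 3 * v 5;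
    v 1, -v 0, v 5, -v 4, v 3, -v 2, 0, 3 * v 6;
    -3 * v 0, -3 * v 1, -3 * v 2, -3 * v 3, -3 * v 4, -3 * v 5, -3 * v 6, 0] := by
  ext i j
  fin_cases i <;> fin_cases j <;> simp [octX, octSign, octIndex]

/-- The columns of R are γ_0η, …, γ_6η, η. They are orthonormal because the γ_m are skew,
anticommute and square to −1, and the line rules say that γ_m acts on them by the octonion table.
The determinant of R is not controlled; this matters only for q̃. -/
theorem IsRealGammaSystem.exists_orthogonal {γ : Fin 7 → Matrix (Fin 8) (Fin 8) ℝ}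
    (hγ : IsRealGammaSystem γ) :
    ∃ R ∈ Matrix.orthogonalGroup (Fin 8) ℝ, ∀ m, γ m = R * octGamma ℝ m * Rᵀ := by
  obtain ⟨η, hη, e0, e1, e2, e3, e4, e5, e6⟩ := hγ.exists_octonion_vacuum
  obtain ⟨-, a1, a2, a3, a4, a5⟩ := hγ.line_rules (by decide) (by decide) e0
  obtain ⟨-, b1, b2, b3, b4, b5⟩ := hγ.line_rules (by decide) (by decide) e1
  obtain ⟨-, c1, c2, c3, c4, c5⟩ := hγ.line_rules (by decide) (by decide) e2
  obtain ⟨-, d1, d2, d3, d4, d5⟩ := hγ.line_rules (by decide) (by decide) e3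
  obtain ⟨-, f1, f2, f3, f4, f5⟩ := hγ.line_rules (by decide) (by decide) e4
  obtain ⟨-, g1, g2, g3, g4, g5⟩ := hγ.line_rules (by decide) (by decide) e5
  obtain ⟨-, k1, k2, k3, k4, k5⟩ := hγ.line_rules (by decide) (by decide) e6
  let b : Fin 8 → Fin 8 → ℝ := ![γ 0 *ᵥ η, γ 1 *ᵥ η, γ 2 *ᵥ η, γ 3 *ᵥ η, γ 4 *ᵥ η, γ 5 *ᵥ η,
    γ 6 *ᵥ η, η]
  let R : Matrix (Fin 8) (Fin 8) ℝ := (Matrix.of b)ᵀ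
  have hskew : ∀ (m : Fin 7) (u w : Fin 8 → ℝ), u ⬝ᵥ (γ m *ᵥ w) = -((γ m *ᵥ u) ⬝ᵥ w) := by
    intro m u w
    rw [dotProduct_mulVec, ← mulVec_transpose, hγ.antisymm, neg_mulVec, neg_dotProduct]
  have hdiag : ∀ m, (γ m *ᵥ η) ⬝ᵥ (γ m *ᵥ η) = 1 := by
    intro m
    rw [hskew, hγ.sq_mulVec, neg_dotProduct, neg_neg, hη]
  have hoff : ∀ m n, m ≠ n → (γ m *ᵥ η) ⬝ᵥ (γ n *ᵥ η) = 0 := by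
    intro m n hmn
    have h1 := hskew n (γ m *ᵥ η) η
    rw [hγ.swap_mulVec hmn.symm, neg_dotProduct, neg_neg] at h1
    have h2 := hskew m (γ n *ᵥ η) η
    rw [dotProduct_comm] at h2
    linarith
  have hη0 : ∀ m, (γ m *ᵥ η) ⬝ᵥ η = 0 := by
    intro m
    have h1 := hskew m η η
    rw [dotProduct_comm] at h1
    linarith
  have hη1 : ∀ m, η ⬝ᵥ (γ m *ᵥ η) = 0 := fun m => by rw [dotProduct_comm, hη0]
  have hbb : ∀ i j, b i ⬝ᵥ b j = (1 : Matrix (Fin 8) (Fin 8) ℝ) i j := by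
    intro i j
    fin_cases i <;> fin_cases j <;> simp [b, hdiag, hη, hη0, hη1, hoff]
  have hRR : Rᵀ * R = 1 := by
    ext i j
    rw [← hbb]
    simp [R, Matrix.mul_apply, dotProduct]
  have hRR' : R * Rᵀ = 1 := mul_eq_one_comm.1 hRR
  refine ⟨R, ?_, fun m => ?_⟩
  · rw [Matrix.mem_orthogonalGroup_iff]
    exact hRR'
  have hcol : γ m * R = R * octGamma ℝ m := by
    have : ∀ j, γ m *ᵥ b j = ∑ k, octGamma ℝ m k j • b k := by
      intro j
      fin_cases m <;> fin_cases j <;>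
        simp [b, octGamma, octIndex, octMulSign, Fin.sum_univ_eight, hγ.sq_mulVec, e0, e1, e2, e3, e4, e5, e6,
          a1, a2, a3, a4, a5, b1, b2, b3, b4, b5, c1, c2, c3, c4, c5, d1, d2, d3, d4, d5,
          f1, f2, f3, f4, f5, g1, g2, g3, g4, g5, k1, k2, k3, k4, k5]
    ext i j
    have h := congrFun (this j) i
    simp only [Finset.sum_apply, Pi.smul_apply, smul_eq_mul] at h
    rw [Matrix.mul_apply]
    rw [Matrix.mulVec, dotProduct] at h
    simp only [R, Matrix.transpose_apply, Matrix.of_apply, Matrix.mul_apply]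
    rw [h]
    exact Finset.sum_congr rfl fun k _ => mul_comm _ _
  rw [← hcol, mul_assoc, hRR', mul_one]

end

/-! ### The exponent of g₇ in the octonionic basis -/

noncomputable section

/-- The pairs `(n, k)` with `f_{mnk} = 1`, one from each of the three lines through `m`. -/
def fanoPair : Fin 7 → Fin 3 → Fin 7 × Fin 7 :=
  ![![(5, 4), (2, 3), (1, 6)], ![(6, 0), (2, 4), (3, 5)], ![(3, 0), (4, 1), (5, 6)],
    ![(0, 2), (5, 1), (6, 4)], ![(0, 5), (1, 2), (3, 6)], ![(4, 0), (1, 3), (6, 2)],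
    ![(0, 1), (2, 5), (4, 3)]]

-- Integer form of the statement that `octX` of the m-th unit is the sum of γ_nγ_k over the three
-- lines through m. All three products send η to γ_mη, which explains the entries 3 in the last
-- column of `octSign`.
set_option maxRecDepth 100000 in
theorem sum_fanoPair_octMulSign : ∀ m i j,
    (∑ t, ∑ k, (if octIndex i k = (fanoPair m t).1 then octMulSign i k else 0) *
      (if octIndex k j = (fanoPair m t).2 then octMulSign k j else 0)) =
      if octIndex i j = m then octSign i j else 0 := by
  decide +kernel

theorem sum_perm_fin_three {M : Type*} [AddCommGroup M] (F : Fin 3 → Fin 3 → Fin 3 → M) :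
    ∑ σ : Equiv.Perm (Fin 3), (Equiv.Perm.sign σ : ℤ) • F (σ 0) (σ 1) (σ 2) =
      F 0 1 2 + F 1 2 0 + F 2 0 1 - F 1 0 2 - F 0 2 1 - F 2 1 0 := by
  have h : (Finset.univ : Finset (Equiv.Perm (Fin 3))) = {1, Equiv.swap 0 1, Equiv.swap 0 2,
    Equiv.swap 1 2, Equiv.swap 0 1 * Equiv.swap 1 2, Equiv.swap 1 2 * Equiv.swap 0 1} := by decide
  rw [h]
  repeat rw [Finset.sum_insert (by decide)]
  rw [Finset.sum_singleton]
  simp [Equiv.Perm.mul_apply, Equiv.swap_apply_def]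
  abel

/-- Sums against the structure constants are sums over the oriented lines. -/
theorem sum_octonionF_smul {M : Type*} [AddCommGroup M] (B : Fin 7 → Fin 7 → Fin 7 → M) :
    ∑ m, ∑ n, ∑ k, octonionF m n k • B m n k =
      ∑ l, ∑ σ : Equiv.Perm (Fin 3), (Equiv.Perm.sign σ : ℤ) •
        B (fanoLine l (σ 0)) (fanoLine l (σ 1)) (fanoLine l (σ 2)) := by
  have h : ∀ m n k, octonionF m n k • B m n k = ∑ l : Fin 7, ∑ σ : Equiv.Perm (Fin 3),
      if fanoLine l (σ 0) = m then if fanoLine l (σ 1) = n then if fanoLine l (σ 2) = k then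
        (Equiv.Perm.sign σ : ℤ) • B m n k else 0 else 0 else 0 := by
    intro m n k
    simp only [octonionF, Finset.sum_smul, ite_and, ite_smul, zero_smul]
  simp only [h]
  rw [Finset.sum_congr rfl fun m _ => Finset.sum_congr rfl fun n _ => Finset.sum_comm]
  rw [Finset.sum_congr rfl fun m _ => Finset.sum_comm, Finset.sum_comm]
  refine Finset.sum_congr rfl fun l _ => ?_
  rw [Finset.sum_congr rfl fun m _ => Finset.sum_congr rfl fun n _ => Finset.sum_comm]
  rw [Finset.sum_congr rfl fun m _ => Finset.sum_comm, Finset.sum_comm]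
  refine Finset.sum_congr rfl fun σ _ => ?_
  simp

/-- Each line contributes six orderings: three choices of m, each with (n, k) and (k, n).
Antisymmetry of B makes the last two equal after the sign of f, whence the factor 2. -/
theorem sum_octonionF_real {M : Type*} [AddCommGroup M] [Module ℝ M] (a : Fin 7 → ℝ)
    (B : Fin 7 → Fin 7 → M) (hB : ∀ m n, m ≠ n → B m n = -B n m) :
    ∑ m, ∑ n, ∑ k, (a m * octonionF m n k) • B n k =
      (2 : ℝ) • ∑ m, a m • ∑ t, B (fanoPair m t).1 (fanoPair m t).2 := by
  have h1 : ∀ m n k, (a m * octonionF m n k) • B n k = octonionF m n k • (a m • B n k) := by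
    intro m n k
    rw [mul_comm, mul_smul, Int.cast_smul_eq_zsmul]
  simp only [h1]
  rw [sum_octonionF_smul fun m n k => a m • B n k]
  have h2 := fun l => sum_perm_fin_three fun i j k =>
    a (fanoLine l i) • B (fanoLine l j) (fanoLine l k)
  simp only [h2]
  simp only [Fin.sum_univ_seven, Fin.sum_univ_three]
  simp only [fanoLine, fanoPair, Matrix.cons_val]
  simp (disch := decide) only [hB 1 0, hB 2 0, hB 3 0, hB 4 0, hB 5 0, hB 6 0, hB 2 1, hB 3 1,
    hB 4 1, hB 5 1, hB 6 1, hB 3 2, hB 4 2, hB 5 2, hB 6 2, hB 4 3, hB 5 3, hB 6 3, hB 5 4, hB 6 4,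
    hB 6 5]
  module

theorem octX_add {R : Type*} [CommRing R] (v w : Fin 7 → R) : octX (v + w) = octX v + octX w := by
  ext i j
  simp [octX, mul_add]

theorem octX_smul {R : Type*} [CommRing R] (r : R) (v : Fin 7 → R) :
    octX (r • v) = r • octX v := by
  ext i j
  simp [octX, mul_left_comm]

theorem octIndex_symm : ∀ i j, octIndex i j = octIndex j i := by decide +kernel

theorem octSign_antisymm : ∀ i j, octSign i j = -octSign j i := by decide +kernel

theorem octX_transpose {R : Type*} [CommRing R] (v : Fin 7 → R) : (octX v)ᵀ = -octX v := by
  ext i j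
  rw [Matrix.transpose_apply, Matrix.neg_apply, octX, Matrix.of_apply, Matrix.of_apply,
    octIndex_symm, octSign_antisymm]
  simp

/-- `octX` as a linear map. -/
def octXLin : (Fin 7 → ℝ) →ₗ[ℝ] Matrix (Fin 8) (Fin 8) ℝ where
  toFun := octX
  map_add' := octX_add
  map_smul' := octX_smul

theorem sum_fanoPair_octGamma (m : Fin 7) :
    ∑ t, octGamma ℝ (fanoPair m t).1 * octGamma ℝ (fanoPair m t).2 =
      octX (Pi.single m (1 : ℝ)) := by
  ext i j
  have h := congrArg (Int.cast : ℤ → ℝ) (sum_fanoPair_octMulSign m i j)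
  push_cast at h
  simp only [Matrix.sum_apply, Matrix.mul_apply, octGamma, octX, Matrix.of_apply]
  rw [h]
  simp [Pi.single_apply]

/-- The sum in the exponent of `g₇`, for gamma matrices that are conjugate to the model. -/
theorem half_sum_octonionF {γ : Fin 7 → Matrix (Fin 8) (Fin 8) ℝ} (hc : IsRealGammaSystem γ)
    {R : Matrix (Fin 8) (Fin 8) ℝ} (hR : R ∈ Matrix.orthogonalGroup (Fin 8) ℝ)
    (hγ : ∀ m, γ m = R * octGamma ℝ m * Rᵀ) (a : Fin 7 → ℝ) :
    (1 / 2 : ℝ) • ∑ m, ∑ n, ∑ k, (a m * octonionF m n k) • (γ n * γ k) = R * octX a * Rᵀ := by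
  have hRR : Rᵀ * R = 1 := (Matrix.mem_orthogonalGroup_iff' (Fin 8) ℝ).1 hR
  have hprod : ∀ n k, γ n * γ k = R * (octGamma ℝ n * octGamma ℝ k) * Rᵀ := by
    intro n k
    rw [hγ n, hγ k]
    calc R * octGamma ℝ n * Rᵀ * (R * octGamma ℝ k * Rᵀ)
        = R * octGamma ℝ n * (Rᵀ * R) * octGamma ℝ k * Rᵀ := by simp only [mul_assoc]
      _ = _ := by rw [hRR, mul_one]; simp only [mul_assoc]
  have hX : octX a = ∑ m, a m • octX (Pi.single m (1 : ℝ)) := by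
    have h1 : octXLin a = octXLin (∑ m, a m • Pi.single m (1 : ℝ)) := by
      congr 1
      ext k
      simp [Finset.sum_apply, Pi.single_apply]
    rw [map_sum] at h1
    simpa [octXLin, octX_smul] using h1
  rw [sum_octonionF_real a (fun n k => γ n * γ k), smul_smul, hX]
  · simp only [hprod, ← sum_fanoPair_octGamma, Finset.mul_sum, Finset.sum_mul, Finset.smul_sum,
      Matrix.mul_smul, Matrix.smul_mul]
    norm_num
  · intro m n hmn
    have := hc.clifford m n
    rw [if_neg hmn] at this
    exact eq_neg_of_add_eq_zero_left this

/-! ### The polynomial form of `g₇` -/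

/-- The inclusion of `ℝ⁷` as the first seven coordinates. -/
def incl7 (v : Fin 7 → ℝ) : Fin 8 → ℝ := Fin.snoc v 0

/-- The last basis vector. -/
def lastVec : Fin 8 → ℝ := Pi.single 7 1

theorem incl7_dotProduct (v w : Fin 7 → ℝ) : incl7 v ⬝ᵥ incl7 w = v ⬝ᵥ w := by
  have h : ∀ u : Fin 7 → ℝ, (Fin.snoc u 0 : Fin 8 → ℝ) (Fin.last 7) = 0 :=
    fun u => Fin.snoc_last (α := fun _ => ℝ) 0 u
  simp [dotProduct, Fin.sum_univ_castSucc, incl7, -Fin.reduceLast, h]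

theorem incl7_dotProduct_lastVec (v : Fin 7 → ℝ) : incl7 v ⬝ᵥ lastVec = 0 := by
  simp [lastVec, incl7]
  exact Fin.snoc_last (α := fun _ => ℝ) 0 v

theorem lastVec_dotProduct_incl7 (v : Fin 7 → ℝ) : lastVec ⬝ᵥ incl7 v = 0 := by
  rw [dotProduct_comm, incl7_dotProduct_lastVec]

theorem lastVec_dotProduct_lastVec : lastVec ⬝ᵥ lastVec = 1 := by simp [lastVec]

theorem incl7_explicit (v : Fin 7 → ℝ) :
    incl7 v = ![v 0, v 1, v 2, v 3, v 4, v 5, v 6, 0] := by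
  ext i
  fin_cases i <;> rfl

/-- With `octX_mulVec_lastVec`, this shows that the plane of v and the last axis is invariant and
that `octX v` acts on it as 3‖v‖ times a quarter turn. -/
theorem octX_mulVec_incl7 (v : Fin 7 → ℝ) : octX v *ᵥ incl7 v = -(3 * (v ⬝ᵥ v)) • lastVec := by
  rw [incl7_explicit, octX_explicit]
  ext i
  fin_cases i <;> simp [lastVec, Matrix.mulVec, dotProduct, Fin.sum_univ_succ] <;> ring

theorem octX_mulVec_lastVec (v : Fin 7 → ℝ) : octX v *ᵥ lastVec = (3 : ℝ) • incl7 v := by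
  rw [incl7_explicit, octX_explicit]
  ext i
  fin_cases i <;> simp [lastVec]

/-- The symmetric part `⟨v,w⟩ e eᵀ + v wᵀ`, where `e` is the last basis vector. -/
def octN (v w : Fin 7 → ℝ) : Matrix (Fin 8) (Fin 8) ℝ :=
  (v ⬝ᵥ w) • vecMulVec lastVec lastVec + vecMulVec (incl7 v) (incl7 w)

/-- The antisymmetric matrix `v eᵀ - e vᵀ`, where `e` is the last basis vector. -/
def octW (v : Fin 7 → ℝ) : Matrix (Fin 8) (Fin 8) ℝ :=
  vecMulVec (incl7 v) lastVec - vecMulVec lastVec (incl7 v)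

theorem octN_transpose (v w : Fin 7 → ℝ) : (octN v w)ᵀ = octN w v := by
  simp [octN, dotProduct_comm]

theorem octW_transpose (v : Fin 7 → ℝ) : (octW v)ᵀ = -octW v := by
  simp [octW]

/-- `octN v v` is ‖v‖² times the projection onto the plane of v and the last axis. The square is
thus −9‖v‖² on this plane and −‖v‖² on its complement. -/
theorem octX_mul_octX (v : Fin 7 → ℝ) :
    octX v * octX v = -(v ⬝ᵥ v) • (1 : Matrix (Fin 8) (Fin 8) ℝ) - (8 : ℝ) • octN v v := by
  have hl : lastVec = ![0, 0, 0, 0, 0, 0, 0, 1] := by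
    ext i
    fin_cases i <;> rfl
  have hv : v ⬝ᵥ v = v 0 * v 0 + v 1 * v 1 + v 2 * v 2 + v 3 * v 3 + v 4 * v 4 + v 5 * v 5 +
      v 6 * v 6 := by
    rw [dotProduct, Fin.sum_univ_seven]
  rw [octN, incl7_explicit, hl, hv, octX_explicit]
  ext i j
  rw [Matrix.mul_apply, Fin.sum_univ_eight]
  simp only [Matrix.sub_apply, Matrix.smul_apply, Matrix.add_apply, vecMulVec_apply,
    Matrix.one_apply]
  fin_cases i <;> fin_cases j <;> simp <;> ring

theorem octX_mul_octN (v : Fin 7 → ℝ) : octX v * octN v v = (3 * (v ⬝ᵥ v)) • octW v := by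
  simp only [octN, octW, mul_add, Matrix.mul_smul, mul_vecMulVec, octX_mulVec_incl7,
    octX_mulVec_lastVec, smul_vecMulVec, smul_sub, smul_smul]
  module

theorem octX_mul_octW (v : Fin 7 → ℝ) : octX v * octW v = -(3 : ℝ) • octN v v := by
  simp only [octN, octW, mul_sub, mul_vecMulVec, octX_mulVec_incl7,
    octX_mulVec_lastVec, smul_vecMulVec, smul_add, smul_smul]
  module

theorem octN_mul_octX (v : Fin 7 → ℝ) : octN v v * octX v = (3 * (v ⬝ᵥ v)) • octW v := by
  have h := congrArg Matrix.transpose (octX_mul_octN v)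
  rw [transpose_mul, transpose_smul, octX_transpose, octN_transpose, octW_transpose, mul_neg,
    smul_neg, neg_inj] at h
  exact h

theorem octW_mul_octX (v : Fin 7 → ℝ) : octW v * octX v = -(3 : ℝ) • octN v v := by
  have h := congrArg Matrix.transpose (octX_mul_octW v)
  rw [transpose_mul, transpose_smul, octX_transpose, octN_transpose, octW_transpose, neg_mul_neg]
    at h
  exact h

theorem octN_mul_octN (v : Fin 7 → ℝ) : octN v v * octN v v = (v ⬝ᵥ v) • octN v v := by
  simp only [octN, mul_add, add_mul, Matrix.mul_smul, Matrix.smul_mul, vecMulVec_mul_vecMulVec,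
    incl7_dotProduct, incl7_dotProduct_lastVec, lastVec_dotProduct_incl7,
    lastVec_dotProduct_lastVec]
  simp
  try module

theorem octN_mul_octW (v : Fin 7 → ℝ) : octN v v * octW v = (v ⬝ᵥ v) • octW v := by
  simp only [octN, octW, mul_sub, add_mul, Matrix.smul_mul,
    vecMulVec_mul_vecMulVec,
    incl7_dotProduct, incl7_dotProduct_lastVec, lastVec_dotProduct_incl7,
    lastVec_dotProduct_lastVec]
  simp
  try module

theorem octW_mul_octN (v : Fin 7 → ℝ) : octW v * octN v v = (v ⬝ᵥ v) • octW v := by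
  have h := congrArg Matrix.transpose (octN_mul_octW v)
  rw [transpose_mul, transpose_smul, octN_transpose, octW_transpose, neg_mul, smul_neg,
    neg_inj] at h
  exact h

theorem octW_mul_octW (v : Fin 7 → ℝ) : octW v * octW v = -octN v v := by
  simp only [octN, octW, mul_sub, sub_mul,
    vecMulVec_mul_vecMulVec,
    incl7_dotProduct, incl7_dotProduct_lastVec, lastVec_dotProduct_incl7,
    lastVec_dotProduct_lastVec]
  simp
  try module

/-- The map `g₇` in the octonionic spinor basis, as a polynomial in `x = (v, c)`. -/
def octG (v : Fin 7 → ℝ) (c : ℝ) : Matrix (Fin 8) (Fin 8) ℝ :=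
  c • (1 : Matrix (Fin 8) (Fin 8) ℝ) + octX v - (4 * c) • octN v v - (4 * (v ⬝ᵥ v)) • octW v

theorem octG_transpose_mul {v : Fin 7 → ℝ} {c : ℝ} (h : v ⬝ᵥ v + c ^ 2 = 1) :
    (octG v c)ᵀ * octG v c = 1 := by
  have hs : v ⬝ᵥ v = 1 - c ^ 2 := by linarith
  simp only [octG, transpose_sub, transpose_add, transpose_smul, octX_transpose, octN_transpose,
    octW_transpose, transpose_one, mul_sub, sub_mul, mul_add, add_mul, neg_mul,
    Matrix.mul_smul, Matrix.smul_mul, octX_mul_octX, octX_mul_octN, octX_mul_octW, octN_mul_octX,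
    octW_mul_octX, octN_mul_octN, octN_mul_octW, octW_mul_octN, octW_mul_octW, mul_one, one_mul,
    mul_neg, smul_neg, smul_smul, hs]
  match_scalars <;> ring

theorem octG_mem_orthogonalGroup {v : Fin 7 → ℝ} {c : ℝ} (h : v ⬝ᵥ v + c ^ 2 = 1) :
    octG v c ∈ Matrix.orthogonalGroup (Fin 8) ℝ := by
  rw [Matrix.mem_orthogonalGroup_iff']
  exact octG_transpose_mul h

-- The cubic terms of `octG` come from cos 3t = cos t − 4 cos t sin²t and sin 3t = 3 sin t − 4 sin³t
-- on the invariant plane. Both sides solve Y' = XY with Y(0) = 1: the derivative of exp(−tX) times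
-- the right side vanishes.
open scoped Matrix.Norms.Operator in
theorem exp_smul_octX {n : Fin 7 → ℝ} (hn : n ⬝ᵥ n = 1) (t : ℝ) :
    NormedSpace.exp (t • octX n) = octG (Real.sin t • n) (Real.cos t) := by
  have hG : ∀ t : ℝ, octG (Real.sin t • n) (Real.cos t) =
      Real.cos t • (1 : Matrix (Fin 8) (Fin 8) ℝ) + Real.sin t • octX n -
        (4 * Real.cos t * Real.sin t ^ 2) • octN n n - (4 * Real.sin t ^ 3) • octW n := by
    intro t
    have h1 : incl7 (Real.sin t • n) = Real.sin t • incl7 n := by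
      rw [incl7_explicit, incl7_explicit]
      simp
    simp only [octG, octN, octW, octX_smul, h1, smul_vecMulVec, vecMulVec_smul, smul_dotProduct,
      dotProduct_smul, hn, smul_eq_mul]
    match_scalars <;> ring
  have hder : ∀ t : ℝ, HasDerivAt (fun t => octG (Real.sin t • n) (Real.cos t))
      (octX n * octG (Real.sin t • n) (Real.cos t)) t := by
    intro t
    have hX := octX_mul_octX n
    have hN := octX_mul_octN n
    rw [hn] at hX hN
    have hs := Real.hasDerivAt_sin t
    have hc := Real.hasDerivAt_cos t
    have h1 := (((hc.smul_const (1 : Matrix (Fin 8) (Fin 8) ℝ)).add (hs.smul_const (octX n))).sub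
      (((hc.const_mul 4).mul (hs.pow 2)).smul_const (octN n n))).sub
        (((hs.pow 3).const_mul 4).smul_const (octW n))
    rw [funext hG]
    refine h1.congr_deriv ?_
    rw [hG t]
    have hcc : Real.cos t ^ 2 = 1 - Real.sin t ^ 2 := Real.cos_sq' t
    simp only [mul_add, mul_sub, Matrix.mul_smul, hX, hN, octX_mul_octW, mul_one, smul_sub,
      smul_smul]
    match_scalars
    all_goals try simp only [Pi.pow_apply]
    all_goals push_cast; ring_nf
    all_goals try (rw [hcc]; ring)
  have hF : ∀ t : ℝ, HasDerivAt (fun t => NormedSpace.exp ((-t) • octX n) *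
      octG (Real.sin t • n) (Real.cos t)) 0 t := by
    intro t
    have h1 := (hasDerivAt_exp_smul_const (𝕂 := ℝ) (octX n) (-t)).scomp t (hasDerivAt_neg t)
    have h2 := h1.mul (hder t)
    refine h2.congr_deriv ?_
    simp [mul_assoc]
  have hconst := is_const_of_deriv_eq_zero (fun t => (hF t).differentiableAt)
    (fun t => (hF t).deriv) t 0
  have h0 : octG (Real.sin 0 • n) (Real.cos 0) = 1 := by
    rw [hG]
    simp
  rw [h0] at hconst
  simp only [neg_zero, zero_smul, NormedSpace.exp_zero, mul_one] at hconst
  rw [neg_smul, Matrix.exp_neg] at hconst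
  have hu := Matrix.isUnit_exp (t • octX n)
  have hdet := (Matrix.isUnit_iff_isUnit_det _).1 hu
  calc NormedSpace.exp (t • octX n)
      = NormedSpace.exp (t • octX n) * ((NormedSpace.exp (t • octX n))⁻¹ *
          octG (Real.sin t • n) (Real.cos t)) := by rw [hconst, mul_one]
    _ = _ := by rw [Matrix.mul_nonsing_inv_cancel_left _ _ hdet]

end

noncomputable section

/-! ### The exponential and the polynomial form -/

theorem exp_complexify (A : Matrix (Fin 8) (Fin 8) ℝ) :
    NormedSpace.exp (complexify A) = complexify (NormedSpace.exp A) := by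
  let _ : NormedRing (Matrix (Fin 8) (Fin 8) ℝ) := Matrix.linftyOpNormedRing
  let _ : NormedAlgebra ℝ (Matrix (Fin 8) (Fin 8) ℝ) := Matrix.linftyOpNormedAlgebra
  let _ : NormedAlgebra ℚ (Matrix (Fin 8) (Fin 8) ℝ) := NormedAlgebra.restrictScalars ℚ ℝ _
  let _ : NormedRing Mat8 := Matrix.linftyOpNormedRing
  let _ : NormedAlgebra ℝ Mat8 := Matrix.linftyOpNormedAlgebra
  have hc : Continuous complexify := by
    refine continuous_matrix fun i j => ?_
    exact Complex.continuous_ofReal.comp (continuous_id.matrix_elem i j)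
  exact (NormedSpace.map_exp complexify hc A).symm

theorem real_inner_self_eq_dotProduct {n : ℕ} (a : EuclideanSpace ℝ (Fin n)) :
    (a : Fin n → ℝ) ⬝ᵥ a = ‖a‖ ^ 2 := by
  rw [EuclideanSpace.real_norm_sq_eq, dotProduct]
  exact Finset.sum_congr rfl fun i _ => (sq _).symm

theorem exp_octX (a : EuclideanSpace ℝ (Fin 7)) :
    NormedSpace.exp (octX (a : Fin 7 → ℝ)) =
      octG (Real.sinc ‖a‖ • (a : Fin 7 → ℝ)) (Real.cos ‖a‖) := by
  by_cases ha : a = 0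
  · subst ha
    have h0 : octX (0 : Fin 7 → ℝ) = 0 := by simpa using octX_smul (0 : ℝ) (0 : Fin 7 → ℝ)
    have h1 : incl7 0 = 0 := by
      rw [incl7_explicit]
      ext i
      fin_cases i <;> rfl
    simp [octG, h0, octN, octW, h1]
  · have hn : ‖a‖ ≠ 0 := norm_ne_zero_iff.2 ha
    have h1 : (‖a‖⁻¹ • (a : Fin 7 → ℝ)) ⬝ᵥ (‖a‖⁻¹ • (a : Fin 7 → ℝ)) = 1 := by
      rw [smul_dotProduct, dotProduct_smul, real_inner_self_eq_dotProduct]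
      simp only [smul_eq_mul]
      field_simp
    have h2 := exp_smul_octX h1 ‖a‖
    rw [← octX_smul, smul_smul, smul_smul, mul_inv_cancel₀ hn, one_smul] at h2
    rw [h2, Real.sinc_of_ne_zero hn, div_eq_mul_inv]

/-- The minus sign of the exponent cancels against Γ_nΓ_k = −γ_nγ_k, and the exponential commutes
with conjugation. The same R serves the gamma matrices and the exponentials, so the orientation of
the spinor basis can be compared later. -/
theorem IsGammaSystem.exists_model {Γ : Fin 7 → Mat8} (hΓ : IsGammaSystem Γ) :
    ∃ R ∈ Matrix.orthogonalGroup (Fin 8) ℝ,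
      (∀ m, Γ m = Complex.I • complexify (R * octGamma ℝ m * Rᵀ)) ∧
      ∀ a : EuclideanSpace ℝ (Fin 7), expMap Γ a =
        complexify (R * octG (Real.sinc ‖a‖ • (a : Fin 7 → ℝ)) (Real.cos ‖a‖) * Rᵀ) := by
  obtain ⟨γ, hγ, hΓγ⟩ := hΓ.exists_real
  obtain ⟨R, hR, hRγ⟩ := hγ.exists_orthogonal
  have hRR : R * Rᵀ = 1 := (Matrix.mem_orthogonalGroup_iff (Fin 8) ℝ).1 hR
  have hinv : R⁻¹ = Rᵀ := Matrix.inv_eq_right_inv hRR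
  refine ⟨R, hR, fun m => by rw [hΓγ, hRγ], fun a => ?_⟩
  have h1 : (-(1 / 2 : ℂ) • ∑ m, ∑ n, ∑ k, ((a m : ℂ) * (octonionF m n k : ℂ)) • (Γ n * Γ k)) =
      complexify (R * octX (a : Fin 7 → ℝ) * Rᵀ) := by
    rw [← half_sum_octonionF hγ hR hRγ, complexify_smul]
    simp only [map_sum, complexify_smul, map_mul, hΓγ, smul_mul_smul_comm, Complex.I_mul_I,
      Finset.smul_sum, smul_smul]
    refine Finset.sum_congr rfl fun m _ => Finset.sum_congr rfl fun n _ =>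
      Finset.sum_congr rfl fun k _ => ?_
    push_cast
    congr 1
    ring
  rw [expMap, h1, exp_complexify, ← hinv,
    Matrix.exp_conj _ _ ⟨⟨R, Rᵀ, hRR, mul_eq_one_comm.1 hRR⟩, rfl⟩, exp_octX]

/-! ### The vector `α` of a point of the sphere -/

theorem norm_firstSeven_sq (x : E8) : ‖firstSeven x‖ ^ 2 + x 7 ^ 2 = ‖x‖ ^ 2 := by
  rw [EuclideanSpace.real_norm_sq_eq, EuclideanSpace.real_norm_sq_eq,
    Fin.sum_univ_castSucc (fun i : Fin 8 => x i ^ 2)]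
  rfl

theorem sphere_norm_sq (x : S7) : ‖firstSeven x.1‖ ^ 2 + x.1 7 ^ 2 = 1 := by
  rw [norm_firstSeven_sq, norm_eq_of_mem_sphere]
  norm_num

theorem alphaVec_spec (x : S7) : Real.sinc ‖alphaVec x‖ • alphaVec x = firstSeven x.1 ∧
    Real.cos ‖alphaVec x‖ = x.1 7 := by
  have hs := sphere_norm_sq x
  have hle : x.1 7 ^ 2 ≤ 1 := by nlinarith [sq_nonneg ‖firstSeven x.1‖]
  have h1 : -1 ≤ x.1 7 := by nlinarith
  have h2 : x.1 7 ≤ 1 := by nlinarith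
  have h0 : 0 ≤ Real.arccos (x.1 7) := Real.arccos_nonneg _
  unfold alphaVec
  split_ifs with h
  · have hx : x.1 7 ^ 2 = 1 := by simpa [h] using hs
    rw [norm_smul, PiLp.norm_single, norm_one, mul_one, Real.norm_of_nonneg h0]
    refine ⟨?_, Real.cos_arccos h1 h2⟩
    rw [h, smul_smul]
    -- At one pole arccos is 0, at the other sinc π = 0; the arbitrary direction chosen there drops
    -- out.
    have : Real.sinc (Real.arccos (x.1 7)) * Real.arccos (x.1 7) = 0 := by
      rcases eq_or_eq_neg_of_sq_eq_sq (x.1 7) 1 (by simpa using hx) with h | h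
      · simp [h]
      · simp [h, Real.sinc_of_ne_zero Real.pi_ne_zero]
    rw [this, zero_smul]
  · have hn : ‖firstSeven x.1‖ ≠ 0 := norm_ne_zero_iff.2 h
    have hnn : ‖(Real.arccos (x.1 7) / ‖firstSeven x.1‖) • firstSeven x.1‖ =
        Real.arccos (x.1 7) := by
      rw [norm_smul, Real.norm_of_nonneg (div_nonneg h0 (norm_nonneg _)), div_mul_cancel₀ _ hn]
    rw [hnn]
    refine ⟨?_, Real.cos_arccos h1 h2⟩
    have ha : Real.arccos (x.1 7) ≠ 0 := by
      intro h3
      rw [Real.arccos_eq_zero] at h3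
      have : x.1 7 = 1 := le_antisymm h2 h3
      rw [this] at hs
      apply hn
      nlinarith
    rw [Real.sinc_of_ne_zero ha, smul_smul, Real.sin_arccos]
    have h4 : Real.sqrt (1 - x.1 7 ^ 2) = ‖firstSeven x.1‖ := by
      rw [show 1 - x.1 7 ^ 2 = ‖firstSeven x.1‖ ^ 2 by linarith, Real.sqrt_sq (norm_nonneg _)]
    rw [h4]
    field_simp
    simp

/-- `g₇` at a point of the sphere, relative to a frame `R` of the octonionic spinor basis. -/
theorem g7_eq_of_model {Γ : Fin 7 → Mat8} {R : Matrix (Fin 8) (Fin 8) ℝ}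
    (hR : ∀ a : EuclideanSpace ℝ (Fin 7), expMap Γ a =
      complexify (R * octG (Real.sinc ‖a‖ • (a : Fin 7 → ℝ)) (Real.cos ‖a‖) * Rᵀ)) (x : S7) :
    g7 Γ x = complexify (R * octG (firstSeven x.1) (x.1 7) * Rᵀ) := by
  obtain ⟨h1, h2⟩ := alphaVec_spec x
  rw [g7, hR, h2, ← h1]
  rfl

theorem g7_eq_expMap {Γ : Fin 7 → Mat8} (hΓ : IsGammaSystem Γ) (a : EuclideanSpace ℝ (Fin 7))
    (x : S7) (hx : ∀ m : Fin 7, x.1 m.castSucc = Real.sinc ‖a‖ * a m)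
    (hx7 : x.1 7 = Real.cos ‖a‖) : g7 Γ x = expMap Γ a := by
  obtain ⟨R, -, -, hR⟩ := hΓ.exists_model
  rw [g7_eq_of_model hR, hR, hx7]
  congr 4
  ext m
  exact hx m

theorem octonionF_swap (m n k : Fin 7) : octonionF m k n = -octonionF m n k := by
  simp only [octonionF, ← Finset.sum_neg_distrib]
  refine Finset.sum_congr rfl fun l _ => ?_
  refine Fintype.sum_equiv (Equiv.mulRight (Equiv.swap 1 2)) _ _ fun σ => ?_
  have h0 : (Equiv.swap (1 : Fin 3) 2) 0 = 0 := by decide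
  simp only [Equiv.coe_mulRight, Equiv.Perm.mul_apply, Equiv.swap_apply_left,
    Equiv.swap_apply_right, h0, Equiv.Perm.sign_mul]
  rw [Equiv.Perm.sign_swap (by decide)]
  by_cases h : fanoLine l (σ 0) = m ∧ fanoLine l (σ 1) = k ∧ fanoLine l (σ 2) = n
  · rw [if_pos h, if_pos ⟨h.1, h.2.2, h.2.1⟩]
    simp
  · rw [if_neg h, if_neg fun h' => h ⟨h'.1, h'.2.2, h'.2.1⟩, neg_zero]

theorem g7_mem_spin7 (Γ : Fin 7 → Mat8) (x : S7) : g7 Γ x ∈ spin7 Γ := by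
  -- Since iΣ_{nk} = −½[Γ_n, Γ_k] and f is antisymmetric in its last two indices, the choice ω_{nk}
  -- = ½ α_m f_{mnk} reproduces the exponent −½ α_m f_{mnk}Γ_nΓ_k.
  refine Submonoid.subset_closure ⟨fun n k => 1 / 2 * ∑ m, alphaVec x m * octonionF m n k, ?_⟩
  simp only [g7, expMap]
  congr 1
  have h1 : ∀ n k, Complex.I •
      (((1 / 2 * ∑ m, alphaVec x m * octonionF m n k : ℝ) : ℂ) • sigmaGen Γ n k) =
      (-(1 / 4 : ℂ)) • ((∑ m, ((alphaVec x m : ℂ) * (octonionF m n k : ℂ)) • (Γ n * Γ k)) +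
        ∑ m, ((alphaVec x m : ℂ) * (octonionF m k n : ℂ)) • (Γ k * Γ n)) := by
    intro n k
    rw [sigmaGen, ← Finset.sum_smul, ← Finset.sum_smul]
    have h2 : ∑ m, ((alphaVec x m : ℂ) * (octonionF m k n : ℂ)) =
        -∑ m, ((alphaVec x m : ℂ) * (octonionF m n k : ℂ)) := by
      rw [← Finset.sum_neg_distrib]
      refine Finset.sum_congr rfl fun m _ => ?_
      rw [octonionF_swap]
      push_cast
      ring
    rw [h2]
    push_cast
    generalize (∑ m, ((alphaVec x m : ℂ) * (octonionF m n k : ℂ))) = S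
    match_scalars
    · linear_combination (S / 4) * Complex.I_sq
    · linear_combination (-S / 4) * Complex.I_sq
  have h3 : ∀ B : Fin 7 → Fin 7 → Fin 7 → Mat8, ∑ n, ∑ k, (-(1 / 4 : ℂ)) •
      ((∑ m, B m n k) + ∑ m, B m k n) = (-(1 / 2 : ℂ)) • ∑ m, ∑ n, ∑ k, B m n k := by
    intro B
    have h4 : ∑ n, ∑ k, ∑ m, B m n k = ∑ m, ∑ n, ∑ k, B m n k := by
      rw [Finset.sum_congr rfl fun n _ => Finset.sum_comm, Finset.sum_comm]
    have h5 : ∑ n, ∑ k, ∑ m, B m k n = ∑ m, ∑ n, ∑ k, B m n k := by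
      rw [Finset.sum_comm, h4]
    simp only [← Finset.smul_sum, Finset.sum_add_distrib, h4, h5]
    module
  rw [← h3]
  rw [Finset.smul_sum]
  refine Finset.sum_congr rfl fun n _ => ?_
  rw [Finset.smul_sum]
  exact Finset.sum_congr rfl fun k _ => h1 n k

/-- The exponential of a real antisymmetric matrix is a rotation. -/
theorem exp_mem_specialOrthogonalGroup {B : Matrix (Fin 8) (Fin 8) ℝ} (hB : Bᵀ = -B) :
    NormedSpace.exp B ∈ Matrix.specialOrthogonalGroup (Fin 8) ℝ := by
  have horth : ∀ B : Matrix (Fin 8) (Fin 8) ℝ, Bᵀ = -B →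
      NormedSpace.exp B ∈ Matrix.orthogonalGroup (Fin 8) ℝ := by
    intro B hB
    have hdet := (Matrix.isUnit_iff_isUnit_det _).1 (Matrix.isUnit_exp B)
    rw [Matrix.mem_orthogonalGroup_iff, ← Matrix.exp_transpose, hB, Matrix.exp_neg, Matrix.mul_nonsing_inv _ hdet]
  rw [Matrix.mem_specialOrthogonalGroup_iff]
  refine ⟨horth B hB, ?_⟩
  -- The determinant is the square of that of exp(B/2), which is ±1 by orthogonality.
  have hhalf : NormedSpace.exp B =
      NormedSpace.exp ((1 / 2 : ℝ) • B) * NormedSpace.exp ((1 / 2 : ℝ) • B) := by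
    rw [← Matrix.exp_add_of_commute _ _ (Commute.refl _), ← two_smul ℝ, smul_smul]
    norm_num
  have h := horth ((1 / 2 : ℝ) • B) (by rw [transpose_smul, hB, smul_neg])
  rw [Matrix.mem_orthogonalGroup_iff] at h
  have hd := congrArg Matrix.det h
  rw [det_mul, det_transpose, det_one] at hd
  rw [hhalf, det_mul, hd]

theorem spin7_le {Γ : Fin 7 → Mat8} (hΓ : IsGammaSystem Γ) {O : Mat8} (hO : O ∈ spin7 Γ) :
    ∃ R ∈ Matrix.specialOrthogonalGroup (Fin 8) ℝ, O = R.map Complex.ofReal := by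
  obtain ⟨γ, hγ, hΓγ⟩ := hΓ.exists_real
  induction hO using Submonoid.closure_induction with
  | mem O hO =>
    obtain ⟨ω, rfl⟩ := hO
    -- In terms of the real matrices iΣ_{mn} = ½[γ_m, γ_n], which is real and skew.
    refine ⟨NormedSpace.exp (∑ m, ∑ n, (ω m n / 2) • (γ m * γ n - γ n * γ m)),
      exp_mem_specialOrthogonalGroup ?_, ?_⟩
    · simp only [transpose_sum, transpose_smul, transpose_sub, transpose_mul, hγ.antisymm,
        neg_mul_neg, ← Finset.sum_neg_distrib]
      refine Finset.sum_congr rfl fun m _ => Finset.sum_congr rfl fun n _ => ?_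
      module
    · refine Eq.trans ?_ (exp_complexify _)
      dsimp only
      congr 1
      simp only [map_sum, complexify_smul, map_sub, map_mul, Finset.smul_sum, sigmaGen, hΓγ,
        smul_mul_smul_comm, Complex.I_mul_I]
      refine Finset.sum_congr rfl fun m _ => Finset.sum_congr rfl fun n _ => ?_
      push_cast
      match_scalars
      · linear_combination (-(ω m n : ℂ) / 2) * Complex.I_sq
      · linear_combination ((ω m n : ℂ) / 2) * Complex.I_sq
  | one => exact ⟨1, one_mem _, by simp⟩
  | mul O₁ O₂ _ _ h₁ h₂ =>
    obtain ⟨R₁, hR₁, rfl⟩ := h₁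
    obtain ⟨R₂, hR₂, rfl⟩ := h₂
    exact ⟨R₁ * R₂, mul_mem hR₁ hR₂, (map_mul complexify R₁ R₂).symm⟩

/-! ### Smoothness -/

theorem incl7_apply (v : Fin 7 → ℝ) (i : Fin 8) :
    incl7 v i = ∑ m : Fin 7, v m * (if m.castSucc = i then 1 else 0) := by
  refine Fin.lastCases ?_ (fun k => ?_) i
  · have : ∀ m : Fin 7, m.castSucc ≠ Fin.last 7 := fun m => (Fin.castSucc_lt_last m).ne
    simp only [this, if_false, mul_zero, Finset.sum_const_zero]
    exact Fin.snoc_last (α := fun _ => ℝ) 0 v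
  · simp only [Fin.castSucc_inj, mul_ite, mul_one, mul_zero, Finset.sum_ite_eq',
      Finset.mem_univ, if_true]
    exact Fin.snoc_castSucc (α := fun _ => ℝ) 0 v k

theorem octG_apply (v : Fin 7 → ℝ) (c : ℝ) (i j : Fin 8) :
    octG v c i j = c * (1 : Matrix (Fin 8) (Fin 8) ℝ) i j + octSign i j * v (octIndex i j) -
      4 * c * ((∑ m, v m * v m) * (lastVec i * lastVec j) + incl7 v i * incl7 v j) -
      4 * (∑ m, v m * v m) * (incl7 v i * lastVec j - lastVec i * incl7 v j) := by
  simp [octG, octX, octN, octW, vecMulVec_apply, dotProduct]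
  ring

theorem contDiffOn_octG {E : Type*} [NormedAddCommGroup E] [NormedSpace ℝ E] {s : Set E}
    {v : E → Fin 7 → ℝ} {c : E → ℝ} {n : WithTop ℕ∞} (hv : ∀ m, ContDiffOn ℝ n (fun y => v y m) s)
    (hc : ContDiffOn ℝ n c s) (i j : Fin 8) :
    ContDiffOn ℝ n (fun y => octG (v y) (c y) i j) s := by
  have hs : ContDiffOn ℝ n (fun y => ∑ m, v y m * v y m) s :=
    ContDiffOn.sum fun m _ => (hv m).mul (hv m)
  have hu : ∀ i, ContDiffOn ℝ n (fun y => incl7 (v y) i) s := by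
    intro i
    simp only [incl7_apply]
    exact ContDiffOn.sum fun m _ => (hv m).mul contDiffOn_const
  simp only [octG_apply]
  have h1 := hv (octIndex i j)
  have h2 := hu i
  have h3 := hu j
  fun_prop

theorem radialExt_g7 {Γ : Fin 7 → Mat8} {R : Matrix (Fin 8) (Fin 8) ℝ}
    (hR : ∀ a : EuclideanSpace ℝ (Fin 7), expMap Γ a =
      complexify (R * octG (Real.sinc ‖a‖ • (a : Fin 7 → ℝ)) (Real.cos ‖a‖) * Rᵀ)) {y : E8}
    (hy : y ≠ 0) : radialExt (g7 Γ) y =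
      complexify (R * octG (fun m => ‖y‖⁻¹ * y m.castSucc) (‖y‖⁻¹ * y 7) * Rᵀ) := by
  rw [radialExt, dif_neg hy, g7_eq_of_model hR]
  rfl

theorem contDiffOn_normalize (k : Fin 8) :
    ContDiffOn ℝ (⊤ : ℕ∞) (fun y : E8 => ‖y‖⁻¹ * y k) {0}ᶜ := by
  have h1 : ContDiffOn ℝ (⊤ : ℕ∞) (fun y : E8 => ‖y‖) {0}ᶜ :=
    fun y hy => (contDiffAt_norm ℝ hy).contDiffWithinAt
  have h2 : ContDiffOn ℝ (⊤ : ℕ∞) (fun y : E8 => y k) {0}ᶜ := by fun_prop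
  exact (h1.inv fun y hy => norm_ne_zero_iff.2 hy).mul h2

/-- In the model g₇ is a polynomial in the coordinates of y/‖y‖, so the poles need no separate
treatment. -/
theorem contDiffOn_radialExt_g7 {Γ : Fin 7 → Mat8} (hΓ : IsGammaSystem Γ) (i j : Fin 8) :
    ContDiffOn ℝ (⊤ : ℕ∞) (fun y => radialExt (g7 Γ) y i j) {0}ᶜ := by
  obtain ⟨R, -, -, hR⟩ := hΓ.exists_model
  have h1 : ContDiffOn ℝ (⊤ : ℕ∞) (fun y : E8 => ∑ k, (∑ l, R i l *
      octG (fun m => ‖y‖⁻¹ * y m.castSucc) (‖y‖⁻¹ * y 7) l k) * R j k) {0}ᶜ := by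
    refine ContDiffOn.sum fun k _ => ContDiffOn.mul (ContDiffOn.sum fun l _ =>
      contDiffOn_const.mul ?_) contDiffOn_const
    exact contDiffOn_octG (fun m => contDiffOn_normalize m.castSucc) (contDiffOn_normalize 7) l k
  refine (Complex.ofRealCLM.contDiff.comp_contDiffOn h1).congr fun y hy => ?_
  rw [radialExt_g7 hR hy]
  simp [Matrix.mul_apply]

end

noncomputable section

/-! ### Moments of the sphere -/

instance : IsFiniteMeasure surfaceS7 := by
  unfold surfaceS7
  infer_instance

/-- Polar coordinates in ℝ⁸, with f extended constantly along rays. A Gaussian φ turns sphere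
integrals into integrals over ℝ⁸. -/
theorem integral_surfaceS7_mul (f : S7 → ℝ) (φ : ℝ → ℝ) :
    ∫ y : E8, (if h : y = 0 then 0 else f ⟨‖y‖⁻¹ • y, by simp [norm_smul, h]⟩) * φ ‖y‖ =
      (∫ x, f x ∂surfaceS7) * ∫ r in Set.Ioi (0 : ℝ), r ^ 7 * φ r := by
  have hdim : Module.finrank ℝ E8 = 8 := by simp
  calc ∫ y : E8, (if h : y = 0 then 0 else f ⟨‖y‖⁻¹ • y, by simp [norm_smul, h]⟩) * φ ‖y‖
      = ∫ y : ({0}ᶜ : Set E8), (if h : y.1 = 0 then 0 else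
          f ⟨‖y.1‖⁻¹ • y.1, by simp [norm_smul, h]⟩) * φ ‖y.1‖ ∂((volume : Measure E8).comap (↑)) := by
        rw [integral_subtype_comap (measurableSet_singleton _).compl fun y : E8 =>
          (if h : y = 0 then 0 else f ⟨‖y‖⁻¹ • y, by simp [norm_smul, h]⟩) * φ ‖y‖,
          restrict_compl_singleton]
    _ = ∫ y : ({0}ᶜ : Set E8), (fun p : S7 × Set.Ioi (0 : ℝ) => f p.1 * φ p.2)
          (homeomorphUnitSphereProd E8 y) ∂((volume : Measure E8).comap (↑)) := by
        congr 1
        ext y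
        rw [dif_neg (show ¬(y : E8) = 0 from y.2)]
        simp only [homeomorphUnitSphereProd_apply_snd_coe]
        congr 2
        ext1
        simp
    _ = ∫ p, f p.1 * φ p.2 ∂surfaceS7.prod (.volumeIoiPow (Module.finrank ℝ E8 - 1)) :=
      (volume : Measure E8).measurePreserving_homeomorphUnitSphereProd.integral_comp
        (Homeomorph.measurableEmbedding _) fun p : S7 × Set.Ioi (0 : ℝ) => f p.1 * φ p.2
    _ = (∫ x, f x ∂surfaceS7) * ∫ r : Set.Ioi (0 : ℝ), φ r ∂.volumeIoiPow 7 := by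
      rw [hdim]
      exact integral_prod_mul f fun r : Set.Ioi (0 : ℝ) => φ r
    _ = _ := by
      congr 1
      simp only [Measure.volumeIoiPow, ENNReal.ofReal]
      rw [integral_withDensity_eq_integral_smul,
        integral_subtype_comap measurableSet_Ioi fun a ↦ Real.toNNReal (a ^ 7) • φ a,
        setIntegral_congr_fun measurableSet_Ioi fun x hx ↦ ?_]
      · rw [NNReal.smul_def, Real.coe_toNNReal _ (pow_nonneg hx.out.le _), smul_eq_mul]
      · exact (measurable_subtype_coe.pow_const _).real_toNNReal

theorem integral_Ioi_pow_mul_exp (n : ℕ) :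
    ∫ r in Set.Ioi (0 : ℝ), r ^ n * Real.exp (-r ^ 2) = 1 / 2 * Real.Gamma ((n + 1) / 2) := by
  have h := integral_rpow_mul_exp_neg_rpow (p := 2) (q := n) (by norm_num)
    (by have := Nat.cast_nonneg (α := ℝ) n; linarith)
  rw [← h]
  refine setIntegral_congr_fun measurableSet_Ioi fun x _ => ?_
  simp

theorem integral_even_pow_mul_exp (k : ℕ) :
    ∫ t : ℝ, t ^ (2 * k) * Real.exp (-t ^ 2) = Real.Gamma (k + 1 / 2) := by
  have h := integral_comp_abs (f := fun t : ℝ => t ^ (2 * k) * Real.exp (-t ^ 2))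
  simp only [sq_abs, pow_mul] at h
  simp only [pow_mul]
  rw [h]
  simp only [← pow_mul]
  rw [integral_Ioi_pow_mul_exp]
  push_cast
  rw [← mul_assoc]
  norm_num
  congr 1
  ring

theorem integral_E8_pow_mul_exp (k : ℕ) :
    ∫ y : E8, y 7 ^ (2 * k) * Real.exp (-‖y‖ ^ 2) =
      Real.Gamma (1 / 2) ^ 7 * Real.Gamma (k + 1 / 2) := by
  rw [← (PiLp.volume_preserving_toLp (Fin 8)).integral_comp
    (MeasurableEquiv.toLp 2 (Fin 8 → ℝ)).measurableEmbedding]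
  let F : Fin 8 → ℝ → ℝ := fun i t => t ^ (2 * (if i = 7 then k else 0)) * Real.exp (-t ^ 2)
  have h1 : ∀ y : Fin 8 → ℝ, (WithLp.toLp 2 y : E8) 7 ^ (2 * k) *
      Real.exp (-‖(WithLp.toLp 2 y : E8)‖ ^ 2) = ∏ i, F i (y i) := by
    intro y
    rw [EuclideanSpace.real_norm_sq_eq, ← Finset.sum_neg_distrib, Real.exp_sum,
      Finset.prod_mul_distrib]
    congr 1
    simp
  simp only [h1]
  rw [integral_fintype_prod_volume_eq_prod]
  simp only [F, integral_even_pow_mul_exp]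
  rw [Fin.prod_univ_castSucc]
  have h2 : ∀ i : Fin 7, (i.castSucc = (7 : Fin 8)) = False := fun i =>
    eq_false (Fin.castSucc_lt_last i).ne
  simp only [h2, if_false, Nat.cast_zero, zero_add, Finset.prod_const, Finset.card_univ,
    Fintype.card_fin]
  rfl

/-- The integral of y_8^{2k} exp(−‖y‖²) over ℝ⁸, computed once in polar coordinates and once as a
product of one-dimensional integrals. -/
theorem moment_surfaceS7 (k : ℕ) :
    (∫ x, x.1 7 ^ (2 * k) ∂surfaceS7) * (1 / 2 * Real.Gamma (k + 4)) =
      Real.sqrt Real.pi ^ 7 * Real.Gamma (k + 1 / 2) := by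
  have h := integral_surfaceS7_mul (fun x => x.1 7 ^ (2 * k))
    fun r => r ^ (2 * k) * Real.exp (-r ^ 2)
  rw [← Real.Gamma_one_half_eq, ← integral_E8_pow_mul_exp]
  have h2 : ∫ r in Set.Ioi (0 : ℝ), r ^ 7 * (r ^ (2 * k) * Real.exp (-r ^ 2)) =
      1 / 2 * Real.Gamma (k + 4) := by
    simp only [← mul_assoc, ← pow_add]
    rw [integral_Ioi_pow_mul_exp]
    congr 2
    push_cast
    ring
  rw [h2] at h
  rw [← h]
  refine integral_congr_ae ?_
  have h0 : ∀ᵐ y : E8, y ≠ 0 := by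
    simp [ae_iff]
  filter_upwards [h0] with y hy
  rw [dif_neg hy]
  have hn : ‖y‖ ≠ 0 := norm_ne_zero_iff.2 hy
  simp only [PiLp.smul_apply, smul_eq_mul, mul_pow, inv_pow]
  field_simp

theorem sqrt_pi_pow_eight : Real.sqrt Real.pi ^ 8 = Real.pi ^ 4 := by
  rw [show (8 : ℕ) = 2 * 4 by norm_num, pow_mul, Real.sq_sqrt Real.pi_pos.le]

theorem integral_sphere_pow_two : ∫ x, x.1 7 ^ 2 ∂surfaceS7 = Real.pi ^ 4 / 24 := by
  have h := moment_surfaceS7 1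
  have g1 : Real.Gamma (((1 : ℕ) : ℝ) + 4) = 24 := by
    rw [show (((1 : ℕ) : ℝ) + 4) = ((4 : ℕ) : ℝ) + 1 by norm_num, Real.Gamma_nat_eq_factorial]
    norm_num [Nat.factorial]
  have g2 : Real.Gamma (((1 : ℕ) : ℝ) + 1 / 2) = 1 / 2 * Real.sqrt Real.pi := by
    rw [← Real.Gamma_one_half_eq, ← Real.Gamma_add_one (by norm_num)]
    norm_num
  rw [g1, g2] at h
  rw [← sqrt_pi_pow_eight]
  linear_combination h / 12

theorem integral_sphere_pow_four : ∫ x, x.1 7 ^ 4 ∂surfaceS7 = Real.pi ^ 4 / 80 := by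
  have h := moment_surfaceS7 2
  have g1 : Real.Gamma (((2 : ℕ) : ℝ) + 4) = 120 := by
    rw [show (((2 : ℕ) : ℝ) + 4) = ((5 : ℕ) : ℝ) + 1 by norm_num, Real.Gamma_nat_eq_factorial]
    norm_num [Nat.factorial]
  have g2 : Real.Gamma (((2 : ℕ) : ℝ) + 1 / 2) = 3 / 4 * Real.sqrt Real.pi := by
    rw [show (((2 : ℕ) : ℝ) + 1 / 2) = 1 / 2 + 1 + 1 by norm_num, Real.Gamma_add_one (by norm_num),
      Real.Gamma_add_one (by norm_num), Real.Gamma_one_half_eq]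
    ring
  rw [g1, g2] at h
  rw [← sqrt_pi_pow_eight]
  linear_combination h / 60

theorem integral_sphere_pow_six : ∫ x, x.1 7 ^ 6 ∂surfaceS7 = Real.pi ^ 4 / 192 := by
  have h := moment_surfaceS7 3
  have g1 : Real.Gamma (((3 : ℕ) : ℝ) + 4) = 720 := by
    rw [show (((3 : ℕ) : ℝ) + 4) = ((6 : ℕ) : ℝ) + 1 by norm_num, Real.Gamma_nat_eq_factorial]
    norm_num [Nat.factorial]
  have g2 : Real.Gamma (((3 : ℕ) : ℝ) + 1 / 2) = 15 / 8 * Real.sqrt Real.pi := by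
    rw [show (((3 : ℕ) : ℝ) + 1 / 2) = 1 / 2 + 1 + 1 + 1 by norm_num,
      Real.Gamma_add_one (by norm_num), Real.Gamma_add_one (by norm_num),
      Real.Gamma_add_one (by norm_num), Real.Gamma_one_half_eq]
    ring
  rw [g1, g2] at h
  rw [← sqrt_pi_pow_eight]
  linear_combination h / 360

theorem volS6_eq : volS6 = 16 * Real.pi ^ 3 / 15 := by
  rw [volS6, Measure.toSphere_real_apply_univ, Measure.real, EuclideanSpace.volume_ball]
  have h : Real.Gamma ((Fintype.card (Fin 7) : ℝ) / 2 + 1) = 105 / 16 * Real.sqrt Real.pi := by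
    rw [Fintype.card_fin, show ((7 : ℕ) : ℝ) / 2 + 1 = 1 / 2 + 1 + 1 + 1 + 1 by norm_num,
      Real.Gamma_add_one (by norm_num), Real.Gamma_add_one (by norm_num),
      Real.Gamma_add_one (by norm_num), Real.Gamma_add_one (by norm_num), Real.Gamma_one_half_eq]
    ring
  have hs : Real.sqrt Real.pi ≠ 0 := (Real.sqrt_pos.2 Real.pi_pos).ne'
  have h6 : Real.sqrt Real.pi ^ 6 = Real.pi ^ 3 := by
    rw [show (6 : ℕ) = 2 * 3 by norm_num, pow_mul, Real.sq_sqrt Real.pi_pos.le]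
  rw [h]
  simp only [ENNReal.ofReal_one, one_pow, one_mul]
  rw [ENNReal.toReal_ofReal (by positivity), Fintype.card_fin]
  rw [finrank_euclideanSpace, Fintype.card_fin, ← h6]
  field_simp
  norm_num

theorem integral_polar : ∫ α in (0 : ℝ)..Real.pi, Real.sin α ^ 6 * Real.cos α ^ 2 *
    (2 * Real.cos α ^ 4 + 5 * Real.cos α ^ 2 + 2) = 75 * Real.pi / 512 := by
  have h : ∀ α : ℝ, Real.sin α ^ 6 * Real.cos α ^ 2 *
      (2 * Real.cos α ^ 4 + 5 * Real.cos α ^ 2 + 2) =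
      9 * Real.sin α ^ 6 - 18 * Real.sin α ^ 8 + 11 * Real.sin α ^ 10 - 2 * Real.sin α ^ 12 := by
    intro α
    have hc := Real.cos_sq' α
    rw [show Real.cos α ^ 4 = (Real.cos α ^ 2) ^ 2 by ring, hc]
    ring
  simp only [h]
  rw [intervalIntegral.integral_sub, intervalIntegral.integral_add, intervalIntegral.integral_sub]
  · simp only [intervalIntegral.integral_const_mul]
    have h6 := integral_sin_pow_even 3
    have h8 := integral_sin_pow_even 4
    have h10 := integral_sin_pow_even 5
    have h12 := integral_sin_pow_even 6
    norm_num only at h6 h8 h10 h12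
    rw [h6, h8, h10, h12]
    ring
  all_goals exact Continuous.intervalIntegrable (by fun_prop) _ _

/-- Integration of a density that is a multiple of `cos²α (2 cos⁴α + 5 cos²α + 2)`. -/
theorem integral_density {D : S7 → ℂ} {K : ℝ}
    (hD : ∀ (x : S7) (α : ℝ), x.1 7 = Real.cos α → (volS6 : ℂ) * D x =
      ((K * (Real.cos α ^ 2 * (2 * Real.cos α ^ 4 + 5 * Real.cos α ^ 2 + 2)) : ℝ) : ℂ)) :
    ∫ x, D x ∂surfaceS7 = ((K * (75 * Real.pi / 512) : ℝ) : ℂ) := by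
  have hvol : volS6 ≠ 0 := by
    rw [volS6_eq]
    positivity
  have hx : ∀ x : S7, -1 ≤ x.1 7 ∧ x.1 7 ≤ 1 := by
    intro x
    rw [← abs_le, ← Real.norm_eq_abs]
    exact (PiLp.norm_apply_le x.1 7).trans_eq (norm_eq_of_mem_sphere x)
  have h1 : ∀ x : S7, D x = ((K / volS6 * (2 * x.1 7 ^ 6 + 5 * x.1 7 ^ 4 + 2 * x.1 7 ^ 2) : ℝ) : ℂ) := by
    intro x
    have h := hD x (Real.arccos (x.1 7)) (Real.cos_arccos (hx x).1 (hx x).2).symm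
    rw [Real.cos_arccos (hx x).1 (hx x).2] at h
    have hv : (volS6 : ℂ) ≠ 0 := by exact_mod_cast hvol
    apply mul_left_cancel₀ hv
    rw [h]
    rw [← Complex.ofReal_mul]
    congr 1
    field_simp
  have hsin : ∀ n : ℕ, Integrable (fun x : S7 => x.1 7 ^ n) surfaceS7 := by
    intro n
    exact Continuous.integrable_of_hasCompactSupport (by fun_prop)
      (HasCompactSupport.of_compactSpace _)
  simp only [h1]
  rw [integral_complex_ofReal]
  congr 1
  -- The moments add up to π⁴(2/192 + 5/80 + 2/24) = 5π⁴/32; division by vol S⁶ = 16π³/15 gives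
  -- 75π/512.
  rw [integral_const_mul, integral_add, integral_add, integral_const_mul, integral_const_mul,
    integral_const_mul, integral_sphere_pow_two, integral_sphere_pow_four, integral_sphere_pow_six,
    volS6_eq]
  · field_simp
    ring
  · exact (hsin 6).const_mul 2
  · exact (hsin 4).const_mul 5
  · exact ((hsin 6).const_mul 2).add ((hsin 4).const_mul 5)
  · exact (hsin 2).const_mul 2

end

noncomputable section

/-! ### The differential of `g₇` -/

/-- The first seven coordinates of a vector. -/
def first7 (x : Fin 8 → ℝ) : Fin 7 → ℝ := fun m => x m.castSucc

/-- `octG` as a function of a vector with eight coordinates. -/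
def octG8 (x : Fin 8 → ℝ) : Matrix (Fin 8) (Fin 8) ℝ := octG (first7 x) (x 7)

/-- The differential of `octG8` at `x` in the direction `w`. -/
def octDG (x w : Fin 8 → ℝ) : Matrix (Fin 8) (Fin 8) ℝ :=
  w 7 • (1 : Matrix (Fin 8) (Fin 8) ℝ) + octX (first7 w) - (4 * w 7) • octN (first7 x) (first7 x) -
    (4 * x 7) • (octN (first7 x) (first7 w) + octN (first7 w) (first7 x)) -
    (8 * (first7 x ⬝ᵥ first7 w)) • octW (first7 x) -
    (4 * (first7 x ⬝ᵥ first7 x)) • octW (first7 w)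

theorem octDG_apply (x w : Fin 8 → ℝ) (i j : Fin 8) :
    octDG x w i j = w 7 * (1 : Matrix (Fin 8) (Fin 8) ℝ) i j +
      octSign i j * w (octIndex i j).castSucc -
      (4 * w 7 * ((∑ m : Fin 7, x m.castSucc * x m.castSucc) * (lastVec i * lastVec j) +
        incl7 (first7 x) i * incl7 (first7 x) j) +
       4 * x 7 * ((∑ m : Fin 7, (w m.castSucc * x m.castSucc + x m.castSucc * w m.castSucc)) *
          (lastVec i * lastVec j) +
        (incl7 (first7 w) i * incl7 (first7 x) j + incl7 (first7 x) i * incl7 (first7 w) j))) -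
      (4 * (∑ m : Fin 7, (w m.castSucc * x m.castSucc + x m.castSucc * w m.castSucc)) *
        (incl7 (first7 x) i * lastVec j - lastVec i * incl7 (first7 x) j) +
       4 * (∑ m : Fin 7, x m.castSucc * x m.castSucc) *
        (incl7 (first7 w) i * lastVec j - lastVec i * incl7 (first7 w) j)) := by
  have h : ∑ m : Fin 7, w m.castSucc * x m.castSucc = ∑ m : Fin 7, x m.castSucc * w m.castSucc :=
    Finset.sum_congr rfl fun m _ => mul_comm _ _
  simp only [Finset.sum_add_distrib, h]
  simp [octDG, octX, octN, octW, vecMulVec_apply, dotProduct, first7, h]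
  ring

theorem hasDerivAt_octG8 {y : ℝ → Fin 8 → ℝ} {w : Fin 8 → ℝ} {t : ℝ}
    (hy : ∀ k, HasDerivAt (fun t => y t k) (w k) t) (i j : Fin 8) :
    HasDerivAt (fun t => octG8 (y t) i j) (octDG (y t) w i j) t := by
  have hs : HasDerivAt (fun t => ∑ m : Fin 7, y t m.castSucc * y t m.castSucc)
      (∑ m : Fin 7, (w m.castSucc * y t m.castSucc + y t m.castSucc * w m.castSucc)) t :=
    HasDerivAt.fun_sum fun m _ => (hy m.castSucc).mul (hy m.castSucc)
  have hu : ∀ i, HasDerivAt (fun t => incl7 (first7 (y t)) i) (incl7 (first7 w) i) t := by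
    intro i
    simp only [incl7_apply, first7]
    exact HasDerivAt.fun_sum fun m _ => (hy m.castSucc).mul_const _
  rw [octDG_apply]
  simp only [octG8, octG_apply]
  exact ((((hy 7).mul_const _).add ((hy _).const_mul _)).sub
    (((hy 7).const_mul 4).mul ((hs.mul_const _).add ((hu i).mul (hu j))))).sub
    ((hs.const_mul 4).mul (((hu i).mul_const _).sub ((hu j).const_mul _)))

theorem hasDerivAt_normalize {x : E8} (hx : ‖x‖ = 1) (w : E8) (k : Fin 8) :
    HasDerivAt (fun t : ℝ => ‖x + t • w‖⁻¹ * (x + t • w) k) (w k - inner ℝ x w * x k) 0 := by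
  have h1 : HasDerivAt (fun t : ℝ => x + t • w) w 0 := by
    simpa using ((hasDerivAt_id (0 : ℝ)).smul_const w).const_add x
  have h2 : HasDerivAt (fun t : ℝ => ‖x + t • w‖ ^ 2) (2 * inner ℝ x w) 0 := by
    have := h1.norm_sq
    simpa using this
  have h3 : HasDerivAt (fun t : ℝ => ‖x + t • w‖) (inner ℝ x w) 0 := by
    have h := h2.sqrt (by simp [hx])
    simp only [Real.sqrt_sq (norm_nonneg _)] at h
    refine h.congr_deriv ?_
    simp [hx]
  have h4 : HasDerivAt (fun t : ℝ => (x + t • w) k) (w k) 0 := by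
    simpa using ((hasDerivAt_id (0 : ℝ)).mul_const (w k)).const_add (x k)
  have h5 := (h3.inv (by simp [hx])).mul h4
  refine h5.congr_deriv ?_
  simp [hx]
  ring

/-- Differentiate along the line x + tw: after normalization its velocity at t = 0 is the tangential
part of w. -/
theorem differential_g7 {Γ : Fin 7 → Mat8} (hΓ : IsGammaSystem Γ) {R : Matrix (Fin 8) (Fin 8) ℝ}
    (hR : ∀ a : EuclideanSpace ℝ (Fin 7), expMap Γ a =
      complexify (R * octG (Real.sinc ‖a‖ • (a : Fin 7 → ℝ)) (Real.cos ‖a‖) * Rᵀ))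
    (x : S7) (w : E8) :
    differential (g7 Γ) x w =
      complexify (R * octDG x.1 (fun k => w k - inner ℝ x.1 w * x.1 k) * Rᵀ) := by
  have hx : ‖x.1‖ = 1 := norm_eq_of_mem_sphere x
  have hx0 : x.1 ≠ 0 := by
    intro h
    rw [h, norm_zero] at hx
    exact zero_ne_one hx
  ext i j
  simp only [differential, Matrix.of_apply]
  have hd : DifferentiableAt ℝ (fun y => radialExt (g7 Γ) y i j) x.1 :=
    ((contDiffOn_radialExt_g7 hΓ i j).contDiffAt
      (isOpen_compl_singleton.mem_nhds hx0)).differentiableAt (by simp)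
  have h1 : HasDerivAt (fun t : ℝ => x.1 + t • w) w 0 := by
    simpa using ((hasDerivAt_id (0 : ℝ)).smul_const w).const_add x.1
  have h2 : HasDerivAt (fun t : ℝ => radialExt (g7 Γ) (x.1 + t • w) i j)
      (fderiv ℝ (fun y => radialExt (g7 Γ) y i j) x.1 w) 0 := by
    have h : HasFDerivAt (fun y => radialExt (g7 Γ) y i j)
        (fderiv ℝ (fun y => radialExt (g7 Γ) y i j) x.1) (x.1 + (0 : ℝ) • w) := by
      simpa using hd.hasFDerivAt
    exact h.comp_hasDerivAt (0 : ℝ) h1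
  have h3 : HasDerivAt (fun t : ℝ => ∑ k, (∑ l, R i l *
      octG8 (fun m => ‖x.1 + t • w‖⁻¹ * (x.1 + t • w) m) l k) * R j k)
      (∑ k, (∑ l, R i l * octDG x.1 (fun k => w k - inner ℝ x.1 w * x.1 k) l k) * R j k) 0 := by
    refine HasDerivAt.fun_sum fun k _ => HasDerivAt.mul_const (HasDerivAt.fun_sum fun l _ =>
      HasDerivAt.const_mul _ ?_) _
    have h := hasDerivAt_octG8 (fun m => hasDerivAt_normalize hx w m) l k
    refine h.congr_deriv ?_
    simp [hx]
  have h4 : (fun t : ℝ => radialExt (g7 Γ) (x.1 + t • w) i j) =ᶠ[nhds 0]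
      fun t : ℝ => ((∑ k, (∑ l, R i l *
        octG8 (fun m => ‖x.1 + t • w‖⁻¹ * (x.1 + t • w) m) l k) * R j k : ℝ) : ℂ) := by
    have hne : ∀ᶠ t : ℝ in nhds 0, x.1 + t • w ≠ 0 := by
      refine h1.continuousAt.eventually_ne ?_
      simpa using hx0
    filter_upwards [hne] with t ht
    rw [radialExt_g7 hR ht]
    simp [Matrix.mul_apply, octG8]
    rfl
  have h5 := h3.ofReal_comp.congr_of_eventuallyEq h4
  rw [h2.unique h5]
  simp [Matrix.mul_apply]

theorem octG8_mem_orthogonalGroup (x : S7) : octG8 x.1 ∈ Matrix.orthogonalGroup (Fin 8) ℝ := by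
  apply octG_mem_orthogonalGroup
  have h := sphere_norm_sq x
  rw [← real_inner_self_eq_dotProduct] at h
  exact h

/-- The Maurer-Cartan form of `g₇`. -/
theorem maurerCartan_g7 {Γ : Fin 7 → Mat8} (hΓ : IsGammaSystem Γ) {R : Matrix (Fin 8) (Fin 8) ℝ}
    (hRR : R ∈ Matrix.orthogonalGroup (Fin 8) ℝ)
    (hR : ∀ a : EuclideanSpace ℝ (Fin 7), expMap Γ a =
      complexify (R * octG (Real.sinc ‖a‖ • (a : Fin 7 → ℝ)) (Real.cos ‖a‖) * Rᵀ))
    (x : S7) (w : E8) :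
    maurerCartan (g7 Γ) x w = complexify (R * ((octG8 x.1)ᵀ *
      octDG x.1 (fun k => w k - inner ℝ x.1 w * x.1 k)) * Rᵀ) := by
  have hRR' : Rᵀ * R = 1 := (Matrix.mem_orthogonalGroup_iff' (Fin 8) ℝ).1 hRR
  have hG : (octG8 x.1)ᵀ * octG8 x.1 = 1 :=
    (Matrix.mem_orthogonalGroup_iff' (Fin 8) ℝ).1 (octG8_mem_orthogonalGroup x)
  have hinv : (g7 Γ x)⁻¹ = complexify (R * (octG8 x.1)ᵀ * Rᵀ) := by
    apply Matrix.inv_eq_left_inv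
    rw [g7_eq_of_model hR, ← map_mul, ← map_one complexify]
    congr 1
    calc R * (octG8 x.1)ᵀ * Rᵀ * (R * octG8 x.1 * Rᵀ)
        = R * ((octG8 x.1)ᵀ * (Rᵀ * R) * octG8 x.1) * Rᵀ := by simp only [mul_assoc]
      _ = 1 := by
        rw [hRR', mul_one, hG, mul_one]
        exact (Matrix.mem_orthogonalGroup_iff (Fin 8) ℝ).1 hRR
  rw [maurerCartan, hinv, differential_g7 hΓ hR, ← map_mul]
  congr 1
  generalize octDG x.1 (fun k => w k - inner ℝ x.1 w * x.1 k) = D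
  calc R * (octG8 x.1)ᵀ * Rᵀ * (R * D * Rᵀ)
      = R * ((octG8 x.1)ᵀ * (Rᵀ * R) * D) * Rᵀ := by simp only [mul_assoc]
    _ = _ := by rw [hRR', mul_one]

/-! ### Evaluation of a density in an oriented orthonormal frame -/

/-- The columns of a matrix as vectors of `ℝ⁸`. -/
def colVec (T : Matrix (Fin 8) (Fin 8) ℝ) (k : Fin 8) : E8 := WithLp.toLp 2 fun i => T i k

/-- Ω is the wedge product of the one-form ⟨x, ·⟩ with A. -/
theorem exists_alternating_uncurry {n : ℕ} (x : E8) (A : E8 [⋀^Fin n]→ₗ[ℝ] ℂ) :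
    ∃ Ω : E8 [⋀^Fin (n + 1)]→ₗ[ℝ] ℂ, ∀ v, Ω v = ∑ i : Fin (n + 1), (-1 : ℤ) ^ (i : ℕ) •
      (inner ℝ x (v i) : ℝ) • A fun k => v (i.succAbove k) :=
  ⟨AlternatingMap.alternatizeUncurryFin ((innerₗ E8 x).smulRight A), fun v =>
    AlternatingMap.alternatizeUncurryFin_apply _ v⟩

/-- The density is the value of the eight-form ⟨x, ·⟩ ∧ ω on the standard basis, hence on every
oriented orthonormal basis. If the last basis vector is x, only the term i = 7 survives, with the
sign (−1)⁷. -/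
theorem formDensity_wedge7 (M : MultilinearMap ℝ (fun _ : Fin 7 => E8) ℂ)
    {T : Matrix (Fin 8) (Fin 8) ℝ} (hT : T ∈ Matrix.specialOrthogonalGroup (Fin 8) ℝ) {x : S7}
    (hx : colVec T 7 = x.1) :
    formDensity x (wedge7 M) = -wedge7 M fun k => colVec T k.castSucc := by
  obtain ⟨hT1, hT2⟩ := Matrix.mem_specialOrthogonalGroup_iff.1 hT
  have hT3 : Tᵀ * T = 1 := (Matrix.mem_orthogonalGroup_iff' (Fin 8) ℝ).1 hT1
  let A : E8 [⋀^Fin 7]→ₗ[ℝ] ℂ := MultilinearMap.alternatization M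
  have hA : ∀ v, wedge7 M v = A v := by
    intro v
    simp only [A, MultilinearMap.alternatization_apply, wedge7]
    refine Finset.sum_congr rfl fun σ _ => ?_
    rw [MultilinearMap.domDomCongr_apply, Units.smul_def, zsmul_eq_mul]
    rfl
  obtain ⟨Ω, hΩ⟩ : ∃ Ω : E8 [⋀^Fin 8]→ₗ[ℝ] ℂ, ∀ v, Ω v = ∑ i : Fin 8, (-1 : ℤ) ^ (i : ℕ) •
      (inner ℝ x.1 (v i) : ℝ) • A fun k => v (i.succAbove k) :=
    exists_alternating_uncurry x.1 A
  let e := (EuclideanSpace.basisFun (Fin 8) ℝ).toBasis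
  have he : ∀ i, e i = EuclideanSpace.single i (1 : ℝ) := by
    intro i
    simp [e]
  have h1 : Ω e = formDensity x (wedge7 M) := by
    rw [hΩ, formDensity]
    refine Finset.sum_congr rfl fun i _ => ?_
    simp only [he, hA]
    rw [EuclideanSpace.inner_single_right]
    simp [mul_assoc]
  have horth : ∀ k, (inner ℝ x.1 (colVec T k) : ℝ) = (1 : Matrix (Fin 8) (Fin 8) ℝ) 7 k := by
    intro k
    rw [← hT3, ← hx, PiLp.inner_apply, Matrix.mul_apply]
    simp [colVec, mul_comm]
  have h2 : Ω (colVec T) = -wedge7 M fun k => colVec T k.castSucc := by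
    rw [hΩ, Finset.sum_eq_single 7]
    · rw [horth, hA]
      have : ∀ k : Fin 7, (7 : Fin 8).succAbove k = k.castSucc := fun k =>
        Fin.succAbove_last_apply k
      simp [this]
    · intro k _ hk
      rw [horth, Matrix.one_apply_ne hk.symm]
      simp
    · simp
  have h3 : Ω (colVec T) = Ω e := by
    have hdet : e.det (colVec T) = 1 := by
      rw [Module.Basis.det_apply, ← hT2]
      congr 1
    -- Proportionality to the determinant is used for real-valued forms, so real and imaginary parts
    -- are treated separately.
    have hre : ∀ L : ℂ →ₗ[ℝ] ℝ, L (Ω (colVec T)) = L (Ω e) := by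
      intro L
      have h := AlternatingMap.eq_smul_basis_det e (L.compAlternatingMap Ω)
      have h' := congrArg (fun g => g (colVec T)) h
      simpa [hdet] using h'
    exact Complex.ext (hre Complex.reLm) (hre Complex.imLm)
  rw [← h1, ← h3, h2]

end

noncomputable section

/-! ### Automorphisms of the octonionic structure -/

/-- Rotations of `ℝ⁸` that fix the last axis and are compatible with the map `octX`. -/
structure IsOctAut (U : Matrix (Fin 8) (Fin 8) ℝ) : Prop where
  mem : U ∈ Matrix.specialOrthogonalGroup (Fin 8) ℝ
  last : U *ᵥ lastVec = lastVec
  oct : ∀ x : Fin 8 → ℝ, octX (first7 (U *ᵥ x)) = U * octX (first7 x) * Uᵀ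

namespace IsOctAut

variable {U V : Matrix (Fin 8) (Fin 8) ℝ}

theorem transpose_mul_self (hU : IsOctAut U) : Uᵀ * U = 1 :=
  (Matrix.mem_orthogonalGroup_iff' (Fin 8) ℝ).1
    (Matrix.mem_specialOrthogonalGroup_iff.1 hU.mem).1

theorem mul_transpose_self (hU : IsOctAut U) : U * Uᵀ = 1 :=
  (Matrix.mem_orthogonalGroup_iff (Fin 8) ℝ).1
    (Matrix.mem_specialOrthogonalGroup_iff.1 hU.mem).1

theorem mul (hU : IsOctAut U) (hV : IsOctAut V) : IsOctAut (U * V) where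
  mem := mul_mem hU.mem hV.mem
  last := by rw [← mulVec_mulVec, hV.last, hU.last]
  oct x := by
    rw [← mulVec_mulVec, hU.oct, hV.oct, transpose_mul]
    simp only [mul_assoc]

theorem transpose (hU : IsOctAut U) : IsOctAut Uᵀ where
  mem := by
    obtain ⟨h1, h2⟩ := Matrix.mem_specialOrthogonalGroup_iff.1 hU.mem
    refine Matrix.mem_specialOrthogonalGroup_iff.2
      ⟨(Matrix.mem_orthogonalGroup_iff (Fin 8) ℝ).2 ?_, by rw [det_transpose, h2]⟩
    exact hU.transpose_mul_self
  last := by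
    conv_lhs => rw [← hU.last, mulVec_mulVec, hU.transpose_mul_self, one_mulVec]
  oct x := by
    have h := hU.oct (Uᵀ *ᵥ x)
    rw [mulVec_mulVec, hU.mul_transpose_self, one_mulVec] at h
    rw [h, transpose_transpose]
    calc _ = (Uᵀ * U) * octX (first7 (Uᵀ *ᵥ x)) * (Uᵀ * U) := by
          rw [hU.transpose_mul_self, one_mul, mul_one]
      _ = _ := by simp only [mul_assoc]

theorem dotProduct (hU : IsOctAut U) (x y : Fin 8 → ℝ) : (U *ᵥ x) ⬝ᵥ (U *ᵥ y) = x ⬝ᵥ y := by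
  rw [dotProduct_mulVec, ← mulVec_transpose, mulVec_mulVec, hU.transpose_mul_self, one_mulVec]

theorem apply_last (hU : IsOctAut U) (x : Fin 8 → ℝ) : (U *ᵥ x) 7 = x 7 := by
  have h := hU.dotProduct x lastVec
  rw [hU.last] at h
  simpa [lastVec] using h

end IsOctAut

theorem incl7_first7 (x : Fin 8 → ℝ) : incl7 (first7 x) = x - x 7 • lastVec := by
  rw [incl7_explicit]
  ext i
  fin_cases i <;> simp [first7, lastVec]

theorem first7_dotProduct (x y : Fin 8 → ℝ) : first7 x ⬝ᵥ first7 y = x ⬝ᵥ y - x 7 * y 7 := by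
  rw [← incl7_dotProduct, incl7_first7, incl7_first7]
  simp only [sub_dotProduct, dotProduct_sub, smul_dotProduct, dotProduct_smul,
    lastVec_dotProduct_lastVec, smul_eq_mul]
  simp [lastVec]

namespace IsOctAut

variable {U V : Matrix (Fin 8) (Fin 8) ℝ}

theorem incl7_mulVec (hU : IsOctAut U) (x : Fin 8 → ℝ) :
    incl7 (first7 (U *ᵥ x)) = U *ᵥ incl7 (first7 x) := by
  rw [incl7_first7, incl7_first7, hU.apply_last, mulVec_sub, mulVec_smul, hU.last]

theorem first7_dotProduct (hU : IsOctAut U) (x y : Fin 8 → ℝ) :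
    first7 (U *ᵥ x) ⬝ᵥ first7 (U *ᵥ y) = first7 x ⬝ᵥ first7 y := by
  rw [_root_.first7_dotProduct, _root_.first7_dotProduct, hU.dotProduct, hU.apply_last,
    hU.apply_last]

theorem vecMulVec_conj (U : Matrix (Fin 8) (Fin 8) ℝ) (x y : Fin 8 → ℝ) :
    vecMulVec (U *ᵥ x) (U *ᵥ y) = U * vecMulVec x y * Uᵀ := by
  rw [mul_vecMulVec, vecMulVec_mul, vecMul_transpose]

theorem octN (hU : IsOctAut U) (x y : Fin 8 → ℝ) :
    octN (first7 (U *ᵥ x)) (first7 (U *ᵥ y)) = U * octN (first7 x) (first7 y) * Uᵀ := by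
  have h := vecMulVec_conj U lastVec lastVec
  rw [hU.last] at h
  rw [_root_.octN, _root_.octN, hU.first7_dotProduct, hU.incl7_mulVec, hU.incl7_mulVec,
    vecMulVec_conj, mul_add, add_mul, Matrix.mul_smul, Matrix.smul_mul, ← h]

theorem octW (hU : IsOctAut U) (x : Fin 8 → ℝ) :
    octW (first7 (U *ᵥ x)) = U * octW (first7 x) * Uᵀ := by
  have h1 := vecMulVec_conj U (incl7 (first7 x)) lastVec
  have h2 := vecMulVec_conj U lastVec (incl7 (first7 x))
  rw [hU.last] at h1 h2
  rw [_root_.octW, _root_.octW, hU.incl7_mulVec, h1, h2, mul_sub, sub_mul]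

/-- This equivariance reduces the computation of g₇ and of its differential to points of one
meridian. -/
theorem octG8 (hU : IsOctAut U) (x : Fin 8 → ℝ) :
    octG8 (U *ᵥ x) = U * octG8 x * Uᵀ := by
  rw [_root_.octG8, _root_.octG8, octG, octG, hU.oct, hU.octN, hU.octW, hU.apply_last,
    hU.first7_dotProduct]
  simp only [mul_add, mul_sub, add_mul, sub_mul, Matrix.mul_smul, Matrix.smul_mul, mul_one,
    hU.mul_transpose_self]

theorem octDG (hU : IsOctAut U) (x w : Fin 8 → ℝ) :
    octDG (U *ᵥ x) (U *ᵥ w) = U * octDG x w * Uᵀ := by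
  rw [_root_.octDG, _root_.octDG, hU.oct, hU.octN, hU.octN, hU.octN, hU.octW, hU.octW,
    hU.apply_last, hU.apply_last, hU.first7_dotProduct, hU.first7_dotProduct]
  simp only [mul_add, mul_sub, add_mul, sub_mul, Matrix.mul_smul, Matrix.smul_mul, mul_one,
    hU.mul_transpose_self]

end IsOctAut

/-! ### Rotations generated by simple derivations -/

/-- The infinitesimal rotation `e_a ↦ e_b`, `e_c ↦ -e_d`. -/
def rotGen (a b c d : Fin 8) : Matrix (Fin 8) (Fin 8) ℤ :=
  Matrix.of fun i j => if i = b ∧ j = a then 1 else if i = a ∧ j = b then -1 else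
    if i = c ∧ j = d then 1 else if i = d ∧ j = c then -1 else 0

/-- The infinitesimal version of `IsOctAut`, for matrices of rank four. -/
structure IsOctDer (D : Matrix (Fin 8) (Fin 8) ℤ) : Prop where
  antisymm : Dᵀ = -D
  cube : D * D * D = -D
  last : ∀ i, D i 7 = 0
  der : ∀ i j m, octSign i j * D (octIndex i j).castSucc m =
    ∑ k, (D i k * (octSign k j * if (octIndex k j).castSucc = m then 1 else 0) -
      (octSign i k * if (octIndex i k).castSucc = m then 1 else 0) * D k j)

theorem isOctDer_rotGen_5416 : IsOctDer (rotGen 5 4 1 6) := by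
  constructor <;> decide +kernel

theorem isOctDer_rotGen_2316 : IsOctDer (rotGen 2 3 1 6) := by
  constructor <;> decide +kernel

theorem isOctDer_rotGen_0143 : IsOctDer (rotGen 0 1 4 3) := by
  constructor <;> decide +kernel

theorem isOctDer_rotGen_2543 : IsOctDer (rotGen 2 5 4 3) := by
  constructor <;> decide +kernel

theorem isOctDer_rotGen_0251 : IsOctDer (rotGen 0 2 5 1) := by
  constructor <;> decide +kernel

theorem isOctDer_rotGen_0642 : IsOctDer (rotGen 0 6 4 2) := by
  constructor <;> decide +kernel

theorem octX_first7_mulVec {D : Matrix (Fin 8) (Fin 8) ℤ} (hD : IsOctDer D) (x : Fin 8 → ℝ) :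
    octX (first7 (D.map (Int.cast : ℤ → ℝ) *ᵥ x)) =
      D.map (Int.cast : ℤ → ℝ) * octX (first7 x) - octX (first7 x) * D.map (Int.cast : ℤ → ℝ) := by
  ext i j
  have hx : ∀ l, x l = ∑ m, (if l = m then (1 : ℝ) else 0) * x m := by
    intro l
    simp
  have h : ∀ m, (octSign i j * D (octIndex i j).castSucc m : ℝ) =
    ∑ k, (D i k * (octSign k j * if (octIndex k j).castSucc = m then (1 : ℝ) else 0) -
      (octSign i k * if (octIndex i k).castSucc = m then (1 : ℝ) else 0) * D k j) := by
    intro m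
    have := congrArg (Int.cast : ℤ → ℝ) (hD.der i j m)
    push_cast at this
    exact this
  rw [Matrix.sub_apply, Matrix.mul_apply, Matrix.mul_apply, ← Finset.sum_sub_distrib]
  simp only [octX, Matrix.of_apply, first7, Matrix.map_apply]
  calc (octSign i j : ℝ) * (D.map (Int.cast : ℤ → ℝ) *ᵥ x) (octIndex i j).castSucc
      = ∑ m, (octSign i j * D (octIndex i j).castSucc m : ℝ) * x m := by
        simp only [Matrix.mulVec, _root_.dotProduct, Matrix.map_apply, Finset.mul_sum, mul_assoc]
    _ = ∑ k, ∑ m, (D i k * (octSign k j * if (octIndex k j).castSucc = m then (1 : ℝ) else 0) -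
      (octSign i k * if (octIndex i k).castSucc = m then (1 : ℝ) else 0) * D k j) * x m := by
        simp only [h, Finset.sum_mul]
        exact Finset.sum_comm
    _ = _ := by
        refine Finset.sum_congr rfl fun k _ => ?_
        conv_rhs => rw [hx (octIndex k j).castSucc, hx (octIndex i k).castSucc]
        simp only [Finset.mul_sum, Finset.sum_mul]
        rw [← Finset.sum_sub_distrib]
        exact Finset.sum_congr rfl fun m _ => by ring

/-- The rotation by the angle with the given cosine and sine. -/
def rotExp (D : Matrix (Fin 8) (Fin 8) ℝ) (c s : ℝ) : Matrix (Fin 8) (Fin 8) ℝ :=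
  1 + s • D + (1 - c) • (D * D)

/-- For D³ = −D the exponential series of θD closes to 1 + sin θ · D + (1 − cos θ) · D², and the
rule is the addition theorem. -/
theorem rotExp_mul {D : Matrix (Fin 8) (Fin 8) ℝ} (hD : D * D * D = -D) (c s c' s' : ℝ) :
    rotExp D c s * rotExp D c' s' = rotExp D (c * c' - s * s') (s * c' + c * s') := by
  have h4 : D * D * (D * D) = -(D * D) := by rw [← mul_assoc, hD, neg_mul]
  have h3 : D * (D * D) = -D := by rw [← mul_assoc, hD]
  simp only [rotExp, mul_add, add_mul, mul_one, one_mul, Matrix.mul_smul, Matrix.smul_mul, smul_smul,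
    h4, h3, hD]
  module

theorem rotExp_transpose {E : Matrix (Fin 8) (Fin 8) ℝ} (hT : Eᵀ = -E) (c s : ℝ) :
    (rotExp E c s)ᵀ = rotExp E c (-s) := by
  simp [rotExp, hT]

theorem rotExp_mem_specialOrthogonalGroup {E : Matrix (Fin 8) (Fin 8) ℝ} (hT : Eᵀ = -E)
    (h3 : E * E * E = -E) {c s : ℝ} (hcs : c ^ 2 + s ^ 2 = 1) :
    rotExp E c s ∈ Matrix.specialOrthogonalGroup (Fin 8) ℝ := by
  have hone : rotExp E 1 0 = 1 := by simp [rotExp]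
  have horth : ∀ c s : ℝ, c ^ 2 + s ^ 2 = 1 → rotExp E c s * (rotExp E c s)ᵀ = 1 := by
    intro c s h
    rw [rotExp_transpose hT, rotExp_mul h3, ← hone]
    congr 1 <;> linarith
  obtain ⟨θ, hc, hs⟩ : ∃ θ : ℝ, c = Real.cos θ ∧ s = Real.sin θ := by
    have hn : ‖(⟨c, s⟩ : ℂ)‖ = 1 := by
      rw [Complex.norm_def, Complex.normSq_mk, Real.sqrt_eq_one]
      linarith
    refine ⟨Complex.arg ⟨c, s⟩, ?_, ?_⟩
    · rw [Complex.cos_arg (by intro h; simp [h] at hn), hn, div_one]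
    · rw [Complex.sin_arg, hn, div_one]
  have hdet : (rotExp E c s).det = 1 := by
    have hhalf : rotExp E c s = rotExp E (Real.cos (θ / 2)) (Real.sin (θ / 2)) *
        rotExp E (Real.cos (θ / 2)) (Real.sin (θ / 2)) := by
      rw [rotExp_mul h3, hc, hs]
      have e : θ = θ / 2 + θ / 2 := by ring
      conv_lhs => rw [e, Real.cos_add, Real.sin_add]
    have h1 := congrArg Matrix.det (horth _ _ (Real.cos_sq_add_sin_sq (θ / 2)))
    rw [det_mul, det_transpose, det_one] at h1
    rw [hhalf, det_mul, h1]
  exact Matrix.mem_specialOrthogonalGroup_iff.2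
    ⟨(Matrix.mem_orthogonalGroup_iff (Fin 8) ℝ).2 (horth c s hcs), hdet⟩

/-- Let X be the image of x under `octX`. The derivation property says that the image of Ex is [E,
X]. As E³ = −E on vectors, the triple commutator of E with X is −[E, X], which restricts X enough
for conjugation by the rotation to be again of degree two in ad E. -/
theorem isOctAut_rotExp {D : Matrix (Fin 8) (Fin 8) ℤ} (hD : IsOctDer D) {c s : ℝ}
    (hcs : c ^ 2 + s ^ 2 = 1) : IsOctAut (rotExp (D.map (Int.cast : ℤ → ℝ)) c s) := by
  set E := D.map (Int.cast : ℤ → ℝ) with hE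
  have h3 : E * E * E = -E := by
    have h := congrArg (fun A : Matrix (Fin 8) (Fin 8) ℤ => (Int.castRingHom ℝ).mapMatrix A) hD.cube
    simp only [map_mul, map_neg] at h
    exact h
  have hT : Eᵀ = -E := by
    have h := congrArg (fun A : Matrix (Fin 8) (Fin 8) ℤ => (Int.castRingHom ℝ).mapMatrix A)
      hD.antisymm
    simp only [map_neg] at h
    exact h
  refine ⟨rotExp_mem_specialOrthogonalGroup hT h3 hcs, ?_, ?_⟩
  · have h0 : E *ᵥ lastVec = 0 := by
      ext i
      simp [lastVec, hE, hD.last]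
    simp [rotExp, add_mulVec, smul_mulVec, ← mulVec_mulVec, h0]
  · intro x
    have h1 := octX_first7_mulVec hD x
    have h2 := octX_first7_mulVec hD (E *ᵥ x)
    have h4 := octX_first7_mulVec hD (E *ᵥ (E *ᵥ x))
    rw [← hE] at h1 h2 h4
    rw [h1] at h2
    rw [h2] at h4
    have hlin : octX (first7 (rotExp E c s *ᵥ x)) = octX (first7 x) + s • octX (first7 (E *ᵥ x)) +
        (1 - c) • octX (first7 (E *ᵥ (E *ᵥ x))) := by
      rw [← octX_smul, ← octX_smul, ← octX_add, ← octX_add]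
      congr 1
      simp only [rotExp, add_mulVec, one_mulVec, smul_mulVec, ← mulVec_mulVec]
      rfl
    have hneg : E *ᵥ (E *ᵥ (E *ᵥ x)) = -(E *ᵥ x) := by
      rw [mulVec_mulVec, mulVec_mulVec, h3, neg_mulVec]
    have hneg' : octX (first7 (-(E *ᵥ x))) = -octX (first7 (E *ᵥ x)) := by
      have := octX_smul (-1 : ℝ) (first7 (E *ᵥ x))
      rw [neg_one_smul, neg_one_smul] at this
      exact this
    rw [hneg, hneg', h1] at h4
    rw [hlin, h1, h2, rotExp_transpose hT]
    generalize octX (first7 x) = X at *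
    have h5 : E * (E * E) = -E := by rw [← mul_assoc, h3]
    -- In the triple commutator the terms E³X and XE³ already account for −[E, X]; the mixed terms
    -- must cancel, that is, E²XE = EXE².
    have hA : E * E * X * E = E * X * (E * E) := by
      have e1 : E * (E * (E * X - X * E) - (E * X - X * E) * E) -
          (E * (E * X - X * E) - (E * X - X * E) * E) * E =
          (E * E * E) * X - (3 : ℝ) • (E * E * X * E) + (3 : ℝ) • (E * X * (E * E)) -
            X * (E * E * E) := by
        simp only [mul_sub, sub_mul, mul_assoc]
        module
      rw [e1, h3] at h4
      have e2 : (3 : ℝ) • (E * E * X * E - E * X * (E * E)) = 0 := by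
        have := sub_eq_zero.2 h4
        rw [smul_sub]
        simp only [mul_neg, neg_mul] at this
        rw [← this]
        module
      have e3 := (smul_eq_zero.1 e2).resolve_left (by norm_num)
      exact sub_eq_zero.1 e3
    have hB : E * X * E = -(E * E * X * (E * E)) := by
      have := congrArg (fun A => E * A) hA
      have e : E * (E * E * X * E) = (E * E * E) * X * E := by simp only [mul_assoc]
      have e' : E * (E * X * (E * E)) = E * E * X * (E * E) := by simp only [mul_assoc]
      simp only [e, e', h3, neg_mul] at this
      rw [← this, neg_neg]
    have hC : E * E * X * (E * E) = -(E * X * E) := by rw [hB, neg_neg]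
    have hs2 : s * s = (1 - c) * (1 + c) := by linarith
    have expand : rotExp E c s * X * rotExp E c (-s) =
        X + s • (E * X - X * E) + (1 - c) • (E * E * X + X * (E * E)) - (s * s) • (E * X * E) +
          ((1 - c) * (1 - c)) • (E * E * X * (E * E)) +
          (s * (1 - c)) • (E * X * (E * E) - E * E * X * E) := by
      simp only [rotExp, mul_add, add_mul, mul_one, one_mul, Matrix.mul_smul, Matrix.smul_mul,
        smul_smul, mul_assoc]
      module
    rw [expand, hA, hC, hs2, sub_self]
    simp only [mul_sub, sub_mul, mul_assoc]
    module

/-- The angle takes (x_a, x_b) to (r, 0) with r ≥ 0. The derivation forces a simultaneous rotation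
in the plane (c, d), which does no harm where both coordinates already vanish. -/
theorem exists_rotation {a b c d : Fin 8} (hD : IsOctDer (rotGen a b c d)) (hab : a ≠ b)
    (hcd : c ≠ d) (hac : a ≠ c) (had : a ≠ d) (hbc : b ≠ c) (hbd : b ≠ d) (x : Fin 8 → ℝ) :
    ∃ U, IsOctAut U ∧ (U *ᵥ x) b = 0 ∧ 0 ≤ (U *ᵥ x) a ∧
      (x c = 0 → x d = 0 → (U *ᵥ x) c = 0 ∧ (U *ᵥ x) d = 0) ∧
      ∀ i, i ≠ a → i ≠ b → i ≠ c → i ≠ d → (U *ᵥ x) i = x i := by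
  set E := (rotGen a b c d).map (Int.cast : ℤ → ℝ) with hE
  have hEa : ∀ y : Fin 8 → ℝ, E *ᵥ y = fun i => if i = b then y a else if i = a then -y b else
      if i = c then y d else if i = d then -y c else 0 := by
    intro y
    ext i
    have : ∀ j, E i j * y j = (if i = b then (if j = a then y j else 0) else if i = a then
      (if j = b then -y j else 0) else if i = c then (if j = d then y j else 0) else
      if i = d then (if j = c then -y j else 0) else 0) := by
      intro j
      simp only [hE, rotGen, Matrix.map_apply, Matrix.of_apply]
      split_ifs <;> simp_all
    simp only [Matrix.mulVec, dotProduct, this]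
    split_ifs <;> simp
  have hU : ∀ co si : ℝ, ∀ i, (rotExp E co si *ᵥ x) i =
      x i + si * (E *ᵥ x) i + (1 - co) * (E *ᵥ (E *ᵥ x)) i := by
    intro co si i
    simp [rotExp, add_mulVec, smul_mulVec, ← mulVec_mulVec]
  obtain ⟨co, si, hcs, h1, h2⟩ : ∃ co si : ℝ, co ^ 2 + si ^ 2 = 1 ∧ co * x b + si * x a = 0 ∧
      0 ≤ co * x a - si * x b := by
    by_cases h : x a ^ 2 + x b ^ 2 = 0
    · have ha : x a = 0 := by nlinarith [sq_nonneg (x a), sq_nonneg (x b)]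
      have hb : x b = 0 := by nlinarith [sq_nonneg (x a), sq_nonneg (x b)]
      exact ⟨1, 0, by norm_num, by simp [hb], by simp [ha]⟩
    · have hpos : 0 < x a ^ 2 + x b ^ 2 := lt_of_le_of_ne (by positivity) (Ne.symm h)
      set r := Real.sqrt (x a ^ 2 + x b ^ 2) with hr
      have hr0 : 0 < r := Real.sqrt_pos.2 hpos
      have hr2 : r ^ 2 = x a ^ 2 + x b ^ 2 := Real.sq_sqrt hpos.le
      refine ⟨x a / r, -x b / r, ?_, ?_, ?_⟩
      · field_simp
        linarith
      · ring
      · have : x a / r * x a - -x b / r * x b = (x a ^ 2 + x b ^ 2) / r := by ring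
        rw [this]
        positivity
  refine ⟨rotExp E co si, isOctAut_rotExp hD hcs, ?_, ?_, ?_, ?_⟩
  · rw [hU]
    simp [hEa, hab]
    linarith
  · rw [hU]
    simp [hEa, hab]
    linarith
  · intro hc hd
    rw [hU, hU]
    simp [hEa, hcd.symm, hac.symm, had.symm, hbc.symm, hbd.symm, hc, hd]
  · intro i h1 h2 h3 h4
    rw [hU]
    simp [hEa, h1, h2, h3, h4]

/-- The automorphisms act transitively on the spheres of the first seven coordinates. -/
theorem exists_isOctAut (x : Fin 8 → ℝ) : ∃ U, IsOctAut U ∧ 0 ≤ (U *ᵥ x) 0 ∧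
    ∀ i, i ≠ 0 → i ≠ 7 → (U *ᵥ x) i = 0 := by
  -- The coordinates 4, 3, 1, 5, 2, 6 are annihilated in this order. The accompanying plane consists
  -- either of 1 and 6, not yet treated, or of two coordinates that are already zero.
  obtain ⟨U1, hU1, a4, -, -, k1⟩ := exists_rotation isOctDer_rotGen_5416 (by decide) (by decide)
    (by decide) (by decide) (by decide) (by decide) x
  set x1 := U1 *ᵥ x
  obtain ⟨U2, hU2, b3, -, -, k2⟩ := exists_rotation isOctDer_rotGen_2316 (by decide) (by decide)
    (by decide) (by decide) (by decide) (by decide) x1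
  set x2 := U2 *ᵥ x1
  have b4 : x2 4 = 0 := by rw [k2 4 (by decide) (by decide) (by decide) (by decide), a4]
  obtain ⟨U3, hU3, c1, -, c43, k3⟩ := exists_rotation isOctDer_rotGen_0143 (by decide) (by decide)
    (by decide) (by decide) (by decide) (by decide) x2
  obtain ⟨c4, c3⟩ := c43 b4 b3
  set x3 := U3 *ᵥ x2
  obtain ⟨U4, hU4, d5, -, d43, k4⟩ := exists_rotation isOctDer_rotGen_2543 (by decide) (by decide)
    (by decide) (by decide) (by decide) (by decide) x3
  obtain ⟨d4, d3⟩ := d43 c4 c3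
  set x4 := U4 *ᵥ x3
  have d1 : x4 1 = 0 := by rw [k4 1 (by decide) (by decide) (by decide) (by decide), c1]
  obtain ⟨U5, hU5, e2, -, e51, k5⟩ := exists_rotation isOctDer_rotGen_0251 (by decide) (by decide)
    (by decide) (by decide) (by decide) (by decide) x4
  obtain ⟨e5, e1⟩ := e51 d5 d1
  set x5 := U5 *ᵥ x4
  have e3 : x5 3 = 0 := by rw [k5 3 (by decide) (by decide) (by decide) (by decide), d3]
  have e4 : x5 4 = 0 := by rw [k5 4 (by decide) (by decide) (by decide) (by decide), d4]
  obtain ⟨U6, hU6, f6, f0, f42, k6⟩ := exists_rotation isOctDer_rotGen_0642 (by decide) (by decide)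
    (by decide) (by decide) (by decide) (by decide) x5
  obtain ⟨f4, f2⟩ := f42 e4 e2
  refine ⟨U6 * (U5 * (U4 * (U3 * (U2 * U1)))),
    hU6.mul (hU5.mul (hU4.mul (hU3.mul (hU2.mul hU1)))), ?_⟩
  have hx : (U6 * (U5 * (U4 * (U3 * (U2 * U1))))) *ᵥ x = U6 *ᵥ x5 := by
    simp only [x5, x4, x3, x2, x1, mulVec_mulVec, mul_assoc]
  rw [hx]
  refine ⟨f0, fun i h0 h7 => ?_⟩
  fin_cases i
  · exact absurd rfl h0
  · exact (k6 1 (by decide) (by decide) (by decide) (by decide)).trans e1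
  · exact f2
  · exact (k6 3 (by decide) (by decide) (by decide) (by decide)).trans e3
  · exact f4
  · exact (k6 5 (by decide) (by decide) (by decide) (by decide)).trans e5
  · exact f6
  · exact absurd rfl h7

end

noncomputable section

/-! ### The Maurer-Cartan form in an adapted frame -/

/-- The constant part of the entries of the components of the Maurer-Cartan form. -/
def thetaP : Fin 8 → Fin 8 → ℤ :=
  ![![0, -1, -1, 1, 1, -1, 1, 3],
    ![1, 0, 1, 1, -1, -1, 1, 1],
    ![1, -1, 0, 1, 1, 1, -1, 1],
    ![-1, -1, -1, 0, -1, 1, 1, 1],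
    ![-1, 1, -1, 1, 0, -1, -1, 1],
    ![1, 1, -1, -1, 1, 0, 1, 1],
    ![-1, -1, 1, -1, 1, -1, 0, 1],
    ![-3, -1, -1, -1, -1, -1, -1, 0]]

/-- The part of the entries proportional to the cosine of the polar angle. -/
def thetaQ : Fin 8 → Fin 8 → ℤ :=
  ![![0, 2, 2, -2, -2, 2, -2, 0],
    ![-2, 0, 0, 0, 0, 0, 0, 2],
    ![-2, 0, 0, 0, 0, 0, 0, 2],
    ![2, 0, 0, 0, 0, 0, 0, 2],
    ![2, 0, 0, 0, 0, 0, 0, 2],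
    ![-2, 0, 0, 0, 0, 0, 0, 2],
    ![2, 0, 0, 0, 0, 0, 0, 2],
    ![0, -2, -2, -2, -2, -2, -2, 0]]

/-- The components of the Maurer-Cartan form of `g₇` in an adapted frame, up to conjugation, at a
point whose polar angle has cosine `c`. -/
def octTheta {R : Type*} [CommRing R] (c : R) (j : Fin 7) : Matrix (Fin 8) (Fin 8) R :=
  Matrix.of fun i k => if octIndex i k = j then (thetaP i k : R) + c * (thetaQ i k : R) else 0

/-- The matrix units `e_a e_bᵀ` of the first seven axes. -/
def unitMat (R : Type*) [CommRing R] (a b : Fin 8) : Matrix (Fin 8) (Fin 8) R :=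
  Matrix.of fun i k => if i = a ∧ k = b then 1 else 0

theorem incl7_smul (r : ℝ) (v : Fin 7 → ℝ) : incl7 (r • v) = r • incl7 v := by
  ext i
  simp only [incl7_apply, Pi.smul_apply, smul_eq_mul, Finset.mul_sum, mul_assoc]

theorem incl7_single (a : Fin 7) : incl7 (Pi.single a 1) = Pi.single a.castSucc 1 := by
  ext i
  rw [incl7_apply]
  simp only [Pi.single_apply, ite_mul, one_mul, zero_mul, Finset.sum_ite_eq', Finset.mem_univ,
    if_true]
  simp [eq_comm]

theorem vecMulVec_single (a b : Fin 8) :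
    vecMulVec (Pi.single a (1 : ℝ)) (Pi.single b 1) = unitMat ℝ a b := by
  ext i k
  simp only [vecMulVec_apply, Pi.single_apply, unitMat, Matrix.of_apply]
  split_ifs <;> simp_all

theorem octN_single (a b : Fin 7) : octN (Pi.single a 1) (Pi.single b 1) =
    (if a = b then (1 : ℝ) else 0) • unitMat ℝ 7 7 + unitMat ℝ a.castSucc b.castSucc := by
  rw [octN, incl7_single, incl7_single, lastVec, vecMulVec_single, vecMulVec_single]
  congr 2
  simp [Pi.single_apply, eq_comm]

theorem octW_single (a : Fin 7) : octW (Pi.single a 1) =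
    unitMat ℝ a.castSucc 7 - unitMat ℝ 7 a.castSucc := by
  rw [octW, incl7_single, lastVec, vecMulVec_single, vecMulVec_single]

/-! ### The differential on a meridian as an identity of homogeneous polynomials -/

/-- The matrix `octX` of an octonion unit. -/
def octUnit (j : Fin 7) : Matrix (Fin 8) (Fin 8) ℤ :=
  Matrix.of fun i k => if octIndex i k = j then octSign i k else 0

/-- The coefficients of the square root of `g₇` in the sine and cosine of half the polar angle. -/
def halfCoeff (a : Fin 4) : Matrix (Fin 8) (Fin 8) ℤ :=
  Matrix.of fun i k => ![if i = k then 1 else 0, octUnit 0 i k,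
    (if i = k then 1 else 0) - 4 * (unitMat ℤ 7 7 i k + unitMat ℤ 0 0 i k),
    octUnit 0 i k - 4 * (unitMat ℤ 0 7 i k - unitMat ℤ 7 0 i k)] a

/-- The coefficients of the differential of `g₇` in the sine and cosine of half the polar angle. -/
def diffCoeff (j : Fin 7) (b : Fin 5) : Matrix (Fin 8) (Fin 8) ℤ :=
  Matrix.of fun i k => ![octUnit j i k,
    -8 * (unitMat ℤ 0 j.castSucc i k + unitMat ℤ j.castSucc 0 i k),
    2 * octUnit j i k - 16 * (unitMat ℤ j.castSucc 7 i k - unitMat ℤ 7 j.castSucc i k),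
    8 * (unitMat ℤ 0 j.castSucc i k + unitMat ℤ j.castSucc 0 i k), octUnit j i k] b

/-- The coefficients of `octTheta` in the sine and cosine of half the polar angle. -/
def thetaCoeff (j : Fin 7) (b : Fin 5) : Matrix (Fin 8) (Fin 8) ℤ :=
  Matrix.of fun i k => if octIndex i k = j then
    ![thetaP i k + thetaQ i k, 0, 2 * thetaP i k, 0, thetaP i k - thetaQ i k] b else 0

/-- The partner of an index with respect to the first octonion unit. -/
def octPartner : Fin 8 → Fin 8 := ![7, 6, 3, 2, 5, 4, 1, 0]

theorem octPartner_ne : ∀ i, i ≠ octPartner i := by decide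

theorem halfCoeff_eq_zero : ∀ (a : Fin 4) (i l : Fin 8), l ≠ i → l ≠ octPartner i →
    1 * halfCoeff a i l = 0 := by
  decide +kernel

theorem halfCoeff_mul_apply (a : Fin 4) (M : Matrix (Fin 8) (Fin 8) ℤ) (i k : Fin 8) :
    (halfCoeff a * M) i k =
      halfCoeff a i i * M i k + halfCoeff a i (octPartner i) * M (octPartner i) k := by
  rw [Matrix.mul_apply]
  refine Finset.sum_eq_add i (octPartner i) (octPartner_ne i) (fun l _ hl => ?_) (by simp) (by simp)
  rw [← one_mul (halfCoeff a i l), halfCoeff_eq_zero a i l hl.1 hl.2, zero_mul]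

theorem mul_halfCoeff_transpose_apply (a : Fin 4) (M : Matrix (Fin 8) (Fin 8) ℤ) (i k : Fin 8) :
    (M * (halfCoeff a)ᵀ) i k =
      M i k * halfCoeff a k k + M i (octPartner k) * halfCoeff a k (octPartner k) := by
  rw [Matrix.mul_apply]
  refine Finset.sum_eq_add k (octPartner k) (octPartner_ne k) (fun l _ hl => ?_) (by simp) (by simp)
  rw [transpose_apply, ← one_mul (halfCoeff a k l), halfCoeff_eq_zero a k l hl.1 hl.2, mul_zero]

/-- The entries of the products of the coefficients of `octDG` and of `halfG`. -/
def diffHalf (j : Fin 7) (i k : Fin 8) (a : Fin 4) (b : Fin 5) : ℤ :=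
  diffCoeff j b i k * halfCoeff a k k +
    diffCoeff j b i (octPartner k) * halfCoeff a k (octPartner k)

/-- The entries of the products of the coefficients of `halfG` and of `octTheta`. -/
def halfTheta (j : Fin 7) (i k : Fin 8) (a : Fin 4) (b : Fin 5) : ℤ :=
  halfCoeff a i i * thetaCoeff j b i k + halfCoeff a i (octPartner i) * thetaCoeff j b (octPartner i) k

/-- The coefficients of the product of a polynomial of degree three and one of degree four. -/
def convCoeff (F : Fin 4 → Fin 5 → ℤ) : Fin 8 → ℤ :=
  ![F 0 0, F 0 1 + F 1 0, F 0 2 + F 1 1 + F 2 0, F 0 3 + F 1 2 + F 2 1 + F 3 0,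
    F 0 4 + F 1 3 + F 2 2 + F 3 1, F 1 4 + F 2 3 + F 3 2, F 2 4 + F 3 3, F 3 4]

/-- The eight coefficients of the degree seven identity dg · hᵀ = hθ, entry by entry. The direction
j = 0 is tangent to the meridian and is treated in `octDG_meridian`. -/
theorem convCoeff_diffHalf : ∀ j : Fin 7, j ≠ 0 → ∀ (i k : Fin 8) (d : Fin 8),
    convCoeff (diffHalf j i k) d = convCoeff (halfTheta j i k) d := by
  decide +kernel

theorem sum_convCoeff (γ σ : ℝ) (F : Fin 4 → Fin 5 → ℤ) :
    ∑ a : Fin 4, ∑ b : Fin 5, γ ^ (3 - (a : ℕ)) * σ ^ (a : ℕ) * (γ ^ (4 - (b : ℕ)) * σ ^ (b : ℕ)) *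
      (F a b : ℝ) = ∑ d : Fin 8, γ ^ (7 - (d : ℕ)) * σ ^ (d : ℕ) * (convCoeff F d : ℝ) := by
  simp [Fin.sum_univ_succ, convCoeff]
  ring

/-- A square root of `g₇` on the meridian through the first axis. -/
def halfG (γ σ : ℝ) : Matrix (Fin 8) (Fin 8) ℝ := octG (σ • Pi.single 0 1) γ

theorem octX_single_cast (a : Fin 7) :
    octX (Pi.single a (1 : ℝ)) = (octUnit a).map (Int.cast : ℤ → ℝ) := by
  ext i k
  simp [octX, octUnit, Pi.single_apply]

theorem unitMat_cast (a b : Fin 8) :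
    unitMat ℝ a b = (unitMat ℤ a b).map (Int.cast : ℤ → ℝ) := by
  ext i k
  simp [unitMat]

/-- The relation γ² + σ² = 1 raises the linear terms to degree three, so that h becomes homogeneous.
-/
theorem halfG_eq_sum {γ σ : ℝ} (h : γ ^ 2 + σ ^ 2 = 1) : halfG γ σ =
    ∑ a : Fin 4, (γ ^ (3 - (a : ℕ)) * σ ^ (a : ℕ)) • (halfCoeff a).map (Int.cast : ℤ → ℝ) := by
  have hN : octN (σ • Pi.single (0 : Fin 7) (1 : ℝ)) (σ • Pi.single 0 1) =
      σ ^ 2 • (unitMat ℝ 7 7 + unitMat ℝ 0 0) := by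
    have := octN_single 0 0
    rw [if_pos rfl, one_smul] at this
    rw [show (0 : Fin 8) = (0 : Fin 7).castSucc from rfl, ← this]
    simp only [octN, incl7_smul, smul_dotProduct, dotProduct_smul, smul_vecMulVec, vecMulVec_smul,
      smul_smul, smul_add, smul_eq_mul]
    module
  have hW : octW (σ • Pi.single (0 : Fin 7) (1 : ℝ)) =
      σ • (unitMat ℝ 0 7 - unitMat ℝ 7 0) := by
    have := octW_single 0
    rw [show (0 : Fin 8) = (0 : Fin 7).castSucc from rfl, ← this]
    simp only [octW, incl7_smul, smul_vecMulVec, vecMulVec_smul, smul_sub]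
  have hd : (σ • Pi.single (0 : Fin 7) (1 : ℝ)) ⬝ᵥ (σ • Pi.single (0 : Fin 7) (1 : ℝ)) = σ ^ 2 := by
    simp
    ring
  rw [halfG, octG, hN, hW, hd, octX_smul, octX_single_cast, unitMat_cast, unitMat_cast,
    unitMat_cast, unitMat_cast]
  ext i k
  simp only [Fin.sum_univ_four, halfCoeff, Matrix.of_apply, Matrix.add_apply, Matrix.sub_apply, Matrix.smul_apply,
    Matrix.map_apply, smul_eq_mul, Matrix.cons_val]
  have h1 : (1 : Matrix (Fin 8) (Fin 8) ℝ) i k = ((if i = k then 1 else 0 : ℤ) : ℝ) := by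
    simp [Matrix.one_apply]
  rw [h1]
  generalize (if i = k then (1 : ℤ) else 0) = δ
  push_cast
  simp
  linear_combination (-γ * (δ : ℝ) -
    σ * (octUnit 0 i k : ℝ)) * h

/-- The differential of `g₇` on the meridian through the first axis, in a direction orthogonal to
the meridian. -/
theorem octDG_single {γ σ s c : ℝ} (h : γ ^ 2 + σ ^ 2 = 1) (hs : s = 2 * σ * γ)
    (hc : c = γ ^ 2 - σ ^ 2) {j : Fin 7} (hj : j ≠ 0) :
    octDG (Pi.single 0 s + Pi.single 7 c) (Pi.single j.castSucc 1) =
      ∑ b : Fin 5, (γ ^ (4 - (b : ℕ)) * σ ^ (b : ℕ)) •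
        (diffCoeff j b).map (Int.cast : ℤ → ℝ) := by
  have hf : first7 (Pi.single 0 s + Pi.single 7 c) = s • Pi.single 0 1 := by
    ext m
    have : m.castSucc ≠ 7 := (Fin.castSucc_lt_last m).ne
    simp only [first7, Pi.add_apply, Pi.single_apply, this, if_false, add_zero, Pi.smul_apply,
      smul_eq_mul, mul_ite, mul_one, mul_zero]
    exact if_congr (Fin.castSucc_inj (b := (0 : Fin 7))) rfl rfl
  have hw : first7 (Pi.single j.castSucc 1) = Pi.single j 1 := by
    ext m
    simp only [first7, Pi.single_apply]
    exact if_congr Fin.castSucc_inj rfl rfl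
  have h7 : (7 : Fin 8) ≠ j.castSucc := (Fin.castSucc_lt_last j).ne'
  have h70 : (7 : Fin 8) ≠ 0 := by decide
  have hw7 : (Pi.single j.castSucc (1 : ℝ) : Fin 8 → ℝ) 7 = 0 := by
    simp [h7]
  have hx7 : (Pi.single 0 s + Pi.single 7 c : Fin 8 → ℝ) 7 = c := by
    simp [h70]
  have hsN : ∀ u : Fin 7 → ℝ, octN (s • Pi.single 0 1) u = s • octN (Pi.single 0 1) u := by
    intro u
    simp only [octN, incl7_smul, smul_dotProduct, smul_vecMulVec, smul_add, smul_eq_mul, mul_smul]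
  have hsN' : ∀ u : Fin 7 → ℝ, octN u (s • Pi.single 0 1) = s • octN u (Pi.single 0 1) := by
    intro u
    simp only [octN, incl7_smul, dotProduct_smul, vecMulVec_smul, smul_add, smul_eq_mul, mul_smul]
  have hd0 : (Pi.single (0 : Fin 7) (1 : ℝ)) ⬝ᵥ Pi.single j (1 : ℝ) = 0 := by
    simp [hj.symm]
  rw [octDG, hf, hw, hw7, hx7, mul_zero, zero_smul, zero_smul, hsN (Pi.single j 1),
    hsN' (Pi.single j 1), octN_single, octN_single, octW_single,
    if_neg hj, if_neg hj.symm, smul_dotProduct, hd0, smul_dotProduct, dotProduct_smul,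
    octX_single_cast, unitMat_cast, unitMat_cast, unitMat_cast, unitMat_cast, unitMat_cast]
  ext i k
  simp only [Fin.sum_univ_five, diffCoeff, Matrix.of_apply, Matrix.add_apply, Matrix.sub_apply, Matrix.smul_apply,
    Matrix.map_apply, smul_eq_mul, Matrix.cons_val]
  simp
  rw [hs, hc]
  have h2 : (γ ^ 2 + σ ^ 2) ^ 2 = 1 := by rw [h, one_pow]
  linear_combination (- (octUnit j i k : ℝ)) * h2

theorem octTheta_eq_sum {γ σ c : ℝ} (h : γ ^ 2 + σ ^ 2 = 1) (hc : c = γ ^ 2 - σ ^ 2) (j : Fin 7) :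
    octTheta c j = ∑ b : Fin 5, (γ ^ (4 - (b : ℕ)) * σ ^ (b : ℕ)) •
      (thetaCoeff j b).map (Int.cast : ℤ → ℝ) := by
  ext i k
  simp only [Fin.sum_univ_five, thetaCoeff, Matrix.add_apply, Matrix.smul_apply,
    Matrix.map_apply, smul_eq_mul, Matrix.cons_val, octTheta, Matrix.of_apply]
  split_ifs
  · rw [hc]
    simp
    have h2 : (γ ^ 2 + σ ^ 2) ^ 2 = 1 := by rw [h, one_pow]
    linear_combination (-(thetaP i k : ℝ)) * h2 - (γ ^ 2 - σ ^ 2) * (thetaQ i k : ℝ) * h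
  · simp

/-- With one factor h moved to the left as hᵀ = h⁻¹, both sides of dg = hθh become homogeneous of
degree 3 + 4 in γ and σ with integer matrix coefficients; comparing these suffices. -/
theorem octDG_single_eq {γ σ s c : ℝ} (h : γ ^ 2 + σ ^ 2 = 1) (hs : s = 2 * σ * γ)
    (hc : c = γ ^ 2 - σ ^ 2) {j : Fin 7} (hj : j ≠ 0) :
    octDG (Pi.single 0 s + Pi.single 7 c) (Pi.single j.castSucc 1) * (halfG γ σ)ᵀ =
      halfG γ σ * octTheta c j := by
  have hmul : ∀ A B : Matrix (Fin 8) (Fin 8) ℤ, A.map (Int.cast : ℤ → ℝ) *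
      B.map (Int.cast : ℤ → ℝ) = (A * B).map (Int.cast : ℤ → ℝ) := fun A B =>
    (Matrix.map_mul (f := Int.castRingHom ℝ)).symm
  rw [octDG_single h hs hc hj, halfG_eq_sum h, octTheta_eq_sum h hc j]
  ext i k
  simp only [transpose_sum, transpose_smul, Finset.sum_mul, Finset.mul_sum, Matrix.smul_mul,
    Matrix.mul_smul, smul_smul, ← transpose_map, hmul, Matrix.sum_apply, Matrix.smul_apply,
    Matrix.map_apply, smul_eq_mul, mul_halfCoeff_transpose_apply, halfCoeff_mul_apply]
  have e1 := sum_convCoeff γ σ (diffHalf j i k)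
  have e2 := sum_convCoeff γ σ (halfTheta j i k)
  simp only [convCoeff_diffHalf j hj i k] at e1
  rw [← e2] at e1
  refine Eq.trans ?_ (e1.trans ?_)
  · rfl
  · rw [Finset.sum_comm]
    refine Finset.sum_congr rfl fun a _ => Finset.sum_congr rfl fun b _ => ?_
    rw [mul_comm (γ ^ (3 - (b : ℕ)) * σ ^ (b : ℕ))]
    rfl

/-- The direction along the meridian. -/
theorem octDG_meridian {γ σ s c : ℝ} (h : γ ^ 2 + σ ^ 2 = 1) (hs : s = 2 * σ * γ)
    (hc : c = γ ^ 2 - σ ^ 2) :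
    octDG (Pi.single 0 s + Pi.single 7 c) (Pi.single 0 c - Pi.single 7 s) =
      octG (s • Pi.single 0 1) c * octX (Pi.single 0 1) := by
  have hsc : s ^ 2 + c ^ 2 = 1 := by
    rw [hs, hc]
    linear_combination (γ ^ 2 + σ ^ 2 + 1) * h
  have h70 : (7 : Fin 8) ≠ 0 := by decide
  have hf : ∀ s c : ℝ, first7 (Pi.single 0 s + Pi.single 7 c) = s • Pi.single 0 1 := by
    intro s c
    ext m
    have : m.castSucc ≠ 7 := (Fin.castSucc_lt_last m).ne
    simp only [first7, Pi.add_apply, Pi.single_apply, this, if_false, add_zero, Pi.smul_apply,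
      smul_eq_mul, mul_ite, mul_one, mul_zero]
    exact if_congr (Fin.castSucc_inj (b := (0 : Fin 7))) rfl rfl
  have hsub : (Pi.single 0 c - Pi.single 7 s : Fin 8 → ℝ) = Pi.single 0 c + Pi.single 7 (-s) := by
    rw [Pi.single_neg, sub_eq_add_neg]
  have h7 : ∀ s c : ℝ, (Pi.single 0 s + Pi.single 7 c : Fin 8 → ℝ) 7 = c := by
    intro s c
    simp [h70]
  have hN : ∀ a b : ℝ, octN (a • Pi.single (0 : Fin 7) (1 : ℝ)) (b • Pi.single 0 1) =
      (a * b) • octN (Pi.single 0 1) (Pi.single 0 1) := by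
    intro a b
    simp only [octN, incl7_smul, smul_dotProduct, dotProduct_smul, smul_vecMulVec, vecMulVec_smul,
      smul_smul, smul_add, smul_eq_mul]
    module
  have hW : ∀ a : ℝ, octW (a • Pi.single (0 : Fin 7) (1 : ℝ)) = a • octW (Pi.single 0 1) := by
    intro a
    simp only [octW, incl7_smul, smul_vecMulVec, vecMulVec_smul, smul_sub]
  have hd : (Pi.single (0 : Fin 7) (1 : ℝ)) ⬝ᵥ Pi.single 0 (1 : ℝ) = 1 := by simp
  have hXX := octX_mul_octX (Pi.single (0 : Fin 7) (1 : ℝ))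
  have hNX := octN_mul_octX (Pi.single (0 : Fin 7) (1 : ℝ))
  have hWX := octW_mul_octX (Pi.single (0 : Fin 7) (1 : ℝ))
  rw [hd] at hXX hNX
  rw [hsub, octDG, octG, hf, hf, h7, h7]
  simp only [hN, hW, octX_smul, smul_dotProduct, dotProduct_smul, hd, smul_eq_mul, mul_one,
    add_mul, sub_mul, Matrix.smul_mul, one_mul, hXX, hNX, hWX]
  match_scalars <;> first | ring1 | linear_combination (-8 * s) * hsc

theorem first7_single_add (s c : ℝ) :
    first7 (Pi.single 0 s + Pi.single 7 c) = s • Pi.single 0 1 := by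
  ext m
  have : m.castSucc ≠ 7 := (Fin.castSucc_lt_last m).ne
  simp only [first7, Pi.add_apply, Pi.single_apply, this, if_false, add_zero, Pi.smul_apply,
    smul_eq_mul, mul_ite, mul_one, mul_zero]
  exact if_congr (Fin.castSucc_inj (b := (0 : Fin 7))) rfl rfl

theorem single_add_single_apply_last (s c : ℝ) :
    (Pi.single 0 s + Pi.single 7 c : Fin 8 → ℝ) 7 = c := by
  have h70 : (7 : Fin 8) ≠ 0 := by decide
  simp [h70]

theorem halfG_eq_exp (t : ℝ) :
    halfG (Real.cos t) (Real.sin t) = NormedSpace.exp (t • octX (Pi.single 0 1)) :=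
  (exp_smul_octX (by simp) t).symm

open scoped Matrix.Norms.Operator in
theorem halfG_mul_halfG (t : ℝ) : halfG (Real.cos t) (Real.sin t) * halfG (Real.cos t) (Real.sin t) =
    octG (Real.sin (2 * t) • Pi.single 0 1) (Real.cos (2 * t)) := by
  rw [← exp_smul_octX (by simp), halfG_eq_exp, ← Matrix.exp_add_of_commute _ _ (Commute.refl _),
    ← add_smul, two_mul]

theorem halfG_eq (γ σ : ℝ) : halfG γ σ = γ • (1 : Matrix (Fin 8) (Fin 8) ℝ) +
    σ • octX (Pi.single 0 1) - (4 * γ * σ ^ 2) • octN (Pi.single 0 1) (Pi.single 0 1) -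
      (4 * σ ^ 3) • octW (Pi.single 0 1) := by
  have hd : (Pi.single (0 : Fin 7) (1 : ℝ)) ⬝ᵥ Pi.single 0 (1 : ℝ) = 1 := by simp
  simp only [halfG, octG, octN, octW, octX_smul, incl7_smul, smul_dotProduct, dotProduct_smul,
    smul_vecMulVec, vecMulVec_smul, hd, smul_eq_mul]
  module

theorem octX_mul_halfG (γ σ : ℝ) :
    octX (Pi.single 0 1) * halfG γ σ = halfG γ σ * octX (Pi.single 0 1) := by
  rw [halfG_eq]
  simp only [mul_add, add_mul, mul_sub, sub_mul, Matrix.mul_smul, Matrix.smul_mul, mul_one, one_mul,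
    octX_mul_octN, octN_mul_octX, octX_mul_octW, octW_mul_octX]

theorem halfG_transpose_mul {γ σ : ℝ} (h : γ ^ 2 + σ ^ 2 = 1) : (halfG γ σ)ᵀ * halfG γ σ = 1 := by
  apply octG_transpose_mul
  simp
  linarith

theorem octTheta_zero (c : ℝ) : octTheta c 0 = octX (Pi.single 0 1) := by
  rw [octX_single_cast]
  ext i k
  have h : ∀ i k, (if octIndex i k = 0 then thetaP i k else 0) =
      (if octIndex i k = 0 then octSign i k else 0) ∧
      (if octIndex i k = 0 then thetaQ i k else 0) = 0 := by decide +kernel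
  obtain ⟨h1, h2⟩ := h i k
  simp only [octTheta, octUnit, Matrix.of_apply, Matrix.map_apply]
  split_ifs at * <;> simp_all

/-- A rotation in the plane of the axes 0 and 7. Its columns 0 and 7 will be the tangent of the
meridian and the point itself, while the other columns are standard axes. -/
theorem rotExp_octW_apply (c s : ℝ) (i k : Fin 8) :
    rotExp (octW (Pi.single 0 1)) c s i k = (1 : Matrix (Fin 8) (Fin 8) ℝ) i k +
      s * ((if i = 0 ∧ k = 7 then 1 else 0) - if i = 7 ∧ k = 0 then 1 else 0) -
      (1 - c) * ((if i = 7 ∧ k = 7 then 1 else 0) + if i = 0 ∧ k = 0 then 1 else 0) := by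
  have h : (0 : Fin 7).castSucc = 0 := rfl
  rw [rotExp, octW_mul_octW, octW_single, octN_single, if_pos rfl, h]
  simp only [unitMat, Matrix.add_apply, Matrix.smul_apply, Matrix.sub_apply, Matrix.neg_apply,
    Matrix.of_apply, smul_eq_mul]
  ring

/-- Factoring h out on both sides is what makes θ simple: with g = h² one gets g⁻¹dg = h⁻¹θh, and θ
is monomial and affine in the cosine of the polar angle. -/
theorem octDG_frame {t s c : ℝ} (hs : s = Real.sin (2 * t)) (hc : c = Real.cos (2 * t)) (k : Fin 7) :
    octDG (Pi.single 0 s + Pi.single 7 c)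
      (fun i => rotExp (octW (Pi.single 0 1)) c s i k.castSucc) =
      halfG (Real.cos t) (Real.sin t) * octTheta c k * halfG (Real.cos t) (Real.sin t) := by
  have h := Real.cos_sq_add_sin_sq t
  have hs' : s = 2 * Real.sin t * Real.cos t := by rw [hs, Real.sin_two_mul]
  have hc' : c = Real.cos t ^ 2 - Real.sin t ^ 2 := by rw [hc, Real.cos_two_mul']
  by_cases hk : k = 0
  · have hcol : (fun i => rotExp (octW (Pi.single 0 1)) c s i k.castSucc) =
        Pi.single 0 c - Pi.single 7 s := by
      ext i
      have h0 : (0 : Fin 7).castSucc = 0 := rfl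
      rw [rotExp_octW_apply, hk, h0]
      have h07 : (0 : Fin 8) ≠ 7 := by decide
      by_cases hi : i = 0
      · subst hi
        simp [h07]
      · by_cases hi' : i = 7
        · simp [hi', h07.symm]
        · simp [hi, hi']
    rw [hcol, octDG_meridian h hs' hc', hs, hc, ← halfG_mul_halfG, hk, octTheta_zero, mul_assoc,
      mul_assoc, octX_mul_halfG]
  · have h1 : k.castSucc ≠ 0 := fun e => hk (Fin.castSucc_injective _ e)
    have h2 : k.castSucc ≠ 7 := (Fin.castSucc_lt_last k).ne
    have hcol : (fun i => rotExp (octW (Pi.single 0 1)) c s i k.castSucc) =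
        Pi.single k.castSucc 1 := by
      ext i
      rw [rotExp_octW_apply]
      simp [h1, h2, Matrix.one_apply, Pi.single_apply]
    have hT := halfG_transpose_mul h
    rw [hcol, ← octDG_single_eq h hs' hc' hk, mul_assoc, hT, mul_one]

/-- An oriented orthonormal frame at a point of the sphere in which the Maurer-Cartan form of `g₇`
takes the standard form. -/
theorem exists_frame {Γ : Fin 7 → Mat8} (hΓ : IsGammaSystem Γ) {R : Matrix (Fin 8) (Fin 8) ℝ}
    (hRR : R ∈ Matrix.orthogonalGroup (Fin 8) ℝ)
    (hR : ∀ a : EuclideanSpace ℝ (Fin 7), expMap Γ a =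
      complexify (R * octG (Real.sinc ‖a‖ • (a : Fin 7 → ℝ)) (Real.cos ‖a‖) * Rᵀ)) (x : S7) :
    ∃ T ∈ Matrix.specialOrthogonalGroup (Fin 8) ℝ, colVec T 7 = x.1 ∧
      ∃ L ∈ Matrix.specialOrthogonalGroup (Fin 8) ℝ, ∀ k : Fin 7,
        maurerCartan (g7 Γ) x (colVec T k.castSucc) =
          complexify (R * (L * octTheta (x.1 7) k * Lᵀ) * Rᵀ) := by
  obtain ⟨U, hU, h0, hi⟩ := exists_isOctAut x.1
  set s := (U *ᵥ x.1) 0 with hs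
  set c := x.1 7 with hc
  have hx0 : U *ᵥ x.1 = Pi.single 0 s + Pi.single 7 c := by
    ext i
    have h07 : (0 : Fin 8) ≠ 7 := by decide
    by_cases h1 : i = 0
    · simp [h1, hs, h07]
    · by_cases h2 : i = 7
      · rw [h2, hU.apply_last]
        simp [h07.symm, hc]
      · rw [hi i h1 h2]
        simp [h1, h2]
  have hV := hU.transpose
  have hxV : Uᵀ *ᵥ (Pi.single 0 s + Pi.single 7 c) = x.1 := by
    rw [← hx0, mulVec_mulVec, hU.transpose_mul_self, one_mulVec]
  have hsc : s ^ 2 + c ^ 2 = 1 := by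
    have h1 := hU.dotProduct x.1 x.1
    have h2 : (x.1 : Fin 8 → ℝ) ⬝ᵥ x.1 = 1 := by
      have e := EuclideanSpace.real_norm_sq_eq x.1
      rw [norm_eq_of_mem_sphere] at e
      simp only [dotProduct, ← sq, ← e, one_pow]
    rw [hx0, h2] at h1
    have h07 : (0 : Fin 8) ≠ 7 := by decide
    simp [h07, h07.symm] at h1
    linarith
  have hc1 : -1 ≤ c := by nlinarith [sq_nonneg s]
  have hc2 : c ≤ 1 := by nlinarith [sq_nonneg s]
  -- Half the polar angle; the condition s ≥ 0 makes s the sine of the full one.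
  set t := Real.arccos c / 2 with ht
  have h2t : 2 * t = Real.arccos c := by
    rw [ht]
    ring
  have hct : c = Real.cos (2 * t) := by rw [h2t, Real.cos_arccos hc1 hc2]
  have hst : s = Real.sin (2 * t) := by
    rw [h2t, Real.sin_arccos, ← hsc]
    simp [Real.sqrt_sq h0]
  set E := octW (Pi.single (0 : Fin 7) (1 : ℝ)) with hE
  have hd : (Pi.single (0 : Fin 7) (1 : ℝ)) ⬝ᵥ Pi.single 0 (1 : ℝ) = 1 := by simp
  have hF : rotExp E c s ∈ Matrix.specialOrthogonalGroup (Fin 8) ℝ := by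
    refine rotExp_mem_specialOrthogonalGroup (octW_transpose _) ?_ (by linarith)
    rw [octW_mul_octW, neg_mul, octN_mul_octW, hd, one_smul]
  have hT := mul_mem hV.mem hF
  have hcol : ∀ k, (colVec (Uᵀ * rotExp E c s) k : Fin 8 → ℝ) = Uᵀ *ᵥ fun i => rotExp E c s i k :=
    fun k => rfl
  have h7 : colVec (Uᵀ * rotExp E c s) 7 = x.1 := by
    have e : (fun i => rotExp E c s i 7) = Pi.single 0 s + Pi.single 7 c := by
      ext i
      have h07 : (0 : Fin 8) ≠ 7 := by decide
      rw [hE, rotExp_octW_apply]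
      by_cases hi : i = 0
      · subst hi
        simp [h07, h07.symm]
      · by_cases hi' : i = 7
        · subst hi'
          simp [h07.symm]
        · simp [hi, hi']
    have h := hcol 7
    rw [e, hxV] at h
    exact (WithLp.ofLp_injective 2) h
  have hh := halfG_transpose_mul (Real.cos_sq_add_sin_sq t)
  set h := halfG (Real.cos t) (Real.sin t) with hhdef
  -- g⁻¹dg = Uᵀ(hᵀθh)U, so L = Uᵀhᵀ. It has determinant 1 because hᵀ is the exponential of a skew
  -- matrix.
  refine ⟨_, hT, h7, Uᵀ * hᵀ, mul_mem hV.mem ?_, fun k => ?_⟩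
  · have : hᵀ = NormedSpace.exp (-(t • octX (Pi.single 0 1))) := by
      rw [hhdef, halfG_eq_exp, ← Matrix.exp_transpose, transpose_smul, octX_transpose, smul_neg]
    rw [this]
    apply exp_mem_specialOrthogonalGroup
    rw [transpose_neg, transpose_smul, octX_transpose, smul_neg]
  · have horth : (inner ℝ x.1 (colVec (Uᵀ * rotExp E c s) k.castSucc) : ℝ) = 0 := by
      have hT1 := (Matrix.mem_orthogonalGroup_iff' (Fin 8) ℝ).1
        (Matrix.mem_specialOrthogonalGroup_iff.1 hT).1
      have e := congrFun (congrFun hT1 7) k.castSucc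
      have hk : (7 : Fin 8) ≠ k.castSucc := (Fin.castSucc_lt_last k).ne'
      rw [Matrix.one_apply_ne hk, Matrix.mul_apply] at e
      rw [← h7, PiLp.inner_apply, ← e]
      simp [colVec, mul_comm]
    have hG : octG8 x.1 = Uᵀ * (h * h) * U := by
      rw [← hxV, hV.octG8, transpose_transpose, octG8, first7_single_add,
        single_add_single_apply_last, hhdef, halfG_mul_halfG, ← hst, ← hct]
    have hD : octDG x.1 (colVec (Uᵀ * rotExp E c s) k.castSucc) = Uᵀ * (h * octTheta c k * h) * U := by
      rw [hcol]
      conv_lhs => rw [← hxV]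
      rw [hV.octDG, transpose_transpose, octDG_frame hst hct]
    rw [maurerCartan_g7 hΓ hRR hR, horth]
    simp only [zero_mul, sub_zero]
    congr 3
    rw [hD, hG]
    simp only [transpose_mul, transpose_transpose, mul_assoc]
    rw [← mul_assoc U Uᵀ, hU.mul_transpose_self, one_mul, ← mul_assoc hᵀ h, hh, one_mul]

end

noncomputable section

/-! ### Alternating sums of ordered products -/

/-- The alternating sum of the products of the `v k` in all orders. -/
def altProd {A : Type*} [Ring A] {n : ℕ} (v : Fin n → A) : A :=
  ∑ σ : Equiv.Perm (Fin n), (Equiv.Perm.sign σ : ℤ) • (List.ofFn fun k => v (σ k)).prod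

theorem sum_perm_fin_succ {M : Type*} [AddCommMonoid M] {n : ℕ}
    (F : Equiv.Perm (Fin (n + 1)) → M) : ∑ σ, F σ =
      ∑ p : Fin (n + 1), ∑ e : Equiv.Perm (Fin n), F (Equiv.Perm.decomposeFin.symm (p, e)) := by
  rw [← Equiv.sum_comp Equiv.Perm.decomposeFin.symm, Fintype.sum_prod_type]

/-- Expansion along the first factor. If v_{p+1} stands first, v_0 takes its place among the others;
this transposition gives the minus sign. -/
theorem altProd_succ {A : Type*} [Ring A] {n : ℕ} (v : Fin (n + 1) → A) :
    altProd v = v 0 * altProd (fun k => v k.succ) -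
      ∑ p : Fin n, v p.succ * altProd (Function.update (fun k => v k.succ) p (v 0)) := by
  rw [altProd, sum_perm_fin_succ, Fin.sum_univ_succ, sub_eq_add_neg, ← Finset.sum_neg_distrib]
  congr 1
  · rw [altProd, Finset.mul_sum]
    refine Finset.sum_congr rfl fun e _ => ?_
    rw [Equiv.Perm.decomposeFin.symm_sign, if_pos rfl, one_mul, List.ofFn_succ, List.prod_cons,
      mul_smul_comm]
    simp
  · refine Finset.sum_congr rfl fun p _ => ?_
    rw [altProd, Finset.mul_sum, ← Finset.sum_neg_distrib]
    refine Finset.sum_congr rfl fun e _ => ?_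
    have h : ∀ k, v (Equiv.swap 0 p.succ (e k).succ) =
        Function.update (fun k => v k.succ) p (v 0) (e k) := by
      intro k
      by_cases hk : e k = p
      · rw [hk, Equiv.swap_apply_right, Function.update_self]
      · rw [Equiv.swap_apply_of_ne_of_ne (Fin.succ_ne_zero _) (fun h => hk (Fin.succ_injective _ h)),
          Function.update_of_ne hk]
    rw [Equiv.Perm.decomposeFin.symm_sign, if_neg (Fin.succ_ne_zero p), List.ofFn_succ,
      List.prod_cons, mul_smul_comm]
    simp [h]

theorem altProd_map {A B : Type*} [Ring A] [Ring B] (φ : A →+* B) {n : ℕ} (v : Fin n → A) :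
    φ (altProd v) = altProd fun k => φ (v k) := by
  rw [altProd, altProd, map_sum]
  refine Finset.sum_congr rfl fun σ _ => ?_
  rw [map_zsmul, map_list_prod, List.map_ofFn]
  rfl

theorem trace_prod_rotate {R : Type*} [CommRing R] {n : ℕ}
    (w : Fin (n + 1) → Matrix (Fin 8) (Fin 8) R) :
    ((List.ofFn fun k => w (finRotate (n + 1) k)).prod).trace = ((List.ofFn w).prod).trace := by
  have h : ∀ k : Fin n, finRotate (n + 1) k.castSucc = k.succ := by
    intro k
    rw [finRotate_apply, Fin.coeSucc_eq_succ]
  rw [List.ofFn_succ', List.concat_eq_append, List.prod_append, finRotate_last]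
  simp only [h]
  rw [List.prod_singleton, Matrix.trace_mul_comm, List.ofFn_succ, List.prod_cons]

/-- The trace is cyclic and a cycle of length seven is even, so the orders with v_0 in a given
position contribute the same for each of the seven positions. -/
theorem trace_altProd {R : Type*} [CommRing R] (v : Fin 7 → Matrix (Fin 8) (Fin 8) R) :
    (altProd v).trace = 7 * (v 0 * altProd fun k : Fin 6 => v k.succ).trace := by
  let g : Equiv.Perm (Fin 7) → R := fun σ =>
    (Equiv.Perm.sign σ : ℤ) • ((List.ofFn fun k => v (σ k)).prod).trace
  have hg : ∀ σ, g (σ * finRotate 7) = g σ := by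
    intro σ
    simp only [g, Equiv.Perm.sign_mul, sign_finRotate, Equiv.Perm.coe_mul, Function.comp_apply]
    rw [trace_prod_rotate fun k => v (σ k)]
    norm_num
  let h : Fin 7 → R := fun m => ∑ σ : Equiv.Perm (Fin 7), if σ m = 0 then g σ else 0
  have hh : ∀ m, h (finRotate 7 m) = h m := by
    intro m
    simp only [h]
    rw [← Equiv.sum_comp (Equiv.mulRight (finRotate 7)) fun σ => if σ m = 0 then g σ else 0]
    simp only [Equiv.coe_mulRight, hg, Equiv.Perm.coe_mul, Function.comp_apply]
  have h0 : ∀ m, h m = h 0 := by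
    intro m
    induction m using Fin.induction with
    | zero => rfl
    | succ k ih => rw [← ih, ← hh k.castSucc, finRotate_apply, Fin.coeSucc_eq_succ]
  have h1 : (altProd v).trace = ∑ m, h m := by
    simp only [h]
    rw [Finset.sum_comm, altProd, Matrix.trace_sum]
    refine Finset.sum_congr rfl fun σ _ => ?_
    rw [Matrix.trace_smul, Finset.sum_eq_single (σ⁻¹ 0)]
    · simp [g]
    · intro m _ hm
      rw [if_neg]
      intro e
      exact hm (by rw [← e]; simp)
    · simp
  have h2 : h 0 = (v 0 * altProd fun k : Fin 6 => v k.succ).trace := by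
    simp only [h]
    rw [sum_perm_fin_succ, Finset.sum_eq_single 0]
    · rw [altProd, Finset.mul_sum, Matrix.trace_sum]
      refine Finset.sum_congr rfl fun e _ => ?_
      rw [Equiv.Perm.decomposeFin_symm_apply_zero, if_pos rfl]
      simp only [g]
      rw [Equiv.Perm.decomposeFin.symm_sign, if_pos rfl, one_mul, List.ofFn_succ, List.prod_cons,
        mul_smul_comm, Matrix.trace_smul]
      simp
    · intro p _ hp
      refine Finset.sum_eq_zero fun e _ => ?_
      rw [Equiv.Perm.decomposeFin_symm_apply_zero, if_neg hp]
    · simp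
  rw [h1, Finset.sum_congr rfl fun m _ => h0 m, h2]
  simp

/-! ### Evaluation for monomial matrices -/

/-- A list of pairs `(k_i, w_i)` represents the monomial matrix with entries `w_i` at `(i, k_i)`. -/
def RepMonomial (d : List (ℕ × ℤ)) (M : Matrix (Fin 8) (Fin 8) ℤ) : Prop :=
  ∀ i : Fin 8, ∃ k : Fin 8, (d.getD i (0, 0)).1 = k ∧
    ∀ j, M i j = if j = k then (d.getD i (0, 0)).2 else 0

/-- An entry of the alternating sum of the products of monomial matrices. -/
def monoPath (j : ℕ) : ℕ → List (List (ℕ × ℤ)) → ℕ → ℤ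
  | 0, _, i => if i = j then 1 else 0
  | n + 1, l, i => match l with
    | [] => 0
    | a :: t =>
      Int.add (Int.mul (a.getD i (0, 0)).2 (monoPath j n t (a.getD i (0, 0)).1))
        (Nat.rec (motive := fun _ => ℤ) 0 (fun p r =>
          Int.sub r (Int.mul ((t.getD p []).getD i (0, 0)).2
            (monoPath j n (t.set p a) ((t.getD p []).getD i (0, 0)).1))) n)

/-- A product of monomial matrices follows a single path of columns, so the expansion along the
first factor needs no sum over intermediate indices. -/
theorem altProd_apply_eq_monoPath (j : Fin 8) : ∀ (n : ℕ) (v : Fin n → Matrix (Fin 8) (Fin 8) ℤ)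
    (l : List (List (ℕ × ℤ))), l.length = n → (∀ k : Fin n, RepMonomial (l.getD k []) (v k)) →
    ∀ i : Fin 8, altProd v i j = monoPath j n l i := by
  intro n
  induction n with
  | zero =>
    intro v l _ _ i
    simp [altProd, monoPath, Matrix.one_apply, Fin.ext_iff]
  | succ n ih =>
    intro v l hl hv i
    obtain ⟨a, t, rfl⟩ : ∃ a t, l = a :: t := List.exists_cons_of_length_eq_add_one hl
    have ht : t.length = n := by simpa using hl
    have hmul : ∀ (d : List (ℕ × ℤ)) (M N : Matrix (Fin 8) (Fin 8) ℤ) (l' : List (List (ℕ × ℤ))),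
        RepMonomial d M → (∀ i : Fin 8, N i j = monoPath j n l' i) →
        (M * N) i j = Int.mul (d.getD i (0, 0)).2 (monoPath j n l' (d.getD i (0, 0)).1) := by
      intro d M N l' hd hN
      obtain ⟨k, hk, hM⟩ := hd i
      rw [Matrix.mul_apply, Finset.sum_eq_single k]
      · rw [hM, if_pos rfl, hk, hN]
        rfl
      · intro b _ hb
        rw [hM, if_neg hb, zero_mul]
      · simp
    have hrec : ∀ (f : ℕ → ℤ) (m : ℕ),
        (Nat.rec (motive := fun _ => ℤ) 0 (fun p r => Int.sub r (f p)) m : ℤ) =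
          -∑ p : Fin m, f p := by
      intro f m
      induction m with
      | zero => simp
      | succ m ihm =>
        rw [Fin.sum_univ_castSucc]
        simp only [ihm, Fin.val_castSucc, Fin.val_last]
        show -_ - _ = _
        ring
    rw [altProd_succ, Matrix.sub_apply, Matrix.sum_apply, monoPath]
    rw [hrec fun p => Int.mul ((t.getD p []).getD i (0, 0)).2
            (monoPath j n (t.set p a) ((t.getD p []).getD i (0, 0)).1)]
    have h0 := hv 0
    rw [hmul a _ _ t (by simpa using h0) (ih _ t ht fun k => hv k.succ),
      sub_eq_add_neg]
    congr 2
    refine Finset.sum_congr rfl fun p _ => ?_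
    have hp := hv p.succ
    refine hmul _ _ _ (t.set p a) (by simpa using hp) (ih _ _ (by simpa using ht) fun k => ?_)
    by_cases hk : k = p
    · subst hk
      rw [Function.update_self, List.getD_eq_getElem _ _ (by simp [ht]), List.getElem_set]
      simpa using h0
    · rw [Function.update_of_ne hk]
      have := hv k.succ
      have hkp : (p : ℕ) ≠ k := fun e => hk (Fin.ext e.symm)
      rw [List.getD_eq_getElem _ _ (by simp [ht]), List.getElem_set_ne hkp]
      rw [List.getD_eq_getElem _ _ (by simp [ht])] at this
      simpa using this

/-- The entries of the monomial matrices `octTheta`. -/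
def thetaData (c : ℤ) : List (List (ℕ × ℤ)) :=
  [[(7, 3), (6, 1), (3, 1), (2, -1), (5, -1), (4, 1), (1, -1), (0, -3)],
    [(6, 1 - 2 * c), (7, 1 + 2 * c), (4, 1), (5, 1), (2, -1), (3, -1), (0, -1 + 2 * c),
      (1, -1 - 2 * c)],
    [(3, 1 - 2 * c), (4, -1), (7, 1 + 2 * c), (0, -1 + 2 * c), (1, 1), (6, 1), (5, -1),
      (2, -1 - 2 * c)],
    [(2, -1 + 2 * c), (5, -1), (0, 1 - 2 * c), (7, 1 + 2 * c), (6, -1), (1, 1), (4, 1),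
      (3, -1 - 2 * c)],
    [(5, -1 + 2 * c), (2, 1), (1, -1), (6, 1), (7, 1 + 2 * c), (0, 1 - 2 * c), (3, -1),
      (4, -1 - 2 * c)],
    [(4, 1 - 2 * c), (3, 1), (6, -1), (1, -1), (0, -1 + 2 * c), (7, 1 + 2 * c), (2, 1),
      (5, -1 - 2 * c)],
    [(1, -1 + 2 * c), (0, 1 - 2 * c), (5, 1), (4, -1), (3, 1), (2, -1), (7, 1 + 2 * c),
      (6, -1 - 2 * c)]]

theorem thetaData_eq : ∀ c ∈ ([-3, -2, -1, 0, 1, 2, 3] : List ℤ), ∀ (j : Fin 7) (i : Fin 8),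
    ∃ k : Fin 8, (((thetaData c).getD j []).getD i (0, 0)).1 = k ∧
      (((thetaData c).getD j []).getD i (0, 0)).2 = thetaP i k + c * thetaQ i k ∧
      ∀ l : Fin 8, octIndex i l = j ∧ (thetaP i l ≠ 0 ∨ thetaQ i l ≠ 0) ↔ l = k := by
  decide +kernel

theorem repMonomial_octTheta {c : ℤ} (hc : c ∈ ([-3, -2, -1, 0, 1, 2, 3] : List ℤ)) (j : Fin 7) :
    RepMonomial ((thetaData c).getD j []) (octTheta c j) := by
  intro i
  obtain ⟨k, h1, h2, h3⟩ := thetaData_eq c hc j i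
  refine ⟨k, h1, fun l => ?_⟩
  rw [h2]
  simp only [octTheta, Matrix.of_apply, Int.cast_id]
  by_cases hl : l = k
  · subst hl
    rw [if_pos rfl, if_pos ((h3 l).2 rfl).1]
  · rw [if_neg hl]
    split_ifs with h
    · have h4 := mt (fun h' => (h3 l).1 ⟨h, h'⟩) hl
      push Not at h4
      rw [h4.1, h4.2, mul_zero, add_zero]
    · rfl

/-- One seventh of the alternating sum of the traces. -/
def chernPath (c : ℤ) : ℤ :=
  ∑ i : Fin 8, (((thetaData c).getD 0 []).getD i (0, 0)).2 *
    monoPath i 6 (thetaData c).tail (((thetaData c).getD 0 []).getD i (0, 0)).1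

/-- Seven sample points, one more than the degree of the polynomial in c. -/
theorem chernPath_eq : ∀ c ∈ ([-3, -2, -1, 0, 1, 2, 3] : List ℤ),
    chernPath c = 12288 * (2 * c ^ 6 + 5 * c ^ 4 + 2 * c ^ 2) := by
  decide +kernel

theorem trace_octTheta_int {c : ℤ} (hc : c ∈ ([-3, -2, -1, 0, 1, 2, 3] : List ℤ)) :
    (octTheta c 0 * altProd fun k : Fin 6 => octTheta c k.succ).trace =
      12288 * (2 * c ^ 6 + 5 * c ^ 4 + 2 * c ^ 2) := by
  rw [← chernPath_eq c hc, Matrix.trace, chernPath]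
  refine Finset.sum_congr rfl fun i _ => ?_
  obtain ⟨k, h1, h2⟩ := repMonomial_octTheta hc 0 i
  rw [Matrix.diag_apply, Matrix.mul_apply, Finset.sum_eq_single k]
  · rw [h2, if_pos rfl, altProd_apply_eq_monoPath i 6 _ (thetaData c).tail rfl fun k => ?_]
    · exact congrArg (fun m => _ * monoPath i 6 (thetaData c).tail m) h1.symm
    · exact repMonomial_octTheta hc k.succ
  · intro l _ hl
    rw [h2, if_neg hl, zero_mul]
  · simp

/-! ### Interpolation in the cosine of the polar angle -/

open Polynomial in
theorem natDegree_mul_apply_le {M N : Matrix (Fin 8) (Fin 8) ℤ[X]} {a b : ℕ}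
    (hM : ∀ i j, (M i j).natDegree ≤ a) (hN : ∀ i j, (N i j).natDegree ≤ b) (i j : Fin 8) :
    ((M * N) i j).natDegree ≤ a + b := by
  rw [Matrix.mul_apply]
  exact Polynomial.natDegree_sum_le_of_forall_le _ _ fun k _ =>
    Polynomial.natDegree_mul_le_of_le (hM i k) (hN k j)

open Polynomial in
theorem natDegree_altProd_apply_le {n : ℕ} (v : Fin n → Matrix (Fin 8) (Fin 8) ℤ[X])
    (hv : ∀ k i j, (v k i j).natDegree ≤ 1) (i j : Fin 8) :
    (altProd v i j).natDegree ≤ n := by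
  have hprod : ∀ (n : ℕ) (w : Fin n → Matrix (Fin 8) (Fin 8) ℤ[X]),
      (∀ k i j, (w k i j).natDegree ≤ 1) → ∀ i j, ((List.ofFn w).prod i j).natDegree ≤ n := by
    intro n
    induction n with
    | zero =>
      intro w _ i j
      simp only [List.ofFn_zero, List.prod_nil, Matrix.one_apply]
      split_ifs <;> simp
    | succ n ih =>
      intro w hw i j
      rw [List.ofFn_succ, List.prod_cons]
      exact (natDegree_mul_apply_le (hw 0) (ih _ fun k => hw k.succ) i j).trans (add_comm 1 n).le
  rw [altProd, Matrix.sum_apply]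
  refine Polynomial.natDegree_sum_le_of_forall_le _ _ fun σ _ => ?_
  rw [Matrix.smul_apply]
  exact (Polynomial.natDegree_smul_le _ _).trans (hprod n _ (fun k => hv (σ k)) i j)

theorem octTheta_map {R S : Type*} [CommRing R] [CommRing S] (φ : R →+* S) (c : R) (j : Fin 7) :
    φ.mapMatrix (octTheta c j) = octTheta (φ c) j := by
  ext i k
  simp [octTheta, apply_ite φ]

theorem trace_octTheta_map {R S : Type*} [CommRing R] [CommRing S] (φ : R →+* S) (c : R) :
    φ (octTheta c 0 * altProd fun k : Fin 6 => octTheta c k.succ).trace =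
      (octTheta (φ c) 0 * altProd fun k : Fin 6 => octTheta (φ c) k.succ).trace := by
  have h := congrArg Matrix.trace (map_mul φ.mapMatrix (octTheta c 0)
    (altProd fun k : Fin 6 => octTheta c k.succ))
  rw [altProd_map, octTheta_map] at h
  simp only [octTheta_map] at h
  rw [← h, Matrix.trace, Matrix.trace, map_sum]
  rfl

-- The component θ_0 does not involve c, since `thetaQ` vanishes where `octIndex` is 0, and the
-- other six are affine in c. So the trace has degree at most six, and agreement at seven integers
-- is an identity in ℤ[X] that specializes to every real c. Finally 86016 = 7 · 12288, the 7 coming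
-- from cyclicity.
open Polynomial in
theorem trace_octTheta (c : ℝ) :
    (altProd (octTheta c)).trace = 86016 * (2 * c ^ 6 + 5 * c ^ 4 + 2 * c ^ 2) := by
  let F : ℤ[X] := (octTheta X 0 * altProd fun k : Fin 6 => octTheta X k.succ).trace
  let G : ℤ[X] := 12288 * (2 * X ^ 6 + 5 * X ^ 4 + 2 * X ^ 2)
  have hQ : ∀ i k, (if octIndex i k = 0 then thetaQ i k else 0) = 0 := by decide +kernel
  have h0 : ∀ i k, ((octTheta (X : ℤ[X]) 0) i k).natDegree ≤ 0 := by
    intro i k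
    have := hQ i k
    simp only [octTheta, Matrix.of_apply]
    split_ifs at this ⊢
    · rw [this]
      simp
    · simp
  have h1 : ∀ (m : Fin 7) (i k : Fin 8), ((octTheta (X : ℤ[X]) m) i k).natDegree ≤ 1 := by
    intro m i k
    simp only [octTheta, Matrix.of_apply]
    split_ifs
    · compute_degree
    · simp
  have hF : F.natDegree ≤ 6 := by
    refine Polynomial.natDegree_sum_le_of_forall_le _ _ fun i _ => ?_
    exact natDegree_mul_apply_le h0 (natDegree_altProd_apply_le _ fun k => h1 k.succ) i i
  have hG : G.natDegree ≤ 6 := by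
    simp only [G]
    compute_degree
  have hFG : F = G := by
    refine Polynomial.eq_of_natDegree_lt_card_of_eval_eq' F G
      ([-3, -2, -1, 0, 1, 2, 3] : List ℤ).toFinset (fun n hn => ?_) ?_
    · have h := trace_octTheta_map (evalRingHom n) (X : ℤ[X])
      rw [coe_evalRingHom, eval_X, trace_octTheta_int (List.mem_toFinset.1 hn)] at h
      rw [h]
      simp [G]
    · have : ([-3, -2, -1, 0, 1, 2, 3] : List ℤ).toFinset.card = 7 := by decide
      rw [this]
      omega
  have h := trace_octTheta_map (eval₂RingHom (Int.castRingHom ℝ) c) (X : ℤ[X])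
  have hF' : (octTheta (X : ℤ[X]) 0 * altProd fun k : Fin 6 => octTheta X k.succ).trace = G := hFG
  rw [hF', coe_eval₂RingHom, eval₂_X] at h
  rw [trace_altProd, ← h]
  simp only [G, eval₂_mul, eval₂_add, eval₂_pow, eval₂_X, eval₂_ofNat]
  ring

end

noncomputable section

/-! ### The density of the Chern-type charge -/

/-- The Maurer-Cartan form at a point as a linear map. -/
def maurerCartanLin (g : S7 → Mat8) (x : S7) : E8 →ₗ[ℝ] Mat8 where
  toFun := maurerCartan g x
  map_add' v w := by
    rw [maurerCartan, maurerCartan, maurerCartan, ← mul_add]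
    congr 1
    ext i j
    simp [differential]
  map_smul' r v := by
    rw [maurerCartan, maurerCartan, RingHom.id_apply, ← Matrix.mul_smul]
    congr 1
    ext i j
    simp [differential]

/-- The trace of the product of seven values of the Maurer-Cartan form. -/
def chernMultilinear (g : S7 → Mat8) (x : S7) : MultilinearMap ℝ (fun _ : Fin 7 => E8) ℂ :=
  (Matrix.traceLinearMap (Fin 8) ℝ ℂ).compMultilinearMap
    ((MultilinearMap.mkPiAlgebraFin ℝ 7 Mat8).compLinearMap fun _ => maurerCartanLin g x)

theorem chernMultilinear_apply (g : S7 → Mat8) (x : S7) (v : Fin 7 → E8) :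
    chernMultilinear g x v = ((List.ofFn fun k => maurerCartan g x (v k)).prod).trace := by
  simp [chernMultilinear, maurerCartanLin]

theorem chernForm_eq (g : S7 → Mat8) (x : S7) (v : Fin 7 → E8) :
    chernForm g x v = wedge7 (chernMultilinear g x) v := by
  rw [chernForm, wedge7, wedge7]
  refine Finset.sum_congr rfl fun σ _ => ?_
  rw [chernMultilinear_apply]
  simp [List.ofFn_succ, mul_assoc]

theorem chernForm_eq_altProd (g : S7 → Mat8) (x : S7) (v : Fin 7 → E8) :
    chernForm g x v = (altProd fun k => maurerCartan g x (v k)).trace := by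
  rw [chernForm_eq, wedge7, altProd, Matrix.trace_sum]
  refine Finset.sum_congr rfl fun σ _ => ?_
  rw [chernMultilinear_apply, Matrix.trace_smul, zsmul_eq_mul]
  rfl

/-- Conjugation by an orthogonal matrix. -/
def conjHom (K : Matrix (Fin 8) (Fin 8) ℝ) (hK : K ∈ Matrix.orthogonalGroup (Fin 8) ℝ) :
    Matrix (Fin 8) (Fin 8) ℝ →+* Matrix (Fin 8) (Fin 8) ℝ where
  toFun A := K * A * Kᵀ
  map_one' := by
    rw [mul_one]
    exact (Matrix.mem_orthogonalGroup_iff (Fin 8) ℝ).1 hK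
  map_mul' A B := by
    have h : Kᵀ * K = 1 := (Matrix.mem_orthogonalGroup_iff' (Fin 8) ℝ).1 hK
    calc K * (A * B) * Kᵀ = K * A * 1 * B * Kᵀ := by simp only [mul_assoc, one_mul]
      _ = _ := by rw [← h]; simp only [mul_assoc]
  map_zero' := by rw [mul_zero, zero_mul]
  map_add' A B := by rw [mul_add, add_mul]

theorem trace_conjHom {K : Matrix (Fin 8) (Fin 8) ℝ} (hK : K ∈ Matrix.orthogonalGroup (Fin 8) ℝ)
    (A : Matrix (Fin 8) (Fin 8) ℝ) : (conjHom K hK A).trace = A.trace := by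
  have h : Kᵀ * K = 1 := (Matrix.mem_orthogonalGroup_iff' (Fin 8) ℝ).1 hK
  change (K * A * Kᵀ).trace = A.trace
  rw [Matrix.trace_mul_comm, ← mul_assoc, h, one_mul]

theorem trace_complexify (A : Matrix (Fin 8) (Fin 8) ℝ) :
    (complexify A).trace = ((A.trace : ℝ) : ℂ) := by
  simp [Matrix.trace]

theorem formDensity_congr (x : S7) {ω ω' : (Fin 7 → E8) → ℂ} (h : ∀ v, ω v = ω' v) :
    formDensity x ω = formDensity x ω' := by
  rw [funext h]

theorem formDensity_chernForm {Γ : Fin 7 → Mat8} (hΓ : IsGammaSystem Γ) (x : S7) :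
    formDensity x (chernForm (g7 Γ) x) =
      ((-(86016 * (2 * x.1 7 ^ 6 + 5 * x.1 7 ^ 4 + 2 * x.1 7 ^ 2)) : ℝ) : ℂ) := by
  obtain ⟨R, hRR, -, hR⟩ := hΓ.exists_model
  obtain ⟨T, hT, hTx, L, hL, hmc⟩ := exists_frame hΓ hRR hR x
  have hL' := (Matrix.mem_specialOrthogonalGroup_iff.1 hL).1
  rw [formDensity_congr x (chernForm_eq (g7 Γ) x), formDensity_wedge7 _ hT hTx, ← chernForm_eq,
    chernForm_eq_altProd]
  simp only [hmc]
  have h : ∀ k, R * (L * octTheta (x.1 7) k * Lᵀ) * Rᵀ =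
      conjHom R hRR (conjHom L hL' (octTheta (x.1 7) k)) := fun k => rfl
  simp only [h]
  rw [← altProd_map, ← altProd_map, ← altProd_map, trace_complexify, trace_conjHom, trace_conjHom,
    trace_octTheta]
  push_cast
  ring

theorem chernDensity_g7 {Γ : Fin 7 → Mat8} (hΓ : IsGammaSystem Γ) (x : S7) :
    chernDensity (g7 Γ) x =
      ((32 / (5 * Real.pi ^ 4) * (2 * x.1 7 ^ 6 + 5 * x.1 7 ^ 4 + 2 * x.1 7 ^ 2) : ℝ) : ℂ) := by
  -- The sign of the normalization cancels the one of the frame evaluation, and 86016/(2⁷ · 3 · 35)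
  -- = 32/5.
  rw [chernDensity, formDensity_chernForm hΓ]
  push_cast
  have hpi : (Real.pi : ℂ) ≠ 0 := Complex.ofReal_ne_zero.2 Real.pi_ne_zero
  field_simp
  ring

theorem volS6_mul_chernDensity {Γ : Fin 7 → Mat8} (hΓ : IsGammaSystem Γ) (x : S7) (α : ℝ)
    (hx : x.1 7 = Real.cos α) : (volS6 : ℂ) * chernDensity (g7 Γ) x =
      ((512 / (75 * Real.pi) *
        (Real.cos α ^ 2 * (2 * Real.cos α ^ 4 + 5 * Real.cos α ^ 2 + 2)) : ℝ) : ℂ) := by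
  rw [chernDensity_g7 hΓ, hx, volS6_eq]
  push_cast
  have hpi : (Real.pi : ℂ) ≠ 0 := Complex.ofReal_ne_zero.2 Real.pi_ne_zero
  field_simp
  ring

theorem chernCharge_g7 {Γ : Fin 7 → Mat8} (hΓ : IsGammaSystem Γ) : chernCharge (g7 Γ) = 1 := by
  rw [chernCharge, integral_density (K := 512 / (75 * Real.pi)) (volS6_mul_chernDensity hΓ)]
  have hpi : (Real.pi : ℂ) ≠ 0 := Complex.ofReal_ne_zero.2 Real.pi_ne_zero
  push_cast
  field_simp

end

noncomputable section

/-! ### Alternating sums -/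

/-- The alternating sum of the values of a function over all orders of its arguments. -/
def altSum {α R : Type*} [CommRing R] {n : ℕ} (f : (Fin n → α) → R) (v : Fin n → α) : R :=
  ∑ σ : Equiv.Perm (Fin n), ((Equiv.Perm.sign σ : ℤ) : R) * f (v ∘ σ)

section

variable {α R : Type*} [CommRing R]

theorem altSum_comp_perm {n : ℕ} (ρ : Equiv.Perm (Fin n)) (f : (Fin n → α) → R) (v : Fin n → α) :
    altSum (fun w => f (w ∘ ρ)) v = ((Equiv.Perm.sign ρ : ℤ) : R) * altSum f v := by
  rw [altSum, altSum, ← Equiv.sum_comp (Equiv.mulRight ρ) fun σ =>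
    ((Equiv.Perm.sign σ : ℤ) : R) * f (v ∘ σ), Finset.mul_sum]
  refine Finset.sum_congr rfl fun σ _ => ?_
  have h : ((Equiv.Perm.sign ρ : ℤ) : R) * ((Equiv.Perm.sign ρ : ℤ) : R) = 1 := by
    rw [← Int.cast_mul, ← Units.val_mul, Int.units_mul_self]
    simp
  rw [Equiv.coe_mulRight, Equiv.Perm.sign_mul, Units.val_mul, Int.cast_mul, Equiv.Perm.coe_mul]
  calc _ = ((Equiv.Perm.sign σ : ℤ) : R) * 1 * f (v ∘ (σ ∘ ρ)) := by rw [mul_one]; rfl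
    _ = _ := by rw [← h]; ring

theorem altSum_congr {n : ℕ} {f g : (Fin n → α) → R} {v : Fin n → α}
    (h : ∀ σ : Equiv.Perm (Fin n), f (v ∘ σ) = g (v ∘ σ)) : altSum f v = altSum g v :=
  Finset.sum_congr rfl fun σ _ => by rw [h]

theorem altSum_add {n : ℕ} (f g : (Fin n → α) → R) (v : Fin n → α) :
    altSum (fun w => f w + g w) v = altSum f v + altSum g v := by
  simp only [altSum, mul_add, Finset.sum_add_distrib]

theorem altSum_sub {n : ℕ} (f g : (Fin n → α) → R) (v : Fin n → α) :
    altSum (fun w => f w - g w) v = altSum f v - altSum g v := by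
  simp only [altSum, mul_sub, Finset.sum_sub_distrib]

theorem altSum_const_mul {n : ℕ} (r : R) (f : (Fin n → α) → R) (v : Fin n → α) :
    altSum (fun w => r * f w) v = r * altSum f v := by
  simp only [altSum, Finset.mul_sum]
  exact Finset.sum_congr rfl fun σ _ => by ring

theorem altSum_zero (f : (Fin 0 → α) → R) (v : Fin 0 → α) : altSum f v = f v := by
  rw [altSum, Fintype.sum_unique, Subsingleton.elim (v ∘ _) v]
  simp

/-- An alternating sum with a fixed first argument. -/
def altTail {n : ℕ} (f : (Fin (n + 1) → α) → R) (a : α) (v : Fin n → α) : R :=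
  altSum (fun w => f (Fin.cons a w)) v

theorem sum_perm_fix_zero {n : ℕ} (f : (Fin (n + 1) → α) → R) (v : Fin (n + 1) → α) :
    ∑ e : Equiv.Perm (Fin n), ((Equiv.Perm.sign (Equiv.Perm.decomposeFin.symm (0, e)) : ℤ) : R) *
      f (v ∘ Equiv.Perm.decomposeFin.symm (0, e)) = altTail f (v 0) (fun k => v k.succ) := by
  rw [altTail, altSum]
  refine Finset.sum_congr rfl fun e _ => ?_
  rw [Equiv.Perm.decomposeFin.symm_sign, if_pos rfl, one_mul]
  congr 2
  ext k
  refine Fin.cases ?_ (fun k => ?_) k <;> simp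

theorem altSum_succ {n : ℕ} (f : (Fin (n + 1) → α) → R) (v : Fin (n + 1) → α) :
    altSum f v = altTail f (v 0) (fun k => v k.succ) -
      ∑ p : Fin n, altTail f (v p.succ) (Function.update (fun k => v k.succ) p (v 0)) := by
  rw [altSum, sum_perm_fin_succ, Fin.sum_univ_succ, sub_eq_add_neg, ← Finset.sum_neg_distrib,
    sum_perm_fix_zero]
  congr 1
  refine Finset.sum_congr rfl fun p _ => ?_
  rw [altTail, altSum, ← Finset.sum_neg_distrib]
  refine Finset.sum_congr rfl fun e _ => ?_
  rw [Equiv.Perm.decomposeFin.symm_sign, if_neg (Fin.succ_ne_zero p)]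
  have h : v ∘ Equiv.Perm.decomposeFin.symm (p.succ, e) =
      Fin.cons (v p.succ) (Function.update (fun k => v k.succ) p (v 0) ∘ e) := by
    ext k
    refine Fin.cases ?_ (fun k => ?_) k
    · simp
    · rw [Function.comp_apply, Equiv.Perm.decomposeFin_symm_apply_succ, Fin.cons_succ,
        Function.comp_apply]
      by_cases hk : e k = p
      · rw [hk, Equiv.swap_apply_right, Function.update_self]
      · rw [Equiv.swap_apply_of_ne_of_ne (Fin.succ_ne_zero _) (fun h => hk (Fin.succ_injective _ h)),
          Function.update_of_ne hk]
  rw [h]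
  simp

/-- If a transitive cyclic permutation of the positions changes a function by the sign of the
permutation, then its alternating sum is a multiple of the one with a fixed first argument. -/
theorem altSum_eq_mul_altTail {n : ℕ} {f : (Fin (n + 1) → α) → R} (ρ : Equiv.Perm (Fin (n + 1)))
    (hρ : ∀ m, ∃ k ∈ Finset.range (n + 1), (ρ ^ k) 0 = m)
    (hf : ∀ w, f (w ∘ ρ) = ((Equiv.Perm.sign ρ : ℤ) : R) * f w) (v : Fin (n + 1) → α) :
    altSum f v = (n + 1) * altTail f (v 0) (fun k => v k.succ) := by
  let g : Equiv.Perm (Fin (n + 1)) → R := fun σ => ((Equiv.Perm.sign σ : ℤ) : R) * f (v ∘ σ)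
  have hg : ∀ σ, g (σ * ρ) = g σ := by
    intro σ
    have h : ((Equiv.Perm.sign ρ : ℤ) : R) * ((Equiv.Perm.sign ρ : ℤ) : R) = 1 := by
      rw [← Int.cast_mul, ← Units.val_mul, Int.units_mul_self]
      simp
    simp only [g]
    rw [Equiv.Perm.sign_mul, Units.val_mul, Int.cast_mul, Equiv.Perm.coe_mul, ← Function.comp_assoc,
      hf]
    linear_combination (((Equiv.Perm.sign σ : ℤ) : R) * f (v ∘ σ)) * h
  let h : Fin (n + 1) → R := fun m => ∑ σ : Equiv.Perm (Fin (n + 1)), if σ m = 0 then g σ else 0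
  have hh : ∀ m, h (ρ m) = h m := by
    intro m
    simp only [h]
    rw [← Equiv.sum_comp (Equiv.mulRight ρ) fun σ => if σ m = 0 then g σ else 0]
    simp only [Equiv.coe_mulRight, hg, Equiv.Perm.coe_mul, Function.comp_apply]
  have hk : ∀ k : ℕ, h ((ρ ^ k) 0) = h 0 := by
    intro k
    induction k with
    | zero => rfl
    | succ k ih => rw [pow_succ', Equiv.Perm.coe_mul, Function.comp_apply, hh, ih]
  have h0 : ∀ m, h m = h 0 := by
    intro m
    obtain ⟨k, -, rfl⟩ := hρ m
    exact hk k
  have h1 : altSum f v = ∑ m, h m := by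
    simp only [h]
    rw [Finset.sum_comm, altSum]
    refine Finset.sum_congr rfl fun σ _ => ?_
    rw [Finset.sum_eq_single (σ⁻¹ 0)]
    · simp [g]
    · intro m _ hm
      rw [if_neg]
      intro e
      exact hm (by rw [← e]; simp)
    · simp
  have h2 : h 0 = altTail f (v 0) (fun k => v k.succ) := by
    simp only [h]
    rw [sum_perm_fin_succ, Finset.sum_eq_single 0, ← sum_perm_fix_zero]
    · refine Finset.sum_congr rfl fun e _ => ?_
      rw [Equiv.Perm.decomposeFin_symm_apply_zero, if_pos rfl]
    · intro p _ hp
      refine Finset.sum_eq_zero fun e _ => ?_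
      rw [Equiv.Perm.decomposeFin_symm_apply_zero, if_neg hp]
    · simp
  rw [h1, Finset.sum_congr rfl fun m _ => h0 m, h2]
  simp

end

end

noncomputable section

/-! ### The polarized Pfaffian -/

section

variable {R : Type*} [CommRing R]

/-- A product of entries of four matrices. -/
def pairProd (A B C D : Matrix (Fin 8) (Fin 8) R) (w : Fin 8 → Fin 8) : R :=
  A (w 0) (w 1) * B (w 2) (w 3) * C (w 4) (w 5) * D (w 6) (w 7)

/-- The contraction of four matrices with the Levi-Civita symbol. -/
def pfaffSum (A B C D : Matrix (Fin 8) (Fin 8) R) : R := altSum (pairProd A B C D) id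

theorem pfaffSum_map {S : Type*} [CommRing S] (φ : R →+* S) (A B C D : Matrix (Fin 8) (Fin 8) R) :
    φ (pfaffSum A B C D) = pfaffSum (A.map φ) (B.map φ) (C.map φ) (D.map φ) := by
  simp [pfaffSum, altSum, pairProd]

/-- Exchanging two pairs of indices is an even permutation. With the next two lemmas, the
contraction is symmetric in its four matrices, and linearity has to be checked only in the first. -/
theorem pfaffSum_swap₁₂ (A B C D : Matrix (Fin 8) (Fin 8) R) :
    pfaffSum A B C D = pfaffSum B A C D := by
  have h := altSum_comp_perm (Equiv.swap 0 2 * Equiv.swap 1 3) (pairProd A B C D) id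
  have hs : Equiv.Perm.sign (Equiv.swap 0 2 * Equiv.swap 1 3 : Equiv.Perm (Fin 8)) = 1 := by
    decide +kernel
  rw [hs, Units.val_one, Int.cast_one, one_mul] at h
  rw [pfaffSum, ← h, pfaffSum]
  refine altSum_congr fun σ => ?_
  change A (σ 2) (σ 3) * B (σ 0) (σ 1) * C (σ 4) (σ 5) * D (σ 6) (σ 7) =
    B (σ 0) (σ 1) * A (σ 2) (σ 3) * C (σ 4) (σ 5) * D (σ 6) (σ 7)
  ring

theorem pfaffSum_swap₂₃ (A B C D : Matrix (Fin 8) (Fin 8) R) :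
    pfaffSum A B C D = pfaffSum A C B D := by
  have h := altSum_comp_perm (Equiv.swap 2 4 * Equiv.swap 3 5) (pairProd A B C D) id
  have hs : Equiv.Perm.sign (Equiv.swap 2 4 * Equiv.swap 3 5 : Equiv.Perm (Fin 8)) = 1 := by
    decide +kernel
  rw [hs, Units.val_one, Int.cast_one, one_mul] at h
  rw [pfaffSum, ← h, pfaffSum]
  refine altSum_congr fun σ => ?_
  change A (σ 0) (σ 1) * B (σ 4) (σ 5) * C (σ 2) (σ 3) * D (σ 6) (σ 7) =
    A (σ 0) (σ 1) * C (σ 2) (σ 3) * B (σ 4) (σ 5) * D (σ 6) (σ 7)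
  ring

theorem pfaffSum_swap₃₄ (A B C D : Matrix (Fin 8) (Fin 8) R) :
    pfaffSum A B C D = pfaffSum A B D C := by
  have h := altSum_comp_perm (Equiv.swap 4 6 * Equiv.swap 5 7) (pairProd A B C D) id
  have hs : Equiv.Perm.sign (Equiv.swap 4 6 * Equiv.swap 5 7 : Equiv.Perm (Fin 8)) = 1 := by
    decide +kernel
  rw [hs, Units.val_one, Int.cast_one, one_mul] at h
  rw [pfaffSum, ← h, pfaffSum]
  refine altSum_congr fun σ => ?_
  change A (σ 0) (σ 1) * B (σ 2) (σ 3) * C (σ 6) (σ 7) * D (σ 4) (σ 5) =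
    A (σ 0) (σ 1) * B (σ 2) (σ 3) * D (σ 4) (σ 5) * C (σ 6) (σ 7)
  ring

theorem pfaffSum_add₁ (A A' B C D : Matrix (Fin 8) (Fin 8) R) :
    pfaffSum (A + A') B C D = pfaffSum A B C D + pfaffSum A' B C D := by
  rw [pfaffSum, pfaffSum, pfaffSum, ← altSum_add]
  exact altSum_congr fun σ => by simp only [pairProd, Matrix.add_apply]; ring

theorem pfaffSum_smul₁ (r : R) (A B C D : Matrix (Fin 8) (Fin 8) R) :
    pfaffSum (r • A) B C D = r * pfaffSum A B C D := by
  rw [pfaffSum, pfaffSum, ← altSum_const_mul]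
  exact altSum_congr fun σ => by simp only [pairProd, Matrix.smul_apply, smul_eq_mul]; ring

theorem pfaffSum_add₂ (A B B' C D : Matrix (Fin 8) (Fin 8) R) :
    pfaffSum A (B + B') C D = pfaffSum A B C D + pfaffSum A B' C D := by
  simp only [pfaffSum_swap₁₂ A, pfaffSum_add₁]

theorem pfaffSum_smul₂ (r : R) (A B C D : Matrix (Fin 8) (Fin 8) R) :
    pfaffSum A (r • B) C D = r * pfaffSum A B C D := by
  simp only [pfaffSum_swap₁₂ A, pfaffSum_smul₁]

theorem pfaffSum_add₃ (A B C C' D : Matrix (Fin 8) (Fin 8) R) :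
    pfaffSum A B (C + C') D = pfaffSum A B C D + pfaffSum A B C' D := by
  simp only [pfaffSum_swap₂₃ A B, pfaffSum_add₂]

theorem pfaffSum_smul₃ (r : R) (A B C D : Matrix (Fin 8) (Fin 8) R) :
    pfaffSum A B (r • C) D = r * pfaffSum A B C D := by
  simp only [pfaffSum_swap₂₃ A B, pfaffSum_smul₂]

theorem pfaffSum_add₄ (A B C D D' : Matrix (Fin 8) (Fin 8) R) :
    pfaffSum A B C (D + D') = pfaffSum A B C D + pfaffSum A B C D' := by
  simp only [pfaffSum_swap₃₄ A B C, pfaffSum_add₃]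

theorem pfaffSum_smul₄ (r : R) (A B C D : Matrix (Fin 8) (Fin 8) R) :
    pfaffSum A B C (r • D) = r * pfaffSum A B C D := by
  simp only [pfaffSum_swap₃₄ A B C, pfaffSum_smul₃]

/-- The list of indices that belongs to four pairs of indices. -/
def pairIndex (p : Fin 4 → Fin 8 × Fin 8) : Fin 8 → Fin 8 :=
  ![(p 0).1, (p 0).2, (p 1).1, (p 1).2, (p 2).1, (p 2).2, (p 3).1, (p 3).2]

theorem pairProd_conj (K A B C D : Matrix (Fin 8) (Fin 8) R) (w : Fin 8 → Fin 8) :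
    pairProd (K * A * Kᵀ) (K * B * Kᵀ) (K * C * Kᵀ) (K * D * Kᵀ) w =
      ∑ p : Fin 4 → Fin 8 × Fin 8, (∏ k, K (w k) (pairIndex p k)) * pairProd A B C D (pairIndex p) := by
  have h : ∀ (M : Matrix (Fin 8) (Fin 8) R) (i j : Fin 8),
      (K * M * Kᵀ) i j = ∑ q : Fin 8 × Fin 8, K i q.1 * M q.1 q.2 * K j q.2 := by
    intro M i j
    rw [Fintype.sum_prod_type_right, Matrix.mul_apply]
    simp only [Matrix.mul_apply, Matrix.transpose_apply, Finset.sum_mul]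
  let F : Fin 4 → Fin 8 × Fin 8 → R := ![fun q => K (w 0) q.1 * A q.1 q.2 * K (w 1) q.2,
    fun q => K (w 2) q.1 * B q.1 q.2 * K (w 3) q.2, fun q => K (w 4) q.1 * C q.1 q.2 * K (w 5) q.2,
    fun q => K (w 6) q.1 * D q.1 q.2 * K (w 7) q.2]
  have hF := Finset.prod_univ_sum (fun _ : Fin 4 => (Finset.univ : Finset (Fin 8 × Fin 8))) F
  rw [Fintype.piFinset_univ, Fin.prod_univ_four] at hF
  rw [pairProd, h, h, h, h]
  refine hF.trans (Finset.sum_congr rfl fun p _ => ?_)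
  rw [Fin.prod_univ_four, Fin.prod_univ_eight]
  simp [F, pairIndex, pairProd]
  ring

/-- After expanding the four conjugations, the Levi-Civita symbol turns the eight factors of K into
the determinant of K with its columns selected by p. That matrix is K times the same selection from
the identity, so det K factors out. -/
theorem pfaffSum_conj (K A B C D : Matrix (Fin 8) (Fin 8) R) :
    pfaffSum (K * A * Kᵀ) (K * B * Kᵀ) (K * C * Kᵀ) (K * D * Kᵀ) = K.det * pfaffSum A B C D := by
  have h : ∀ M : Matrix (Fin 8) (Fin 8) R,
      pfaffSum (M * A * Mᵀ) (M * B * Mᵀ) (M * C * Mᵀ) (M * D * Mᵀ) =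
        ∑ p : Fin 4 → Fin 8 × Fin 8,
          (M.submatrix id (pairIndex p)).det * pairProd A B C D (pairIndex p) := by
    intro M
    rw [pfaffSum, altSum]
    refine (Finset.sum_congr rfl fun σ _ => (congrArg _ (pairProd_conj M A B C D _)).trans
      (Finset.mul_sum _ _ _)).trans (Finset.sum_comm.trans (Finset.sum_congr rfl fun p _ => ?_))
    rw [Matrix.det_apply, Finset.sum_mul]
    refine Finset.sum_congr rfl fun σ _ => ?_
    rw [Units.smul_def, zsmul_eq_mul, mul_assoc]
    rfl
  have h1 := h 1
  simp only [one_mul, Matrix.transpose_one, mul_one] at h1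
  rw [h K, h1, Finset.mul_sum]
  refine Finset.sum_congr rfl fun p _ => ?_
  have hK : K.submatrix id (pairIndex p) =
      K * (1 : Matrix (Fin 8) (Fin 8) R).submatrix id (pairIndex p) := by
    ext i j
    simp [Matrix.mul_apply, Matrix.one_apply]
  rw [← mul_assoc, ← Matrix.det_mul, ← hK]

/-! ### Expansion of the Pfaffian of an antisymmetric matrix -/

/-- The recursion behind the row expansion of a Pfaffian. The permutation ρ moves every position to
the first one at the cost of its sign, so v_0 may be fixed there at the price of a factor n + 2.
Expanding over the second argument then leaves v_1 in the vacated place. -/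
theorem altSum_pair {α : Type*} {n : ℕ} {f : (Fin (n + 2) → α) → R} {g : (Fin n → α) → R}
    {X : α → α → R} (hfg : ∀ a b w, f (Fin.cons a (Fin.cons b w)) = X a b * g w)
    (ρ : Equiv.Perm (Fin (n + 2))) (hρ : ∀ m, ∃ k ∈ Finset.range (n + 2), (ρ ^ k) 0 = m)
    (hf : ∀ w, f (w ∘ ρ) = ((Equiv.Perm.sign ρ : ℤ) : R) * f w) (v : Fin (n + 2) → α) :
    altSum f v = (n + 2) * (X (v 0) (v 1) * altSum g (fun k => v k.succ.succ) -
      ∑ p : Fin n, X (v 0) (v p.succ.succ) *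
        altSum g (Function.update (fun k => v k.succ.succ) p (v 1))) := by
  rw [altSum_eq_mul_altTail ρ hρ hf, altTail, altSum_succ]
  simp only [altTail, hfg, altSum_const_mul]
  push_cast
  rw [add_assoc, one_add_one_eq_two]
  rfl

/-- The cyclic permutation that exchanges two positions. -/
def pairCycle2 : Equiv.Perm (Fin 2) := ⟨![1, 0], ![1, 0], by decide, by decide⟩

/-- The cyclic permutation of two pairs of positions that reverses one of the pairs. -/
def pairCycle4 : Equiv.Perm (Fin 4) := ⟨![2, 3, 1, 0], ![3, 2, 0, 1], by decide, by decide⟩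

/-- The cyclic permutation of three pairs of positions that reverses one of the pairs. -/
def pairCycle6 : Equiv.Perm (Fin 6) :=
  ⟨![2, 3, 4, 5, 1, 0], ![5, 4, 0, 1, 2, 3], by decide, by decide⟩

/-- The cyclic permutation of four pairs of positions that reverses one of the pairs. -/
def pairCycle8 : Equiv.Perm (Fin 8) :=
  ⟨![2, 3, 4, 5, 6, 7, 1, 0], ![7, 6, 0, 1, 2, 3, 4, 5], by decide, by decide⟩

variable {X : Matrix (Fin 8) (Fin 8) R}

theorem altSum_two (hX : ∀ i j, X j i = -X i j) (v : Fin 2 → Fin 8) :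
    altSum (fun w : Fin 2 → Fin 8 => X (w 0) (w 1)) v = 2 * X (v 0) (v 1) := by
  rw [altSum_pair (g := fun _ => 1) (X := X) (fun a b w => (mul_one _).symm) pairCycle2
    (by decide +kernel) (fun w => by
      have hs : Equiv.Perm.sign pairCycle2 = -1 := by decide +kernel
      rw [hs]
      change X (w 1) (w 0) = _
      rw [hX]
      simp)]
  simp [altSum_zero]

theorem altSum_four (hX : ∀ i j, X j i = -X i j) (v : Fin 4 → Fin 8) :
    altSum (fun w : Fin 4 → Fin 8 => X (w 0) (w 1) * X (w 2) (w 3)) v =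
      8 * (X (v 0) (v 1) * X (v 2) (v 3) - X (v 0) (v 2) * X (v 1) (v 3) +
        X (v 0) (v 3) * X (v 1) (v 2)) := by
  rw [altSum_pair (g := fun w : Fin 2 → Fin 8 => X (w 0) (w 1)) (X := X) (fun a b w => rfl)
    pairCycle4 (by decide +kernel) (fun w => by
      have hs : Equiv.Perm.sign pairCycle4 = -1 := by decide +kernel
      rw [hs]
      change X (w 2) (w 3) * X (w 1) (w 0) = _
      rw [hX (w 0)]
      push_cast
      ring)]
  simp only [altSum_two hX, Fin.sum_univ_succ, Fin.sum_univ_zero]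
  change ((2 : ℕ) + 2 : R) * (X (v 0) (v 1) * (2 * X (v 2) (v 3)) -
    (X (v 0) (v 2) * (2 * X (v 1) (v 3)) + (X (v 0) (v 3) * (2 * X (v 2) (v 1)) + 0))) = _
  rw [hX (v 1) (v 2)]
  push_cast
  ring

theorem altSum_six (hX : ∀ i j, X j i = -X i j) (v : Fin 6 → Fin 8) :
    altSum (fun w : Fin 6 → Fin 8 => X (w 0) (w 1) * (X (w 2) (w 3) * X (w 4) (w 5))) v =
      48 * (X (v 0) (v 1) * (X (v 2) (v 3) * X (v 4) (v 5) - X (v 2) (v 4) * X (v 3) (v 5) +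
          X (v 2) (v 5) * X (v 3) (v 4)) -
        X (v 0) (v 2) * (X (v 1) (v 3) * X (v 4) (v 5) - X (v 1) (v 4) * X (v 3) (v 5) +
          X (v 1) (v 5) * X (v 3) (v 4)) +
        X (v 0) (v 3) * (X (v 1) (v 2) * X (v 4) (v 5) - X (v 1) (v 4) * X (v 2) (v 5) +
          X (v 1) (v 5) * X (v 2) (v 4)) -
        X (v 0) (v 4) * (X (v 1) (v 2) * X (v 3) (v 5) - X (v 1) (v 3) * X (v 2) (v 5) +
          X (v 1) (v 5) * X (v 2) (v 3)) +
        X (v 0) (v 5) * (X (v 1) (v 2) * X (v 3) (v 4) - X (v 1) (v 3) * X (v 2) (v 4) +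
          X (v 1) (v 4) * X (v 2) (v 3))) := by
  rw [altSum_pair (g := fun w : Fin 4 → Fin 8 => X (w 0) (w 1) * X (w 2) (w 3)) (X := X)
    (fun a b w => rfl) pairCycle6 (by decide +kernel) (fun w => by
      have hs : Equiv.Perm.sign pairCycle6 = -1 := by decide +kernel
      rw [hs]
      change X (w 2) (w 3) * (X (w 4) (w 5) * X (w 1) (w 0)) = _
      rw [hX (w 0)]
      push_cast
      ring)]
  simp only [altSum_four hX, Fin.sum_univ_succ, Fin.sum_univ_zero]
  change ((4 : ℕ) + 2 : R) * (X (v 0) (v 1) * (8 * (X (v 2) (v 3) * X (v 4) (v 5) -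
      X (v 2) (v 4) * X (v 3) (v 5) + X (v 2) (v 5) * X (v 3) (v 4))) -
    (X (v 0) (v 2) * (8 * (X (v 1) (v 3) * X (v 4) (v 5) -
      X (v 1) (v 4) * X (v 3) (v 5) + X (v 1) (v 5) * X (v 3) (v 4))) +
    (X (v 0) (v 3) * (8 * (X (v 2) (v 1) * X (v 4) (v 5) -
      X (v 2) (v 4) * X (v 1) (v 5) + X (v 2) (v 5) * X (v 1) (v 4))) +
    (X (v 0) (v 4) * (8 * (X (v 2) (v 3) * X (v 1) (v 5) -
      X (v 2) (v 1) * X (v 3) (v 5) + X (v 2) (v 5) * X (v 3) (v 1))) +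
    (X (v 0) (v 5) * (8 * (X (v 2) (v 3) * X (v 4) (v 1) -
      X (v 2) (v 4) * X (v 3) (v 1) + X (v 2) (v 1) * X (v 3) (v 4))) + 0))))) = _
  rw [hX (v 1) (v 2), hX (v 1) (v 3), hX (v 1) (v 4)]
  push_cast
  ring

end

end

noncomputable section

/-! ### The Pfaffian and traces on the spin representation -/

/-- Here 384 = 2⁴ · 4! counts the orders of the pairs and within the pairs, and the bracket is the
Pfaffian expanded along its first row. -/
theorem pfaffSum_self {X : Matrix (Fin 8) (Fin 8) ℝ} (hX : ∀ i j, X j i = -X i j) :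
    pfaffSum X X X X =
      384 * (X 0 1 * (X 2 3 * (X 4 5 * X 6 7 - X 4 6 * X 5 7 + X 4 7 * X 5 6) - X 2 4 * (X 3 5 * X
      6 7 - X 3 6 * X 5 7 + X 3 7 * X 5 6) + X 2 5 * (X 3 4 * X 6 7 - X 3 6 * X 4 7 + X 3 7 * X 4
      6) - X 2 6 * (X 3 4 * X 5 7 - X 3 5 * X 4 7 + X 3 7 * X 4 5) + X 2 7 * (X 3 4 * X 5 6 - X 3
      5 * X 4 6 + X 3 6 * X 4 5)) - X 0 2 * (X 1 3 * (X 4 5 * X 6 7 - X 4 6 * X 5 7 + X 4 7 * X 5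
      6) - X 1 4 * (X 3 5 * X 6 7 - X 3 6 * X 5 7 + X 3 7 * X 5 6) + X 1 5 * (X 3 4 * X 6 7 - X 3
      6 * X 4 7 + X 3 7 * X 4 6) - X 1 6 * (X 3 4 * X 5 7 - X 3 5 * X 4 7 + X 3 7 * X 4 5) + X 1 7
      * (X 3 4 * X 5 6 - X 3 5 * X 4 6 + X 3 6 * X 4 5)) + X 0 3 * (X 1 2 * (X 4 5 * X 6 7 - X 4 6
      * X 5 7 + X 4 7 * X 5 6) - X 1 4 * (X 2 5 * X 6 7 - X 2 6 * X 5 7 + X 2 7 * X 5 6) + X 1 5 *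
      (X 2 4 * X 6 7 - X 2 6 * X 4 7 + X 2 7 * X 4 6) - X 1 6 * (X 2 4 * X 5 7 - X 2 5 * X 4 7 + X
      2 7 * X 4 5) + X 1 7 * (X 2 4 * X 5 6 - X 2 5 * X 4 6 + X 2 6 * X 4 5)) - X 0 4 * (X 1 2 *
      (X 3 5 * X 6 7 - X 3 6 * X 5 7 + X 3 7 * X 5 6) - X 1 3 * (X 2 5 * X 6 7 - X 2 6 * X 5 7 + X
      2 7 * X 5 6) + X 1 5 * (X 2 3 * X 6 7 - X 2 6 * X 3 7 + X 2 7 * X 3 6) - X 1 6 * (X 2 3 * X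
      5 7 - X 2 5 * X 3 7 + X 2 7 * X 3 5) + X 1 7 * (X 2 3 * X 5 6 - X 2 5 * X 3 6 + X 2 6 * X 3
      5)) + X 0 5 * (X 1 2 * (X 3 4 * X 6 7 - X 3 6 * X 4 7 + X 3 7 * X 4 6) - X 1 3 * (X 2 4 * X
      6 7 - X 2 6 * X 4 7 + X 2 7 * X 4 6) + X 1 4 * (X 2 3 * X 6 7 - X 2 6 * X 3 7 + X 2 7 * X 3
      6) - X 1 6 * (X 2 3 * X 4 7 - X 2 4 * X 3 7 + X 2 7 * X 3 4) + X 1 7 * (X 2 3 * X 4 6 - X 2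
      4 * X 3 6 + X 2 6 * X 3 4)) - X 0 6 * (X 1 2 * (X 3 4 * X 5 7 - X 3 5 * X 4 7 + X 3 7 * X 4
      5) - X 1 3 * (X 2 4 * X 5 7 - X 2 5 * X 4 7 + X 2 7 * X 4 5) + X 1 4 * (X 2 3 * X 5 7 - X 2
      5 * X 3 7 + X 2 7 * X 3 5) - X 1 5 * (X 2 3 * X 4 7 - X 2 4 * X 3 7 + X 2 7 * X 3 4) + X 1 7
      * (X 2 3 * X 4 5 - X 2 4 * X 3 5 + X 2 5 * X 3 4)) + X 0 7 * (X 1 2 * (X 3 4 * X 5 6 - X 3 5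
      * X 4 6 + X 3 6 * X 4 5) - X 1 3 * (X 2 4 * X 5 6 - X 2 5 * X 4 6 + X 2 6 * X 4 5) + X 1 4 *
      (X 2 3 * X 5 6 - X 2 5 * X 3 6 + X 2 6 * X 3 5) - X 1 5 * (X 2 3 * X 4 6 - X 2 4 * X 3 6 + X
      2 6 * X 3 4) + X 1 6 * (X 2 3 * X 4 5 - X 2 4 * X 3 5 + X 2 5 * X 3 4))) := by
  rw [pfaffSum, altSum_pair (g := fun w : Fin 6 → Fin 8 =>
      X (w 0) (w 1) * (X (w 2) (w 3) * X (w 4) (w 5)))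
    (X := X) (fun a b w => by
      change X a b * X (w 0) (w 1) * X (w 2) (w 3) * X (w 4) (w 5) = _
      ring) pairCycle8 (by decide +kernel) (fun w => by
      have hs : Equiv.Perm.sign pairCycle8 = -1 := by decide +kernel
      rw [hs]
      change X (w 2) (w 3) * X (w 4) (w 5) * X (w 6) (w 7) * X (w 1) (w 0) =
        _ * (X (w 0) (w 1) * X (w 2) (w 3) * X (w 4) (w 5) * X (w 6) (w 7))
      rw [hX (w 0)]
      push_cast
      ring)]
  simp only [altSum_six hX, Fin.sum_univ_succ, Fin.sum_univ_zero]
  change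
    ((6 : ℕ) + 2 : ℝ) * (X 0 1 * (48 * (X 2 3 * (X 4 5 * X 6 7 - X 4 6 * X 5 7 + X 4 7 * X 5 6) -
    X 2 4 * (X 3 5 * X 6 7 - X 3 6 * X 5 7 + X 3 7 * X 5 6) + X 2 5 * (X 3 4 * X 6 7 - X 3 6 * X 4
    7 + X 3 7 * X 4 6) - X 2 6 * (X 3 4 * X 5 7 - X 3 5 * X 4 7 + X 3 7 * X 4 5) + X 2 7 * (X 3 4
    * X 5 6 - X 3 5 * X 4 6 + X 3 6 * X 4 5))) - (X 0 2 * (48 * (X 1 3 * (X 4 5 * X 6 7 - X 4 6 *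
    X 5 7 + X 4 7 * X 5 6) - X 1 4 * (X 3 5 * X 6 7 - X 3 6 * X 5 7 + X 3 7 * X 5 6) + X 1 5 * (X
    3 4 * X 6 7 - X 3 6 * X 4 7 + X 3 7 * X 4 6) - X 1 6 * (X 3 4 * X 5 7 - X 3 5 * X 4 7 + X 3 7
    * X 4 5) + X 1 7 * (X 3 4 * X 5 6 - X 3 5 * X 4 6 + X 3 6 * X 4 5))) + (X 0 3 * (48 * (X 2 1 *
    (X 4 5 * X 6 7 - X 4 6 * X 5 7 + X 4 7 * X 5 6) - X 2 4 * (X 1 5 * X 6 7 - X 1 6 * X 5 7 + X 1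
    7 * X 5 6) + X 2 5 * (X 1 4 * X 6 7 - X 1 6 * X 4 7 + X 1 7 * X 4 6) - X 2 6 * (X 1 4 * X 5 7
    - X 1 5 * X 4 7 + X 1 7 * X 4 5) + X 2 7 * (X 1 4 * X 5 6 - X 1 5 * X 4 6 + X 1 6 * X 4 5))) +
    (X 0 4 * (48 * (X 2 3 * (X 1 5 * X 6 7 - X 1 6 * X 5 7 + X 1 7 * X 5 6) - X 2 1 * (X 3 5 * X 6
    7 - X 3 6 * X 5 7 + X 3 7 * X 5 6) + X 2 5 * (X 3 1 * X 6 7 - X 3 6 * X 1 7 + X 3 7 * X 1 6) -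
    X 2 6 * (X 3 1 * X 5 7 - X 3 5 * X 1 7 + X 3 7 * X 1 5) + X 2 7 * (X 3 1 * X 5 6 - X 3 5 * X 1
    6 + X 3 6 * X 1 5))) + (X 0 5 * (48 * (X 2 3 * (X 4 1 * X 6 7 - X 4 6 * X 1 7 + X 4 7 * X 1 6)
    - X 2 4 * (X 3 1 * X 6 7 - X 3 6 * X 1 7 + X 3 7 * X 1 6) + X 2 1 * (X 3 4 * X 6 7 - X 3 6 * X
    4 7 + X 3 7 * X 4 6) - X 2 6 * (X 3 4 * X 1 7 - X 3 1 * X 4 7 + X 3 7 * X 4 1) + X 2 7 * (X 3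
    4 * X 1 6 - X 3 1 * X 4 6 + X 3 6 * X 4 1))) + (X 0 6 * (48 * (X 2 3 * (X 4 5 * X 1 7 - X 4 1
    * X 5 7 + X 4 7 * X 5 1) - X 2 4 * (X 3 5 * X 1 7 - X 3 1 * X 5 7 + X 3 7 * X 5 1) + X 2 5 *
    (X 3 4 * X 1 7 - X 3 1 * X 4 7 + X 3 7 * X 4 1) - X 2 1 * (X 3 4 * X 5 7 - X 3 5 * X 4 7 + X 3
    7 * X 4 5) + X 2 7 * (X 3 4 * X 5 1 - X 3 5 * X 4 1 + X 3 1 * X 4 5))) + (X 0 7 * (48 * (X 2 3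
    * (X 4 5 * X 6 1 - X 4 6 * X 5 1 + X 4 1 * X 5 6) - X 2 4 * (X 3 5 * X 6 1 - X 3 6 * X 5 1 + X
    3 1 * X 5 6) + X 2 5 * (X 3 4 * X 6 1 - X 3 6 * X 4 1 + X 3 1 * X 4 6) - X 2 6 * (X 3 4 * X 5
    1 - X 3 5 * X 4 1 + X 3 1 * X 4 5) + X 2 1 * (X 3 4 * X 5 6 - X 3 5 * X 4 6 + X 3 6 * X 4 5)))
    + (0)))))))) = _
  rw [hX 1 2, hX 1 3, hX 1 4, hX 1 5, hX 1 6]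
  push_cast
  ring

-- The left side is eight times the Pfaffian of X, and the y_ij are the entries of −X². The
-- relations `h0`–`h6` express orthogonality to the standard gamma matrices, that is, membership in
-- spin(7). Eliminating the entries x_i7 with them leaves a polynomial identity in the 21 free
-- entries. Only the left side changes sign with the orientation.
set_option maxHeartbeats 4000000 in
set_option maxRecDepth 100000 in
theorem pfaffian_quartic_identity
    {x01 x02 x03 x04 x05 x06 x07 x12 x13 x14 x15 x16 x17 x23 x24 x25 x26 x27 x34 x35 x36 x37 x45
    x46 x47 x56 x57 x67 y00 y01 y02 y03 y04 y05 y06 y07 y11 y12 y13 y14 y15 y16 y17 y22 y23 y24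
    y25 y26 y27 y33 y34 y35 y36 y37 y44 y45 y46 y47 y55 y56 y57 y66 y67 y77 : ℝ}
    (h0 : x07 = x16 + x25 - x34) (h1 : x47 = -x03 + x12 + x56) (h2 : x67 = x01 - x23 + x45)
    (h3 : x17 = -x06 + x24 + x35) (h4 : x57 = x02 + x13 - x46) (h5 : x27 = -x05 - x14 - x36)
    (h6 : x37 = x04 - x15 + x26)
    (hy00 : y00 = x01 * x01 + x02 * x02 + x03 * x03 + x04 * x04 + x05 * x05 + x06 * x06 + x07 *
    x07) (hy01 : y01 = x02 * x12 + x03 * x13 + x04 * x14 + x05 * x15 + x06 * x16 + x07 * x17)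
    (hy02 : y02 = - x01 * x12 + x03 * x23 + x04 * x24 + x05 * x25 + x06 * x26 + x07 * x27) (hy03 :
    y03 = - x01 * x13 - x02 * x23 + x04 * x34 + x05 * x35 + x06 * x36 + x07 * x37) (hy04 : y04 = -
    x01 * x14 - x02 * x24 - x03 * x34 + x05 * x45 + x06 * x46 + x07 * x47) (hy05 : y05 = - x01 *
    x15 - x02 * x25 - x03 * x35 - x04 * x45 + x06 * x56 + x07 * x57) (hy06 : y06 = - x01 * x16 -
    x02 * x26 - x03 * x36 - x04 * x46 - x05 * x56 + x07 * x67) (hy07 : y07 = - x01 * x17 - x02 *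
    x27 - x03 * x37 - x04 * x47 - x05 * x57 - x06 * x67) (hy11 : y11 = x01 * x01 + x12 * x12 + x13
    * x13 + x14 * x14 + x15 * x15 + x16 * x16 + x17 * x17) (hy12 : y12 = x01 * x02 + x13 * x23 +
    x14 * x24 + x15 * x25 + x16 * x26 + x17 * x27) (hy13 : y13 = x01 * x03 - x12 * x23 + x14 * x34
    + x15 * x35 + x16 * x36 + x17 * x37) (hy14 : y14 = x01 * x04 - x12 * x24 - x13 * x34 + x15 *
    x45 + x16 * x46 + x17 * x47) (hy15 : y15 = x01 * x05 - x12 * x25 - x13 * x35 - x14 * x45 + x16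
    * x56 + x17 * x57) (hy16 : y16 = x01 * x06 - x12 * x26 - x13 * x36 - x14 * x46 - x15 * x56 +
    x17 * x67) (hy17 : y17 = x01 * x07 - x12 * x27 - x13 * x37 - x14 * x47 - x15 * x57 - x16 *
    x67) (hy22 : y22 = x02 * x02 + x12 * x12 + x23 * x23 + x24 * x24 + x25 * x25 + x26 * x26 + x27
    * x27) (hy23 : y23 = x02 * x03 + x12 * x13 + x24 * x34 + x25 * x35 + x26 * x36 + x27 * x37)
    (hy24 : y24 = x02 * x04 + x12 * x14 - x23 * x34 + x25 * x45 + x26 * x46 + x27 * x47) (hy25 :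
    y25 = x02 * x05 + x12 * x15 - x23 * x35 - x24 * x45 + x26 * x56 + x27 * x57) (hy26 : y26 = x02
    * x06 + x12 * x16 - x23 * x36 - x24 * x46 - x25 * x56 + x27 * x67) (hy27 : y27 = x02 * x07 +
    x12 * x17 - x23 * x37 - x24 * x47 - x25 * x57 - x26 * x67) (hy33 : y33 = x03 * x03 + x13 * x13
    + x23 * x23 + x34 * x34 + x35 * x35 + x36 * x36 + x37 * x37) (hy34 : y34 = x03 * x04 + x13 *
    x14 + x23 * x24 + x35 * x45 + x36 * x46 + x37 * x47) (hy35 : y35 = x03 * x05 + x13 * x15 + x23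
    * x25 - x34 * x45 + x36 * x56 + x37 * x57) (hy36 : y36 = x03 * x06 + x13 * x16 + x23 * x26 -
    x34 * x46 - x35 * x56 + x37 * x67) (hy37 : y37 = x03 * x07 + x13 * x17 + x23 * x27 - x34 * x47
    - x35 * x57 - x36 * x67) (hy44 : y44 = x04 * x04 + x14 * x14 + x24 * x24 + x34 * x34 + x45 *
    x45 + x46 * x46 + x47 * x47) (hy45 : y45 = x04 * x05 + x14 * x15 + x24 * x25 + x34 * x35 + x46
    * x56 + x47 * x57) (hy46 : y46 = x04 * x06 + x14 * x16 + x24 * x26 + x34 * x36 - x45 * x56 +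
    x47 * x67) (hy47 : y47 = x04 * x07 + x14 * x17 + x24 * x27 + x34 * x37 - x45 * x57 - x46 *
    x67) (hy55 : y55 = x05 * x05 + x15 * x15 + x25 * x25 + x35 * x35 + x45 * x45 + x56 * x56 + x57
    * x57) (hy56 : y56 = x05 * x06 + x15 * x16 + x25 * x26 + x35 * x36 + x45 * x46 + x57 * x67)
    (hy57 : y57 = x05 * x07 + x15 * x17 + x25 * x27 + x35 * x37 + x45 * x47 - x56 * x67) (hy66 :
    y66 = x06 * x06 + x16 * x16 + x26 * x26 + x36 * x36 + x46 * x46 + x56 * x56 + x67 * x67) (hy67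
    : y67 = x06 * x07 + x16 * x17 + x26 * x27 + x36 * x37 + x46 * x47 + x56 * x57) (hy77 : y77 =
    x07 * x07 + x17 * x17 + x27 * x27 + x37 * x37 + x47 * x47 + x57 * x57 + x67 * x67) :
    8 * (x01 * (x23 * (x45 * (x67) - x46 * (x57) + x47 * (x56)) - x24 * (x35 * (x67) - x36 * (x57)
    + x37 * (x56)) + x25 * (x34 * (x67) - x36 * (x47) + x37 * (x46)) - x26 * (x34 * (x57) - x35 *
    (x47) + x37 * (x45)) + x27 * (x34 * (x56) - x35 * (x46) + x36 * (x45))) - x02 * (x13 * (x45 *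
    (x67) - x46 * (x57) + x47 * (x56)) - x14 * (x35 * (x67) - x36 * (x57) + x37 * (x56)) + x15 *
    (x34 * (x67) - x36 * (x47) + x37 * (x46)) - x16 * (x34 * (x57) - x35 * (x47) + x37 * (x45)) +
    x17 * (x34 * (x56) - x35 * (x46) + x36 * (x45))) + x03 * (x12 * (x45 * (x67) - x46 * (x57) +
    x47 * (x56)) - x14 * (x25 * (x67) - x26 * (x57) + x27 * (x56)) + x15 * (x24 * (x67) - x26 *
    (x47) + x27 * (x46)) - x16 * (x24 * (x57) - x25 * (x47) + x27 * (x45)) + x17 * (x24 * (x56) -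
    x25 * (x46) + x26 * (x45))) - x04 * (x12 * (x35 * (x67) - x36 * (x57) + x37 * (x56)) - x13 *
    (x25 * (x67) - x26 * (x57) + x27 * (x56)) + x15 * (x23 * (x67) - x26 * (x37) + x27 * (x36)) -
    x16 * (x23 * (x57) - x25 * (x37) + x27 * (x35)) + x17 * (x23 * (x56) - x25 * (x36) + x26 *
    (x35))) + x05 * (x12 * (x34 * (x67) - x36 * (x47) + x37 * (x46)) - x13 * (x24 * (x67) - x26 *
    (x47) + x27 * (x46)) + x14 * (x23 * (x67) - x26 * (x37) + x27 * (x36)) - x16 * (x23 * (x47) -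
    x24 * (x37) + x27 * (x34)) + x17 * (x23 * (x46) - x24 * (x36) + x26 * (x34))) - x06 * (x12 *
    (x34 * (x57) - x35 * (x47) + x37 * (x45)) - x13 * (x24 * (x57) - x25 * (x47) + x27 * (x45)) +
    x14 * (x23 * (x57) - x25 * (x37) + x27 * (x35)) - x15 * (x23 * (x47) - x24 * (x37) + x27 *
    (x34)) + x17 * (x23 * (x45) - x24 * (x35) + x25 * (x34))) + x07 * (x12 * (x34 * (x56) - x35 *
    (x46) + x36 * (x45)) - x13 * (x24 * (x56) - x25 * (x46) + x26 * (x45)) + x14 * (x23 * (x56) -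
    x25 * (x36) + x26 * (x35)) - x15 * (x23 * (x46) - x24 * (x36) + x26 * (x34)) + x16 * (x23 *
    (x45) - x24 * (x35) + x25 * (x34)))) =
      -((y00 ^ 2 + y11 ^ 2 + y22 ^ 2 + y33 ^ 2 + y44 ^ 2 + y55 ^ 2 + y66 ^ 2 + y77 ^ 2) + 2 * (y01
      ^ 2 + y02 ^ 2 + y03 ^ 2 + y04 ^ 2 + y05 ^ 2 + y06 ^ 2 + y07 ^ 2 + y12 ^ 2 + y13 ^ 2 + y14 ^
      2 + y15 ^ 2 + y16 ^ 2 + y17 ^ 2 + y23 ^ 2 + y24 ^ 2 + y25 ^ 2 + y26 ^ 2 + y27 ^ 2 + y34 ^ 2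
      + y35 ^ 2 + y36 ^ 2 + y37 ^ 2 + y45 ^ 2 + y46 ^ 2 + y47 ^ 2 + y56 ^ 2 + y57 ^ 2 + y67 ^ 2))
      +
      (x01 ^ 2 + x02 ^ 2 + x03 ^ 2 + x04 ^ 2 + x05 ^ 2 + x06 ^ 2 + x07 ^ 2 + x12 ^ 2 + x13 ^ 2 +
      x14 ^ 2 + x15 ^ 2 + x16 ^ 2 + x17 ^ 2 + x23 ^ 2 + x24 ^ 2 + x25 ^ 2 + x26 ^ 2 + x27 ^ 2 +
      x34 ^ 2 + x35 ^ 2 + x36 ^ 2 + x37 ^ 2 + x45 ^ 2 + x46 ^ 2 + x47 ^ 2 + x56 ^ 2 + x57 ^ 2 +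
      x67 ^ 2) ^ 2 := by
  subst h0 h1 h2 h3 h4 h5 h6 hy00 hy01 hy02 hy03 hy04 hy05 hy06 hy07 hy11 hy12 hy13 hy14 hy15 hy16
    hy17 hy22 hy23 hy24 hy25 hy26 hy27 hy33 hy34 hy35 hy36 hy37 hy44 hy45 hy46 hy47 hy55 hy56 hy57
    hy66 hy67 hy77
  ring

theorem pfaffSum_self_eq_trace {X : Matrix (Fin 8) (Fin 8) ℝ} (hX : ∀ i j, X j i = -X i j)
    (h0 : X 0 7 = X 1 6 + X 2 5 - X 3 4) (h1 : X 4 7 = -X 0 3 + X 1 2 + X 5 6)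
    (h2 : X 6 7 = X 0 1 - X 2 3 + X 4 5) (h3 : X 1 7 = -X 0 6 + X 2 4 + X 3 5)
    (h4 : X 5 7 = X 0 2 + X 1 3 - X 4 6) (h5 : X 2 7 = -X 0 5 - X 1 4 - X 3 6)
    (h6 : X 3 7 = X 0 4 - X 1 5 + X 2 6) :
    pfaffSum X X X X = -(48 * (X * X * (X * X)).trace) + 12 * (X * X).trace ^ 2 := by
  have hd : ∀ i, X i i = 0 := fun i => by linarith [hX i i]
  have hY : ∀ i j, (X * X) i j = -∑ k, X i k * X j k := by
    intro i j
    rw [Matrix.mul_apply, ← Finset.sum_neg_distrib]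
    exact Finset.sum_congr rfl fun k _ => by rw [hX j k]; ring
  have hYs : ∀ i j, (X * X) j i = (X * X) i j := by
    intro i j
    rw [hY, hY]
    exact congrArg Neg.neg (Finset.sum_congr rfl fun k _ => mul_comm _ _)
  have key := @pfaffian_quartic_identity
    (X 0 1) (X 0 2) (X 0 3) (X 0 4) (X 0 5) (X 0 6) (X 0 7) (X 1 2) (X 1 3) (X 1 4) (X 1 5) (X 1
    6) (X 1 7) (X 2 3) (X 2 4) (X 2 5) (X 2 6) (X 2 7) (X 3 4) (X 3 5) (X 3 6) (X 3 7) (X 4 5) (X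
    4 6) (X 4 7) (X 5 6) (X 5 7) (X 6 7)
    (-(X * X) 0 0) (-(X * X) 0 1) (-(X * X) 0 2) (-(X * X) 0 3) (-(X * X) 0 4) (-(X * X) 0 5) (-(X
    * X) 0 6) (-(X * X) 0 7) (-(X * X) 1 1) (-(X * X) 1 2) (-(X * X) 1 3) (-(X * X) 1 4) (-(X * X)
    1 5) (-(X * X) 1 6) (-(X * X) 1 7) (-(X * X) 2 2) (-(X * X) 2 3) (-(X * X) 2 4) (-(X * X) 2 5)
    (-(X * X) 2 6) (-(X * X) 2 7) (-(X * X) 3 3) (-(X * X) 3 4) (-(X * X) 3 5) (-(X * X) 3 6) (-(X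
    * X) 3 7) (-(X * X) 4 4) (-(X * X) 4 5) (-(X * X) 4 6) (-(X * X) 4 7) (-(X * X) 5 5) (-(X * X)
    5 6) (-(X * X) 5 7) (-(X * X) 6 6) (-(X * X) 6 7) (-(X * X) 7 7)
    h0 h1 h2 h3 h4 h5 h6
  -- One definition for each entry of −X² on or above the diagonal.
  iterate 36
    specialize key (by
      simp only [hY, Fin.sum_univ_eight, hd,
        hX 0 1, hX 0 2, hX 0 3, hX 0 4, hX 0 5, hX 0 6, hX 0 7, hX 1 2, hX 1 3, hX 1 4, hX 1 5, hX
        1 6, hX 1 7, hX 2 3, hX 2 4, hX 2 5, hX 2 6, hX 2 7, hX 3 4, hX 3 5, hX 3 6, hX 3 7, hX 4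
        5, hX 4 6, hX 4 7, hX 5 6, hX 5 7, hX 6 7]
      ring)
  have htr : (X * X).trace =
      -(2 * (X 0 1 ^ 2 + X 0 2 ^ 2 + X 0 3 ^ 2 + X 0 4 ^ 2 + X 0 5 ^ 2 + X 0 6 ^ 2 + X 0 7 ^ 2 + X
      1 2 ^ 2 + X 1 3 ^ 2 + X 1 4 ^ 2 + X 1 5 ^ 2 + X 1 6 ^ 2 + X 1 7 ^ 2 + X 2 3 ^ 2 + X 2 4 ^ 2
      + X 2 5 ^ 2 + X 2 6 ^ 2 + X 2 7 ^ 2 + X 3 4 ^ 2 + X 3 5 ^ 2 + X 3 6 ^ 2 + X 3 7 ^ 2 + X 4 5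
      ^ 2 + X 4 6 ^ 2 + X 4 7 ^ 2 + X 5 6 ^ 2 + X 5 7 ^ 2 + X 6 7 ^ 2)) := by
    simp only [Matrix.trace, Matrix.diag_apply, hY, Fin.sum_univ_eight, hd,
      hX 0 1, hX 0 2, hX 0 3, hX 0 4, hX 0 5, hX 0 6, hX 0 7, hX 1 2, hX 1 3, hX 1 4, hX 1 5, hX 1
      6, hX 1 7, hX 2 3, hX 2 4, hX 2 5, hX 2 6, hX 2 7, hX 3 4, hX 3 5, hX 3 6, hX 3 7, hX 4 5,
      hX 4 6, hX 4 7, hX 5 6, hX 5 7, hX 6 7]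
    ring
  have htr4 : (X * X * (X * X)).trace = ∑ i, ∑ j, (X * X) i j ^ 2 := by
    rw [Matrix.trace]
    refine Finset.sum_congr rfl fun i _ => ?_
    rw [Matrix.diag_apply, Matrix.mul_apply]
    exact Finset.sum_congr rfl fun j _ => by rw [hYs i j, sq]
  rw [pfaffSum_self hX, htr, htr4]
  generalize X * X = Y at key hYs ⊢
  simp only [Fin.sum_univ_eight, hYs 0 1, hYs 0 2, hYs 0 3, hYs 0 4, hYs 0 5, hYs 0 6, hYs 0 7,
    hYs 1 2, hYs 1 3, hYs 1 4, hYs 1 5, hYs 1 6, hYs 1 7, hYs 2 3, hYs 2 4, hYs 2 5, hYs 2 6, hYs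
    2 7, hYs 3 4, hYs 3 5, hYs 3 6, hYs 3 7, hYs 4 5, hYs 4 6, hYs 4 7, hYs 5 6, hYs 5 7, hYs 6 7]
  linear_combination 48 * key

end

noncomputable section

/-! ### Polarization -/

/-- Linearity in each of four arguments. -/
structure IsQuadrilinear {V : Type*} [AddCommGroup V] [Module ℝ V] (G : V → V → V → V → ℝ) :
    Prop where
  add₁ : ∀ a a' b c d, G (a + a') b c d = G a b c d + G a' b c d
  add₂ : ∀ a b b' c d, G a (b + b') c d = G a b c d + G a b' c d
  add₃ : ∀ a b c c' d, G a b (c + c') d = G a b c d + G a b c' d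
  add₄ : ∀ a b c d d', G a b c (d + d') = G a b c d + G a b c d'
  smul₁ : ∀ (r : ℝ) a b c d, G (r • a) b c d = r * G a b c d
  smul₂ : ∀ (r : ℝ) a b c d, G a (r • b) c d = r * G a b c d
  smul₃ : ∀ (r : ℝ) a b c d, G a b (r • c) d = r * G a b c d
  smul₄ : ∀ (r : ℝ) a b c d, G a b c (r • d) = r * G a b c d

/-- The term linear in t of G at x + ty, with all four arguments equal, shows that G(y, x, x, x) =
0; inclusion and exclusion over a, b, c then polarizes this cubic form. -/
theorem IsQuadrilinear.polarize {V : Type*} [AddCommGroup V] [Module ℝ V]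
    {G : V → V → V → V → ℝ} (hG : IsQuadrilinear G) (S : Submodule ℝ V)
    (h0 : ∀ x ∈ S, G x x x x = 0) (h2 : ∀ x y, G x y x x = G y x x x)
    (h3 : ∀ x y, G x x y x = G y x x x) (h4 : ∀ x y, G x x x y = G y x x x)
    {y a b c : V} (hy : y ∈ S) (ha : a ∈ S) (hb : b ∈ S) (hc : c ∈ S) :
    G y a b c + G y a c b + G y b a c + G y b c a + G y c a b + G y c b a = 0 := by
  have h1 : ∀ x ∈ S, G y x x x = 0 := by
    intro x hx
    have e : ∀ t : ℝ, G (x + t • y) (x + t • y) (x + t • y) (x + t • y) = 0 := fun t =>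
      h0 _ (S.add_mem hx (S.smul_mem t hy))
    have e1 := e 1
    have e2 := e (-1)
    have e3 := e 2
    have e4 := e (-2)
    simp only [hG.add₁, hG.add₂, hG.add₃, hG.add₄, hG.smul₁, hG.smul₂, hG.smul₃, hG.smul₄]
      at e1 e2 e3 e4
    -- The odd differences at t = 1 and t = 2 contain t and t³ terms. The weights 8 and −1 cancel
    -- the cubic one and leave 12 times the linear one, which consists of four terms that coincide
    -- by `h2`, `h3` and `h4`.
    linear_combination (8 * (e1 - e2) - (e3 - e4)) / 48 - (h2 x y + h3 x y + h4 x y) / 4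
  have e := h1 _ (S.add_mem (S.add_mem ha hb) hc)
  have e1 := h1 _ (S.add_mem ha hb)
  have e2 := h1 _ (S.add_mem ha hc)
  have e3 := h1 _ (S.add_mem hb hc)
  simp only [hG.add₂, hG.add₃, hG.add₄] at e e1 e2 e3
  linear_combination e - e1 - e2 - e3 + h1 a ha + h1 b hb + h1 c hc

/-- The difference of the polarized Pfaffian and the corresponding expression in traces. -/
def pfaffDefect (A B C D : Matrix (Fin 8) (Fin 8) ℝ) : ℝ :=
  pfaffSum A B C D + 48 * (A * B * (C * D)).trace - 12 * ((A * B).trace * (C * D).trace)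

theorem isQuadrilinear_pfaffDefect : IsQuadrilinear pfaffDefect where
  add₁ a a' b c d := by
    simp only [pfaffDefect, pfaffSum_add₁, add_mul, Matrix.trace_add]
    ring
  add₂ a b b' c d := by
    simp only [pfaffDefect, pfaffSum_add₂, mul_add, add_mul, Matrix.trace_add]
    ring
  add₃ a b c c' d := by
    simp only [pfaffDefect, pfaffSum_add₃, mul_add, add_mul, Matrix.trace_add]
    ring
  add₄ a b c d d' := by
    simp only [pfaffDefect, pfaffSum_add₄, mul_add, Matrix.trace_add]
    ring
  smul₁ r a b c d := by
    simp only [pfaffDefect, pfaffSum_smul₁, smul_mul_assoc, Matrix.trace_smul, smul_eq_mul]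
    ring
  smul₂ r a b c d := by
    simp only [pfaffDefect, pfaffSum_smul₂, mul_smul_comm, smul_mul_assoc, Matrix.trace_smul,
      smul_eq_mul]
    ring
  smul₃ r a b c d := by
    simp only [pfaffDefect, pfaffSum_smul₃, mul_smul_comm, smul_mul_assoc, Matrix.trace_smul,
      smul_eq_mul]
    ring
  smul₄ r a b c d := by
    simp only [pfaffDefect, pfaffSum_smul₄, mul_smul_comm, Matrix.trace_smul,
      smul_eq_mul]
    ring

/-- Tr(ABCD) is not symmetric, but when three arguments coincide cyclicity moves the fourth one to
the front, which is all the polarization asks for. -/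
theorem pfaffDefect_polarize (S : Submodule ℝ (Matrix (Fin 8) (Fin 8) ℝ))
    (hS : ∀ X ∈ S, pfaffSum X X X X = -(48 * (X * X * (X * X)).trace) + 12 * (X * X).trace ^ 2)
    {Y A B C : Matrix (Fin 8) (Fin 8) ℝ} (hY : Y ∈ S) (hA : A ∈ S) (hB : B ∈ S) (hC : C ∈ S) :
    pfaffDefect Y A B C + pfaffDefect Y A C B + pfaffDefect Y B A C + pfaffDefect Y B C A +
      pfaffDefect Y C A B + pfaffDefect Y C B A = 0 := by
  refine isQuadrilinear_pfaffDefect.polarize S (fun X hX => ?_) (fun X Y => ?_) (fun X Y => ?_)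
    (fun X Y => ?_) hY hA hB hC
  · rw [pfaffDefect, hS X hX]
    ring
  · rw [pfaffDefect, pfaffDefect, pfaffSum_swap₁₂, Matrix.trace_mul_comm X Y,
      show X * Y * (X * X) = X * (Y * X * X) by noncomm_ring,
      Matrix.trace_mul_comm X (Y * X * X), mul_assoc (Y * X)]
  · rw [pfaffDefect, pfaffDefect, pfaffSum_swap₂₃, pfaffSum_swap₁₂,
      Matrix.trace_mul_comm (X * X) (Y * X)]
    ring
  · rw [pfaffDefect, pfaffDefect, pfaffSum_swap₃₄, pfaffSum_swap₂₃, pfaffSum_swap₁₂,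
      show X * X * (X * Y) = X * X * X * Y by noncomm_ring, Matrix.trace_mul_comm (X * X * X) Y,
      show Y * (X * X * X) = Y * X * (X * X) by noncomm_ring, Matrix.trace_mul_comm X Y]
    ring

/-! ### The two alternating sums -/

/-- The alternating sum that corresponds to the Euler-type seven-form. -/
def eulerSum {R : Type*} [CommRing R] (Z : Fin 7 → Matrix (Fin 8) (Fin 8) R) : R :=
  altSum (fun v => pfaffSum (v 0) (v 1 * v 2) (v 3 * v 4) (v 5 * v 6)) Z

theorem altSum_comp_perm_one {α R : Type*} [CommRing R] {n : ℕ} {ρ : Equiv.Perm (Fin n)}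
    (hρ : Equiv.Perm.sign ρ = 1) (f : (Fin n → α) → R) (v : Fin n → α) :
    altSum (fun w => f (w ∘ ρ)) v = altSum f v := by
  rw [altSum_comp_perm, hρ]
  simp

theorem altSum_comp_perm_neg_one {α R : Type*} [CommRing R] {n : ℕ} {ρ : Equiv.Perm (Fin n)}
    (hρ : Equiv.Perm.sign ρ = -1) (f : (Fin n → α) → R) (v : Fin n → α) :
    altSum (fun w => f (w ∘ ρ)) v = -altSum f v := by
  rw [altSum_comp_perm, hρ]
  simp

/-- Alternating sums of a function of commutators. -/
theorem altSum_commutator {A : Type*} [Ring A] {F : A → A → A → A → ℝ}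
    (h2 : ∀ a b b' c d, F a (b - b') c d = F a b c d - F a b' c d)
    (h3 : ∀ a b c c' d, F a b (c - c') d = F a b c d - F a b c' d)
    (h4 : ∀ a b c d d', F a b c (d - d') = F a b c d - F a b c d') (Z : Fin 7 → A) :
    altSum (fun v => F (v 0) (v 1 * v 2 - v 2 * v 1) (v 3 * v 4 - v 4 * v 3)
      (v 5 * v 6 - v 6 * v 5)) Z =
      8 * altSum (fun v => F (v 0) (v 1 * v 2) (v 3 * v 4) (v 5 * v 6)) Z := by
  have e : ∀ i j : Fin 7, i ≠ j → ∀ H H' : (Fin 7 → A) → ℝ,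
      (∀ v, H' v = H v - H (v ∘ Equiv.swap i j)) → altSum H' Z = 2 * altSum H Z := by
    intro i j hij H H' h
    rw [funext h, altSum_sub,
      altSum_comp_perm_neg_one (Equiv.Perm.sign_swap hij)]
    ring
  refine (e 1 2 (by decide) (fun v => F (v 0) (v 1 * v 2) (v 3 * v 4 - v 4 * v 3)
    (v 5 * v 6 - v 6 * v 5)) _ fun v => h2 _ _ (v 2 * v 1) _ _).trans ?_
  rw [show (8 : ℝ) = 2 * (2 * 2) by norm_num, mul_assoc, mul_assoc]
  refine congrArg _ ((e 3 4 (by decide) (fun v => F (v 0) (v 1 * v 2) (v 3 * v 4)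
    (v 5 * v 6 - v 6 * v 5)) _ fun v => h3 _ _ _ (v 4 * v 3) _).trans (congrArg _ ?_))
  exact e 5 6 (by decide) (fun v => F (v 0) (v 1 * v 2) (v 3 * v 4) (v 5 * v 6)) _
    fun v => h4 _ _ _ _ (v 6 * v 5)

/-- The sum over all orders of the last three arguments. -/
def symmLastThree {V : Type*} (F : V → V → V → V → ℝ) (y a b c : V) : ℝ :=
  F y a b c + F y a c b + F y b a c + F y b c a + F y c a b + F y c b a

/-- An alternating sum over seven arguments does not change when the last three pairs of
arguments are permuted. -/
theorem altSum_symmetrize {A : Type*} [Ring A] (F : A → A → A → A → ℝ) (Z : Fin 7 → A) :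
    altSum (fun v => symmLastThree F (v 0) (v 1 * v 2 - v 2 * v 1) (v 3 * v 4 - v 4 * v 3)
      (v 5 * v 6 - v 6 * v 5)) Z =
      6 * altSum (fun v => F (v 0) (v 1 * v 2 - v 2 * v 1) (v 3 * v 4 - v 4 * v 3)
        (v 5 * v 6 - v 6 * v 5)) Z := by
  let f : (Fin 7 → A) → ℝ := fun v => F (v 0) (v 1 * v 2 - v 2 * v 1) (v 3 * v 4 - v 4 * v 3)
    (v 5 * v 6 - v 6 * v 5)
  let r₁ : Equiv.Perm (Fin 7) := ⟨![0, 1, 2, 5, 6, 3, 4], ![0, 1, 2, 5, 6, 3, 4], by decide, by decide⟩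
  let r₂ : Equiv.Perm (Fin 7) := ⟨![0, 3, 4, 1, 2, 5, 6], ![0, 3, 4, 1, 2, 5, 6], by decide, by decide⟩
  let r₃ : Equiv.Perm (Fin 7) := ⟨![0, 3, 4, 5, 6, 1, 2], ![0, 5, 6, 1, 2, 3, 4], by decide, by decide⟩
  let r₄ : Equiv.Perm (Fin 7) := ⟨![0, 5, 6, 1, 2, 3, 4], ![0, 3, 4, 5, 6, 1, 2], by decide, by decide⟩
  let r₅ : Equiv.Perm (Fin 7) := ⟨![0, 5, 6, 3, 4, 1, 2], ![0, 5, 6, 3, 4, 1, 2], by decide, by decide⟩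
  have e : ∀ ρ : Equiv.Perm (Fin 7), Equiv.Perm.sign ρ = 1 →
      altSum (fun w => f (w ∘ ρ)) Z = altSum f Z := fun ρ hρ => altSum_comp_perm_one hρ f Z
  have h : altSum (fun w => f w + f (w ∘ r₁) + f (w ∘ r₂) + f (w ∘ r₃) + f (w ∘ r₄) +
      f (w ∘ r₅)) Z = 6 * altSum f Z := by
    rw [altSum_add, altSum_add, altSum_add, altSum_add, altSum_add, e r₁ (by decide +kernel),
      e r₂ (by decide +kernel), e r₃ (by decide +kernel), e r₄ (by decide +kernel),
      e r₅ (by decide +kernel)]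
    ring
  exact h

theorem altSum_trace_eq_altProd (Z : Fin 7 → Matrix (Fin 8) (Fin 8) ℝ) :
    altSum (fun v => (v 0 * (v 1 * v 2) * (v 3 * v 4 * (v 5 * v 6))).trace) Z =
      (altProd Z).trace := by
  rw [altSum, altProd, Matrix.trace_sum]
  refine Finset.sum_congr rfl fun σ _ => ?_
  rw [Matrix.trace_smul, zsmul_eq_mul]
  congr 2
  simp [List.ofFn_succ, mul_assoc]

/-- The cyclic shift of the last four arguments preserves the second trace but is an odd
permutation, so the sum equals its own negative. -/
theorem altSum_trace_mul_trace (Z : Fin 7 → Matrix (Fin 8) (Fin 8) ℝ) :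
    altSum (fun v => (v 0 * (v 1 * v 2)).trace * (v 3 * v 4 * (v 5 * v 6)).trace) Z = 0 := by
  let ρ : Equiv.Perm (Fin 7) := ⟨![0, 1, 2, 4, 5, 6, 3], ![0, 1, 2, 6, 3, 4, 5], by decide, by decide⟩
  have h := altSum_comp_perm_neg_one (ρ := ρ) (by decide +kernel)
    (fun v => (v 0 * (v 1 * v 2)).trace * (v 3 * v 4 * (v 5 * v 6)).trace) Z
  have h' : altSum (fun w => (fun v : Fin 7 → Matrix (Fin 8) (Fin 8) ℝ =>
      (v 0 * (v 1 * v 2)).trace * (v 3 * v 4 * (v 5 * v 6)).trace) (w ∘ ρ)) Z =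
      altSum (fun v => (v 0 * (v 1 * v 2)).trace * (v 3 * v 4 * (v 5 * v 6)).trace) Z := by
    refine altSum_congr fun σ => ?_
    generalize Z ∘ σ = v
    change (v 0 * (v 1 * v 2)).trace * (v 4 * v 5 * (v 6 * v 3)).trace = _
    rw [show v 4 * v 5 * (v 6 * v 3) = v 4 * v 5 * v 6 * v 3 by noncomm_ring,
      Matrix.trace_mul_comm _ (v 3),
      show v 3 * (v 4 * v 5 * v 6) = v 3 * v 4 * (v 5 * v 6) by noncomm_ring]
  linarith

/-- The products v_kv_l need not lie in S, but their commutators do. Under antisymmetrization each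
product may be replaced by half a commutator, and permuting the three pairs changes nothing. So the
polarized identity applies and the alternating sum of the defect vanishes. In it the double trace
contributes zero. -/
theorem eulerSum_eq_trace_altProd (S : Submodule ℝ (Matrix (Fin 8) (Fin 8) ℝ))
    (hS : ∀ X ∈ S, pfaffSum X X X X = -(48 * (X * X * (X * X)).trace) + 12 * (X * X).trace ^ 2)
    {Z : Fin 7 → Matrix (Fin 8) (Fin 8) ℝ} (hZ : ∀ k, Z k ∈ S)
    (hZZ : ∀ k l, Z k * Z l - Z l * Z k ∈ S) :
    eulerSum Z = -(48 * (altProd Z).trace) := by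
  have hQ := isQuadrilinear_pfaffDefect
  have hsub : ∀ f : Matrix (Fin 8) (Fin 8) ℝ → ℝ, (∀ a b, f (a + b) = f a + f b) →
      ∀ a b, f (a - b) = f a - f b := by
    intro f hf a b
    rw [eq_sub_iff_add_eq, ← hf, sub_add_cancel]
  have h1 := altSum_symmetrize pfaffDefect Z
  rw [altSum_commutator (fun a b b' c d => hsub (fun x => pfaffDefect a x c d)
      (fun x y => hQ.add₂ a x y c d) b b') (fun a b c c' d => hsub (fun x => pfaffDefect a b x d)
      (fun x y => hQ.add₃ a b x y d) c c') (fun a b c d d' => hsub (fun x => pfaffDefect a b c x)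
      (fun x y => hQ.add₄ a b c x y) d d')] at h1
  have h2 : altSum (fun v => pfaffDefect (v 0) (v 1 * v 2) (v 3 * v 4) (v 5 * v 6)) Z =
      eulerSum Z + 48 * (altProd Z).trace - 12 * 0 := by
    rw [eulerSum, ← altSum_trace_eq_altProd, ← altSum_trace_mul_trace Z, ← altSum_const_mul,
      ← altSum_const_mul, ← altSum_add, ← altSum_sub]
    rfl
  have h3 : altSum (fun v => symmLastThree pfaffDefect (v 0) (v 1 * v 2 - v 2 * v 1)
      (v 3 * v 4 - v 4 * v 3) (v 5 * v 6 - v 6 * v 5)) Z = 0 := by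
    rw [altSum]
    refine Finset.sum_eq_zero fun σ _ => ?_
    rw [symmLastThree]
    simp only [Function.comp_apply]
    rw [pfaffDefect_polarize S hS (hZ _) (hZZ _ _) (hZZ _ _) (hZZ _ _), mul_zero]
  rw [h3, h2] at h1
  linarith

end

noncomputable section

/-! ### Monomial matrices -/

/-- The matrix with the entry `a i` at `(i, π i)`. -/
def monoMat {R : Type*} [CommRing R] (π : Fin 8 → Fin 8) (a : Fin 8 → R) :
    Matrix (Fin 8) (Fin 8) R :=
  Matrix.of fun i k => if k = π i then a i else 0

section

variable {R : Type*} [CommRing R]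

theorem mul_monoMat_trace (A : Matrix (Fin 8) (Fin 8) R) (π : Fin 8 → Fin 8) (a : Fin 8 → R) :
    (A * monoMat π a).trace = ∑ i, A (π i) i * a i := by
  rw [Matrix.trace_mul_comm]
  refine Finset.sum_congr rfl fun i _ => ?_
  simp [Matrix.mul_apply, monoMat, mul_comm]

theorem monoMat_mul_apply (π : Fin 8 → Fin 8) (a : Fin 8 → R) (A : Matrix (Fin 8) (Fin 8) R)
    (i k : Fin 8) : (monoMat π a * A) i k = a i * A (π i) k := by
  simp [Matrix.mul_apply, monoMat]

end

/-- The column of the nonzero entry in each row of the model gamma matrices. -/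
def octCol : Fin 7 → Fin 8 → Fin 8 :=
  ![![7, 6, 3, 2, 5, 4, 1, 0],
    ![6, 7, 4, 5, 2, 3, 0, 1],
    ![3, 4, 7, 0, 1, 6, 5, 2],
    ![2, 5, 0, 7, 6, 1, 4, 3],
    ![5, 2, 1, 6, 7, 0, 3, 4],
    ![4, 3, 6, 1, 0, 7, 2, 5],
    ![1, 0, 5, 4, 3, 2, 7, 6]]

theorem octIndex_eq_iff : ∀ (m : Fin 7) (i k : Fin 8), i ≠ k → (octIndex i k = m ↔ k = octCol m i) := by
  decide +kernel

theorem octCol_ne : ∀ (m : Fin 7) (i : Fin 8), octCol m i ≠ i := by decide +kernel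

/-- On the diagonal `octIndex` has the default value 0, so these zeros are what keeps spurious
entries out of the matrices with index 0. -/
theorem diag_eq_zero : ∀ i : Fin 8, octMulSign i i = 0 ∧ thetaP i i = 0 ∧ thetaQ i i = 0 := by
  decide +kernel

theorem octGamma_eq_monoMat (R : Type*) [CommRing R] (m : Fin 7) :
    octGamma R m = monoMat (octCol m) fun i => (octMulSign i (octCol m i) : R) := by
  ext i k
  simp only [octGamma, monoMat, Matrix.of_apply]
  by_cases hik : i = k
  · subst hik
    simp [diag_eq_zero, (octCol_ne m i).symm]
  · by_cases h : k = octCol m i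
    · rw [if_pos ((octIndex_eq_iff m i k hik).2 h), if_pos h, h]
    · rw [if_neg (mt (octIndex_eq_iff m i k hik).1 h), if_neg h]

theorem octTheta_eq_monoMat {R : Type*} [CommRing R] (c : R) (j : Fin 7) :
    octTheta c j = monoMat (octCol j) fun i =>
      (thetaP i (octCol j i) : R) + c * (thetaQ i (octCol j i) : R) := by
  ext i k
  simp only [octTheta, monoMat, Matrix.of_apply]
  by_cases hik : i = k
  · subst hik
    simp [diag_eq_zero, (octCol_ne j i).symm]
  · by_cases h : k = octCol j i
    · rw [if_pos ((octIndex_eq_iff j i k hik).2 h), if_pos h, h]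
    · rw [if_neg (mt (octIndex_eq_iff j i k hik).1 h), if_neg h]

/-! ### The Maurer-Cartan form takes values in the spin algebra -/

theorem theta_antisymm : ∀ i k, thetaP k i = -thetaP i k ∧ thetaQ k i = -thetaQ i k := by
  decide +kernel

theorem octTheta_antisymm (c : ℝ) (j : Fin 7) : (octTheta c j)ᵀ = -octTheta c j := by
  ext i k
  simp only [octTheta, Matrix.transpose_apply, Matrix.neg_apply, Matrix.of_apply,
    octIndex_symm k i, (theta_antisymm i k).1, (theta_antisymm i k).2]
  split_ifs
  · push_cast
    ring
  · ring

/-- The coefficients of the trace of the product of a component of the Maurer-Cartan form and a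
model gamma matrix. -/
def thetaGammaCoeff (A : Fin 8 → Fin 8 → ℤ) (k m : Fin 7) (i : Fin 8) : ℤ :=
  if octCol k (octCol m i) = i then
    Int.mul (A (octCol m i) i) (octMulSign i (octCol m i)) else 0

theorem sum_thetaGammaCoeff : ∀ k m : Fin 7,
    ∑ i, thetaGammaCoeff thetaP k m i = 0 ∧ ∑ i, thetaGammaCoeff thetaQ k m i = 0 := by
  decide +kernel

/-- Orthogonality to all γ_m in the trace form singles out spin(7) among the skew matrices. The
trace is affine in c, and both coefficients are finite integer sums. -/
theorem trace_octTheta_mul_octGamma (c : ℝ) (k m : Fin 7) :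
    (octTheta c k * octGamma ℝ m).trace = 0 := by
  have h : (octTheta c k * octGamma ℝ m).trace =
      ((∑ i, thetaGammaCoeff thetaP k m i : ℤ) : ℝ) +
        c * ((∑ i, thetaGammaCoeff thetaQ k m i : ℤ) : ℝ) := by
    rw [octGamma_eq_monoMat, octTheta_eq_monoMat, mul_monoMat_trace]
    push_cast
    rw [Finset.mul_sum, ← Finset.sum_add_distrib]
    refine Finset.sum_congr rfl fun i _ => ?_
    simp only [monoMat, Matrix.of_apply, thetaGammaCoeff]
    by_cases h : octCol k (octCol m i) = i
    · rw [if_pos h.symm, if_pos h, if_pos h, h]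
      change _ = ((thetaP (octCol m i) i * octMulSign i (octCol m i) : ℤ) : ℝ) +
        c * ((thetaQ (octCol m i) i * octMulSign i (octCol m i) : ℤ) : ℝ)
      push_cast
      ring
    · rw [if_neg (Ne.symm h), if_neg h, if_neg h]
      simp
  rw [h, (sum_thetaGammaCoeff k m).1, (sum_thetaGammaCoeff k m).2]
  simp

/-- The coefficients of the trace of the product of two components of the Maurer-Cartan form and a
model gamma matrix. -/
def thetaThetaGammaCoeff (A B : Fin 8 → Fin 8 → ℤ) (k l m : Fin 7) (i : Fin 8) : ℤ :=
  if octCol l (octCol k (octCol m i)) = i then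
    Int.mul (Int.mul (A (octCol m i) (octCol k (octCol m i))) (B (octCol k (octCol m i)) i))
      (octMulSign i (octCol m i))
  else 0

/-- The sum of eight integers. -/
def sum8 (f : Fin 8 → ℤ) : ℤ :=
  Int.add (f 0) (Int.add (f 1) (Int.add (f 2) (Int.add (f 3) (Int.add (f 4) (Int.add (f 5)
    (Int.add (f 6) (f 7)))))))

theorem sum8_eq (f : Fin 8 → ℤ) : sum8 f = ∑ i, f i := by
  rw [Fin.sum_univ_eight]
  change f 0 + (f 1 + (f 2 + (f 3 + (f 4 + (f 5 + (f 6 + f 7)))))) = _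
  ring

theorem sum8_thetaThetaGammaCoeff : ∀ k l m : Fin 7,
    sum8 (thetaThetaGammaCoeff thetaP thetaP k l m) =
      sum8 (thetaThetaGammaCoeff thetaP thetaP l k m) ∧
    Int.add (sum8 (thetaThetaGammaCoeff thetaP thetaQ k l m))
      (sum8 (thetaThetaGammaCoeff thetaQ thetaP k l m)) =
      Int.add (sum8 (thetaThetaGammaCoeff thetaP thetaQ l k m))
        (sum8 (thetaThetaGammaCoeff thetaQ thetaP l k m)) ∧
    sum8 (thetaThetaGammaCoeff thetaQ thetaQ k l m) =
      sum8 (thetaThetaGammaCoeff thetaQ thetaQ l k m) := by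
  decide +kernel

theorem trace_octTheta_mul_octTheta_mul_octGamma (c : ℝ) (k l m : Fin 7) :
    (octTheta c k * octTheta c l * octGamma ℝ m).trace =
      ((sum8 (thetaThetaGammaCoeff thetaP thetaP k l m) : ℤ) : ℝ) +
      c * (((sum8 (thetaThetaGammaCoeff thetaP thetaQ k l m) : ℤ) : ℝ) +
        ((sum8 (thetaThetaGammaCoeff thetaQ thetaP k l m) : ℤ) : ℝ)) +
      c ^ 2 * ((sum8 (thetaThetaGammaCoeff thetaQ thetaQ k l m) : ℤ) : ℝ) := by
  simp only [sum8_eq]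
  rw [octGamma_eq_monoMat, octTheta_eq_monoMat, octTheta_eq_monoMat, mul_monoMat_trace]
  push_cast
  rw [← Finset.sum_add_distrib, Finset.mul_sum, Finset.mul_sum, ← Finset.sum_add_distrib,
    ← Finset.sum_add_distrib]
  refine Finset.sum_congr rfl fun i _ => ?_
  rw [monoMat_mul_apply]
  simp only [monoMat, Matrix.of_apply, thetaThetaGammaCoeff]
  by_cases h : octCol l (octCol k (octCol m i)) = i
  · rw [if_pos h.symm, if_pos h, if_pos h, if_pos h, if_pos h, h]
    simp only [Int.mul_def]
    push_cast
    ring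
  · rw [if_neg (Ne.symm h), if_neg h, if_neg h, if_neg h, if_neg h]
    simp

/-- Brackets of components of θ stay in spin(7). This is verified for each power of c separately, as
a symmetry in k and l of the integer coefficients. -/
theorem trace_commutator_octTheta_mul_octGamma (c : ℝ) (k l m : Fin 7) :
    ((octTheta c k * octTheta c l - octTheta c l * octTheta c k) * octGamma ℝ m).trace = 0 := by
  obtain ⟨h0, h1, h2⟩ := sum8_thetaThetaGammaCoeff k l m
  have h1' := congrArg (Int.cast : ℤ → ℝ) h1
  simp only [Int.add_def] at h1'
  push_cast at h1'
  rw [sub_mul, Matrix.trace_sub, trace_octTheta_mul_octTheta_mul_octGamma,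
    trace_octTheta_mul_octTheta_mul_octGamma, h0, h2, h1']
  ring

/-! ### The standard gamma matrices -/

/-- The column of the nonzero entry in each row of the standard gamma matrices. -/
def stdCol : Fin 7 → Fin 8 → Fin 8 :=
  ![![7, 6, 5, 4, 3, 2, 1, 0],
    ![3, 2, 1, 0, 7, 6, 5, 4],
    ![1, 0, 3, 2, 5, 4, 7, 6],
    ![6, 7, 4, 5, 2, 3, 0, 1],
    ![2, 3, 0, 1, 6, 7, 4, 5],
    ![5, 4, 7, 6, 1, 0, 3, 2],
    ![4, 5, 6, 7, 0, 1, 2, 3]]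

/-- The nonzero entries of the standard gamma matrices, divided by the imaginary unit. -/
def stdSign : Fin 7 → Fin 8 → ℤ :=
  ![![-1, 1, 1, -1, 1, -1, -1, 1],
    ![-1, 1, -1, 1, -1, 1, -1, 1],
    ![-1, 1, 1, -1, -1, 1, 1, -1],
    ![1, 1, -1, -1, 1, 1, -1, -1],
    ![-1, -1, 1, 1, 1, 1, -1, -1],
    ![-1, -1, -1, -1, 1, 1, 1, 1],
    ![-1, 1, -1, 1, 1, -1, 1, -1]]

/-- The standard gamma matrices divided by the imaginary unit. -/
def stdReal (R : Type*) [CommRing R] (m : Fin 7) : Matrix (Fin 8) (Fin 8) R :=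
  monoMat (stdCol m) fun i => (stdSign m i : R)

/-- The triple tensor product of integer matrices. -/
def tensor3Int (A B C : Matrix (Fin 2) (Fin 2) ℤ) (i k : Fin 8) : ℤ :=
  A (bits.symm i).1 (bits.symm k).1 *
    (B (bits.symm i).2.1 (bits.symm k).2.1 * C (bits.symm i).2.2 (bits.symm k).2.2)

theorem tensor3_apply (A B C : Matrix (Fin 2) (Fin 2) ℂ) (i k : Fin 8) :
    tensor3 A B C i k = A (bits.symm i).1 (bits.symm k).1 *
      (B (bits.symm i).2.1 (bits.symm k).2.1 * C (bits.symm i).2.2 (bits.symm k).2.2) := by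
  simp [tensor3, Matrix.kroneckerMap_apply]

theorem tensor3_intCast (A B C : Matrix (Fin 2) (Fin 2) ℤ) (i k : Fin 8) :
    tensor3 (A.map (Int.cast : ℤ → ℂ)) (B.map Int.cast) (C.map Int.cast) i k =
      (tensor3Int A B C i k : ℂ) := by
  simp [tensor3_apply, tensor3Int]

/-- The entries of the standard gamma matrices divided by the imaginary unit. -/
def stdEntry (m : Fin 7) (i k : Fin 8) : ℤ := if k = stdCol m i then stdSign m i else 0

theorem stdEntry_eq : ∀ i k : Fin 8,
    stdEntry 0 i k = tensor3Int !![0, -1; 1, 0] !![0, -1; 1, 0] !![0, -1; 1, 0] i k ∧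
    stdEntry 1 i k = tensor3Int !![1, 0; 0, 1] !![0, 1; 1, 0] !![0, -1; 1, 0] i k ∧
    stdEntry 2 i k = tensor3Int !![1, 0; 0, 1] !![1, 0; 0, -1] !![0, -1; 1, 0] i k ∧
    stdEntry 3 i k = -tensor3Int !![0, 1; 1, 0] !![0, -1; 1, 0] !![1, 0; 0, 1] i k ∧
    stdEntry 4 i k = tensor3Int !![1, 0; 0, -1] !![0, -1; 1, 0] !![1, 0; 0, 1] i k ∧
    stdEntry 5 i k = tensor3Int !![0, -1; 1, 0] !![1, 0; 0, 1] !![0, 1; 1, 0] i k ∧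
    stdEntry 6 i k = tensor3Int !![0, -1; 1, 0] !![1, 0; 0, 1] !![1, 0; 0, -1] i k := by
  decide +kernel

theorem stdReal_apply (R : Type*) [CommRing R] (m : Fin 7) (i k : Fin 8) :
    stdReal R m i k = (stdEntry m i k : R) := by
  simp only [stdReal, monoMat, Matrix.of_apply, stdEntry]
  split_ifs <;> simp

theorem standardGamma_eq (m : Fin 7) : standardGamma m = Complex.I • complexify (stdReal ℝ m) := by
  have h2 : pauli2 = Complex.I • (!![0, -1; 1, 0] : Matrix (Fin 2) (Fin 2) ℤ).map Int.cast := by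
    ext i k
    fin_cases i <;> fin_cases k <;> simp [pauli2]
  have h1 : pauli1 = (!![0, 1; 1, 0] : Matrix (Fin 2) (Fin 2) ℤ).map Int.cast := by
    ext i k
    fin_cases i <;> fin_cases k <;> simp [pauli1]
  have h3 : pauli3 = (!![1, 0; 0, -1] : Matrix (Fin 2) (Fin 2) ℤ).map Int.cast := by
    ext i k
    fin_cases i <;> fin_cases k <;> simp [pauli3]
  have h0 : (1 : Matrix (Fin 2) (Fin 2) ℂ) = (!![1, 0; 0, 1] : Matrix (Fin 2) (Fin 2) ℤ).map Int.cast := by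
    ext i k
    fin_cases i <;> fin_cases k <;> simp
  have s1 : ∀ A B C i k, tensor3 (Complex.I • A) B C i k = Complex.I * tensor3 A B C i k := by
    intro A B C i k
    simp only [tensor3_apply, Matrix.smul_apply, smul_eq_mul]
    ring
  have s2 : ∀ A B C i k, tensor3 A (Complex.I • B) C i k = Complex.I * tensor3 A B C i k := by
    intro A B C i k
    simp only [tensor3_apply, Matrix.smul_apply, smul_eq_mul]
    ring
  have s3 : ∀ A B C i k, tensor3 A B (Complex.I • C) i k = Complex.I * tensor3 A B C i k := by
    intro A B C i k
    simp only [tensor3_apply, Matrix.smul_apply, smul_eq_mul]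
    ring
  ext i k
  obtain ⟨t0, t1, t2, t3, t4, t5, t6⟩ := stdEntry_eq i k
  rw [Matrix.smul_apply, smul_eq_mul, RingHom.mapMatrix_apply, Matrix.map_apply,
    Complex.ofRealHom_eq_coe, stdReal_apply]
  fin_cases m
  · change -tensor3 pauli2 pauli2 pauli2 i k = Complex.I * (((stdEntry 0 i k : ℤ) : ℝ) : ℂ)
    rw [t0, h2, s1, s2, s3, tensor3_intCast]
    push_cast
    linear_combination (-Complex.I * (tensor3Int !![0, -1; 1, 0] !![0, -1; 1, 0]
      !![0, -1; 1, 0] i k : ℂ)) * Complex.I_mul_I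
  · change tensor3 1 pauli1 pauli2 i k = Complex.I * (((stdEntry 1 i k : ℤ) : ℝ) : ℂ)
    rw [t1, h2, h1, h0, s3, tensor3_intCast]
    push_cast
    ring
  · change tensor3 1 pauli3 pauli2 i k = Complex.I * (((stdEntry 2 i k : ℤ) : ℝ) : ℂ)
    rw [t2, h2, h3, h0, s3, tensor3_intCast]
    push_cast
    ring
  · change -tensor3 pauli1 pauli2 1 i k = Complex.I * (((stdEntry 3 i k : ℤ) : ℝ) : ℂ)
    rw [t3, h2, h1, h0, s2, tensor3_intCast]
    push_cast
    ring
  · change tensor3 pauli3 pauli2 1 i k = Complex.I * (((stdEntry 4 i k : ℤ) : ℝ) : ℂ)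
    rw [t4, h2, h3, h0, s2, tensor3_intCast]
    push_cast
    ring
  · change tensor3 pauli2 1 pauli1 i k = Complex.I * (((stdEntry 5 i k : ℤ) : ℝ) : ℂ)
    rw [t5, h2, h1, h0, s1, tensor3_intCast]
    push_cast
    ring
  · change tensor3 pauli2 1 pauli3 i k = Complex.I * (((stdEntry 6 i k : ℤ) : ℝ) : ℂ)
    rw [t6, h2, h3, h0, s1, tensor3_intCast]
    push_cast
    ring

end

noncomputable section

/-! ### The Euler-type charge in terms of the Chern-type charge -/

/-- The antisymmetric matrices that are orthogonal to the standard gamma matrices. -/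
def spinPart : Submodule ℝ (Matrix (Fin 8) (Fin 8) ℝ) where
  carrier := {X | Xᵀ = -X ∧ ∀ m, (X * stdReal ℝ m).trace = 0}
  zero_mem' := by simp
  add_mem' {X Y} hX hY := by
    refine ⟨by rw [Matrix.transpose_add, hX.1, hY.1, neg_add], fun m => ?_⟩
    rw [add_mul, Matrix.trace_add, hX.2, hY.2, add_zero]
  smul_mem' r X hX := by
    refine ⟨by rw [Matrix.transpose_smul, hX.1, smul_neg], fun m => ?_⟩
    rw [smul_mul_assoc, Matrix.trace_smul, hX.2, smul_zero]

/-- By skewness, each of the seven trace conditions is a linear relation among four entries of X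
above the diagonal; these are the hypotheses of `pfaffSum_self_eq_trace`. -/
theorem pfaffSum_self_of_mem_spinPart {X : Matrix (Fin 8) (Fin 8) ℝ} (h : X ∈ spinPart) :
    pfaffSum X X X X = -(48 * (X * X * (X * X)).trace) + 12 * (X * X).trace ^ 2 := by
  obtain ⟨hX, ht⟩ := h
  have hX' : ∀ i j, X j i = -X i j := fun i j => congrFun (congrFun hX i) j
  have hm : ∀ m, ∑ i, X (stdCol m i) i * (stdSign m i : ℝ) = 0 := fun m => by
    rw [← ht m, stdReal, mul_monoMat_trace]
  have e0 := hm 0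
  have e1 := hm 1
  have e2 := hm 2
  have e3 := hm 3
  have e4 := hm 4
  have e5 := hm 5
  have e6 := hm 6
  simp [Fin.sum_univ_eight, stdCol, stdSign] at e0 e1 e2 e3 e4 e5 e6
  refine pfaffSum_self_eq_trace hX' ?_ ?_ ?_ ?_ ?_ ?_ ?_
  · linarith [hX' 0 7, hX' 1 6, hX' 2 5, hX' 3 4]
  · linarith [hX' 0 3, hX' 1 2, hX' 4 7, hX' 5 6]
  · linarith [hX' 0 1, hX' 2 3, hX' 4 5, hX' 6 7]
  · linarith [hX' 0 6, hX' 1 7, hX' 2 4, hX' 3 5]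
  · linarith [hX' 0 2, hX' 1 3, hX' 4 6, hX' 5 7]
  · linarith [hX' 0 5, hX' 1 4, hX' 2 7, hX' 3 6]
  · linarith [hX' 0 4, hX' 1 5, hX' 2 6, hX' 3 7]

theorem eulerSum_map {R S : Type*} [CommRing R] [CommRing S] (φ : R →+* S)
    (Z : Fin 7 → Matrix (Fin 8) (Fin 8) R) :
    φ (eulerSum Z) = eulerSum fun k => (Z k).map φ := by
  rw [eulerSum, eulerSum, altSum, altSum, map_sum]
  refine Finset.sum_congr rfl fun σ _ => ?_
  rw [map_mul, pfaffSum_map, map_intCast]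
  simp only [Matrix.map_mul]
  rfl

theorem eulerSum_smul {R : Type*} [CommRing R] (r : R) (Z : Fin 7 → Matrix (Fin 8) (Fin 8) R) :
    (eulerSum fun k => r • Z k) = r ^ 7 * eulerSum Z := by
  rw [eulerSum, eulerSum, altSum, altSum, Finset.mul_sum]
  refine Finset.sum_congr rfl fun σ _ => ?_
  simp only [Function.comp_apply, smul_mul_assoc, mul_smul_comm, pfaffSum_smul₁, pfaffSum_smul₂,
    pfaffSum_smul₃, pfaffSum_smul₄]
  ring

theorem eulerSum_conj {R : Type*} [CommRing R] {K : Matrix (Fin 8) (Fin 8) R} (hK : Kᵀ * K = 1)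
    (Z : Fin 7 → Matrix (Fin 8) (Fin 8) R) :
    (eulerSum fun k => K * Z k * Kᵀ) = K.det * eulerSum Z := by
  have h : ∀ A B : Matrix (Fin 8) (Fin 8) R, K * A * Kᵀ * (K * B * Kᵀ) = K * (A * B) * Kᵀ := by
    intro A B
    calc K * A * Kᵀ * (K * B * Kᵀ) = K * A * (Kᵀ * K) * B * Kᵀ := by simp only [mul_assoc]
      _ = _ := by rw [hK]; simp only [mul_assoc, mul_one]
  rw [eulerSum, eulerSum, altSum, altSum, Finset.mul_sum]
  refine Finset.sum_congr rfl fun σ _ => ?_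
  simp only [Function.comp_apply, h, pfaffSum_conj]
  ring

/-- The alternating sum of the components of the Maurer-Cartan form, in a spinor basis of the same
orientation as one in which the gamma matrices are the standard ones. -/
theorem eulerSum_octTheta (c : ℝ) {S : Matrix (Fin 8) (Fin 8) ℝ}
    (hS : S ∈ Matrix.orthogonalGroup (Fin 8) ℝ) (hstd : ∀ m, stdReal ℝ m = S * octGamma ℝ m * Sᵀ) :
    S.det * eulerSum (octTheta c) = -(48 * (86016 * (2 * c ^ 6 + 5 * c ^ 4 + 2 * c ^ 2))) := by
  have hS' : Sᵀ * S = 1 := (Matrix.mem_orthogonalGroup_iff' (Fin 8) ℝ).1 hS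
  have hanti : ∀ X : Matrix (Fin 8) (Fin 8) ℝ, Xᵀ = -X → (conjHom S hS X)ᵀ = -conjHom S hS X := by
    intro X hX
    change (S * X * Sᵀ)ᵀ = -(S * X * Sᵀ)
    rw [Matrix.transpose_mul, Matrix.transpose_mul, Matrix.transpose_transpose, hX]
    simp only [mul_neg, neg_mul, mul_assoc]
  have hmem : ∀ X : Matrix (Fin 8) (Fin 8) ℝ, Xᵀ = -X → (∀ m, (X * octGamma ℝ m).trace = 0) →
      conjHom S hS X ∈ spinPart := by
    intro X hX ht
    refine ⟨hanti X hX, fun m => ?_⟩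
    have h : stdReal ℝ m = conjHom S hS (octGamma ℝ m) := hstd m
    rw [h, ← map_mul, trace_conjHom, ht]
  have hθ : ∀ k l, (octTheta c k * octTheta c l - octTheta c l * octTheta c k)ᵀ =
      -(octTheta c k * octTheta c l - octTheta c l * octTheta c k) := by
    intro k l
    rw [Matrix.transpose_sub, Matrix.transpose_mul, Matrix.transpose_mul, octTheta_antisymm,
      octTheta_antisymm, neg_mul_neg, neg_mul_neg, neg_sub]
  rw [← eulerSum_conj hS']
  have h := eulerSum_eq_trace_altProd spinPart (fun X => pfaffSum_self_of_mem_spinPart)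
    (Z := fun k => conjHom S hS (octTheta c k))
    (fun k => hmem _ (octTheta_antisymm c k) (trace_octTheta_mul_octGamma c k))
    (fun k l => by
      rw [← map_mul, ← map_mul, ← map_sub]
      exact hmem _ (hθ k l) (trace_commutator_octTheta_mul_octGamma c k l))
  rw [← altProd_map, trace_conjHom, trace_octTheta] at h
  exact h

/-! ### The density of the Euler-type charge -/

/-- The gauge potential at a point as a linear map. -/
def gaugePotLin (g : S7 → Mat8) (x : S7) : E8 →ₗ[ℝ] Mat8 := Complex.I • maurerCartanLin g x

theorem gaugePotLin_apply (g : S7 → Mat8) (x : S7) (v : E8) :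
    gaugePotLin g x v = gaugePot g x v := rfl

/-- The contraction of seven values of the gauge potential with the Levi-Civita symbol. -/
def eulerMultilinear (g : S7 → Mat8) (x : S7) : MultilinearMap ℝ (fun _ : Fin 7 => E8) ℂ :=
  MultilinearMap.mk' (fun v => pfaffSum (gaugePotLin g x (v 0))
      (gaugePotLin g x (v 1) * gaugePotLin g x (v 2)) (gaugePotLin g x (v 3) * gaugePotLin g x (v 4))
      (gaugePotLin g x (v 5) * gaugePotLin g x (v 6)))
    (fun v i a b => by
      fin_cases i <;> simp [map_add, add_mul, mul_add, pfaffSum_add₁, pfaffSum_add₂,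
        pfaffSum_add₃, pfaffSum_add₄])
    (fun v i r a => by
      have h : ∀ A : Mat8, r • A = (r : ℂ) • A := fun A => (Complex.coe_smul r A).symm
      have h1 : ∀ A B C D : Mat8, pfaffSum (r • A) B C D = r * pfaffSum A B C D :=
        fun A B C D => by rw [h, pfaffSum_smul₁]
      have h2 : ∀ A B C D : Mat8, pfaffSum A (r • B) C D = r * pfaffSum A B C D :=
        fun A B C D => by rw [h, pfaffSum_smul₂]
      have h3 : ∀ A B C D : Mat8, pfaffSum A B (r • C) D = r * pfaffSum A B C D :=
        fun A B C D => by rw [h, pfaffSum_smul₃]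
      have h4 : ∀ A B C D : Mat8, pfaffSum A B C (r • D) = r * pfaffSum A B C D :=
        fun A B C D => by rw [h, pfaffSum_smul₄]
      fin_cases i <;> simp [map_smul, h1, h2, h3, h4])

theorem eulerMultilinear_apply (g : S7 → Mat8) (x : S7) (v : Fin 7 → E8) :
    eulerMultilinear g x v = pfaffSum (gaugePot g x (v 0)) (gaugePot g x (v 1) * gaugePot g x (v 2))
      (gaugePot g x (v 3) * gaugePot g x (v 4)) (gaugePot g x (v 5) * gaugePot g x (v 6)) := by
  simp only [eulerMultilinear, MultilinearMap.mk', MultilinearMap.coe_mk, gaugePotLin_apply]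

theorem eulerForm_eq (g : S7 → Mat8) (x : S7) (v : Fin 7 → E8) :
    eulerForm g x v = wedge7 (eulerMultilinear g x) v := by
  rw [eulerForm, wedge7, wedge7]
  refine Finset.sum_congr rfl fun σ _ => ?_
  rw [eulerMultilinear_apply, pfaffSum, altSum]
  simp only [pairProd, Function.comp_apply, id_eq]

theorem eulerForm_eq_eulerSum (g : S7 → Mat8) (x : S7) (v : Fin 7 → E8) :
    eulerForm g x v = eulerSum fun k => gaugePot g x (v k) := by
  rw [eulerForm_eq, wedge7, eulerSum, altSum]
  simp only [eulerMultilinear_apply, Function.comp_apply]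

/-- Here K relates Γ to the model and R relates it to the standard matrices, so RᵀK takes the model
to the standard matrices. Conjugating θ by K multiplies the Euler sum by det K, and this equals
det(RᵀK) because det R = 1. The sign left open by the choice of K is thus absorbed in
`eulerSum_octTheta`. -/
theorem formDensity_eulerForm {Γ : Fin 7 → Mat8} (hΓ : IsGammaSystem Γ)
    {R : Matrix (Fin 8) (Fin 8) ℝ} (hR : R ∈ Matrix.specialOrthogonalGroup (Fin 8) ℝ)
    (hRΓ : ∀ m, Γ m = R.map Complex.ofReal * standardGamma m * (R.map Complex.ofReal)ᵀ) (x : S7) :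
    formDensity x (eulerForm (g7 Γ) x) =
      -Complex.I * (48 * (86016 * (2 * (x.1 7 : ℂ) ^ 6 + 5 * (x.1 7 : ℂ) ^ 4 + 2 * (x.1 7 : ℂ) ^ 2))) := by
  obtain ⟨K, hK, hKΓ, hKa⟩ := hΓ.exists_model
  obtain ⟨T, hT, hTx, L, hL, hmc⟩ := exists_frame hΓ hK hKa x
  obtain ⟨hR1, hRdet⟩ := Matrix.mem_specialOrthogonalGroup_iff.1 hR
  obtain ⟨hL1, hLdet⟩ := Matrix.mem_specialOrthogonalGroup_iff.1 hL
  have hRR : Rᵀ * R = 1 := (Matrix.mem_orthogonalGroup_iff' (Fin 8) ℝ).1 hR1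
  have hLL : Lᵀ * L = 1 := (Matrix.mem_orthogonalGroup_iff' (Fin 8) ℝ).1 hL1
  have hKK : Kᵀ * K = 1 := (Matrix.mem_orthogonalGroup_iff' (Fin 8) ℝ).1 hK
  have hmodel : ∀ m, R * stdReal ℝ m * Rᵀ = K * octGamma ℝ m * Kᵀ := by
    intro m
    apply complexify_injective
    have h : Complex.I • complexify (R * stdReal ℝ m * Rᵀ) =
        Complex.I • complexify (K * octGamma ℝ m * Kᵀ) := by
      rw [← hKΓ m, hRΓ m, standardGamma_eq, map_mul, map_mul, complexify_transpose, mul_smul_comm,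
        smul_mul_assoc]
      rfl
    exact smul_right_injective _ Complex.I_ne_zero h
  have hS : Rᵀ * K ∈ Matrix.orthogonalGroup (Fin 8) ℝ := by
    rw [Matrix.mem_orthogonalGroup_iff', Matrix.transpose_mul, Matrix.transpose_transpose]
    calc Kᵀ * R * (Rᵀ * K) = Kᵀ * (R * Rᵀ) * K := by simp only [mul_assoc]
      _ = 1 := by rw [mul_eq_one_comm.1 hRR, mul_one, hKK]
  have hstd : ∀ m, stdReal ℝ m = Rᵀ * K * octGamma ℝ m * (Rᵀ * K)ᵀ := by
    intro m
    calc stdReal ℝ m = Rᵀ * R * stdReal ℝ m * (Rᵀ * R) := by rw [hRR, one_mul, mul_one]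
      _ = Rᵀ * (R * stdReal ℝ m * Rᵀ) * R := by simp only [mul_assoc]
      _ = _ := by
        rw [hmodel, Matrix.transpose_mul, Matrix.transpose_transpose]
        simp only [mul_assoc]
  have hE := eulerSum_octTheta (x.1 7) hS hstd
  rw [Matrix.det_mul, Matrix.det_transpose, hRdet, one_mul] at hE
  have hE' : (eulerSum fun k => K * (L * octTheta (x.1 7) k * Lᵀ) * Kᵀ) =
      -(48 * (86016 * (2 * x.1 7 ^ 6 + 5 * x.1 7 ^ 4 + 2 * x.1 7 ^ 2))) := by
    rw [eulerSum_conj hKK fun k => L * octTheta (x.1 7) k * Lᵀ, eulerSum_conj hLL, hLdet, one_mul, hE]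
  rw [formDensity_congr x (eulerForm_eq (g7 Γ) x), formDensity_wedge7 _ hT hTx, ← eulerForm_eq,
    eulerForm_eq_eulerSum]
  simp only [gaugePot, hmc]
  have hmap := eulerSum_map Complex.ofRealHom fun k => K * (L * octTheta (x.1 7) k * Lᵀ) * Kᵀ
  rw [hE'] at hmap
  rw [eulerSum_smul]
  change -(Complex.I ^ 7 * eulerSum fun k =>
    (K * (L * octTheta (x.1 7) k * Lᵀ) * Kᵀ).map Complex.ofRealHom) = _
  have hI : Complex.I ^ 7 = -Complex.I := by
    rw [show Complex.I ^ 7 = (Complex.I ^ 2) ^ 3 * Complex.I by ring, Complex.I_sq]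
    ring
  rw [← hmap, hI, Complex.ofRealHom_eq_coe]
  push_cast
  ring

/-- The ratio is 48 · 2⁷/2¹¹ = 3 in absolute value. Its sign comes from i⁷ = −i in the seven
potentials, the i of the normalization and the −48 of the quartic identity. -/
theorem eulerDensity_g7 {Γ : Fin 7 → Mat8} (hΓ : IsGammaSystem Γ)
    {R : Matrix (Fin 8) (Fin 8) ℝ} (hR : R ∈ Matrix.specialOrthogonalGroup (Fin 8) ℝ)
    (hRΓ : ∀ m, Γ m = R.map Complex.ofReal * standardGamma m * (R.map Complex.ofReal)ᵀ) (x : S7) :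
    eulerDensity (g7 Γ) x = -3 * chernDensity (g7 Γ) x := by
  rw [eulerDensity, formDensity_eulerForm hΓ hR hRΓ, chernDensity_g7 hΓ]
  push_cast
  have hpi : (Real.pi : ℂ) ≠ 0 := Complex.ofReal_ne_zero.2 Real.pi_ne_zero
  have hI := Complex.I_sq
  field_simp
  rw [hI]
  ring

theorem eulerCharge_g7 {Γ : Fin 7 → Mat8} (hΓ : IsGammaSystem Γ)
    {R : Matrix (Fin 8) (Fin 8) ℝ} (hR : R ∈ Matrix.specialOrthogonalGroup (Fin 8) ℝ)
    (hRΓ : ∀ m, Γ m = R.map Complex.ofReal * standardGamma m * (R.map Complex.ofReal)ᵀ) :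
    eulerCharge (g7 Γ) = -3 := by
  rw [eulerCharge, funext (eulerDensity_g7 hΓ hR hRΓ), integral_const_mul]
  have h := chernCharge_g7 hΓ
  rw [chernCharge] at h
  rw [h, mul_one]

end

/-! ### The theorem -/

theorem mainTheorem3 (Γ : Fin 7 → Mat8) (hΓ : IsGammaSystem Γ) :
    -- `g₇` is a smooth map of `S⁷` to `Spin(7) ⊂ SO(8)`, given by the exponential on the whole
    -- closed ball of radius `π`
    (∀ a : EuclideanSpace ℝ (Fin 7), ‖a‖ ≤ Real.pi → ∀ x : S7,
      (∀ m : Fin 7, x.1 m.castSucc = Real.sinc ‖a‖ * a m) → x.1 7 = Real.cos ‖a‖ →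
        g7 Γ x = expMap Γ a) ∧
    (∀ i j, ContDiffOn ℝ (⊤ : ℕ∞) (fun y => radialExt (g7 Γ) y i j) {0}ᶜ) ∧
    (∀ x : S7, g7 Γ x ∈ spin7 Γ) ∧
    (∀ O ∈ spin7 Γ, ∃ R ∈ Matrix.specialOrthogonalGroup (Fin 8) ℝ, O = R.map Complex.ofReal) ∧
    -- the charge `q`: its density depends only on the polar angle, and reduces to the integrand
    (∀ (x : S7) (α : ℝ), x.1 7 = Real.cos α →
      (volS6 : ℂ) * chernDensity (g7 Γ) x =
        ((512 / (75 * Real.pi) *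
          (Real.cos α ^ 2 * (2 * Real.cos α ^ 4 + 5 * Real.cos α ^ 2 + 2)) : ℝ) : ℂ)) ∧
    chernCharge (g7 Γ) =
      ((512 / (75 * Real.pi) * ∫ α in (0 : ℝ)..Real.pi, Real.sin α ^ 6 * Real.cos α ^ 2 *
        (2 * Real.cos α ^ 4 + 5 * Real.cos α ^ 2 + 2) : ℝ) : ℂ) ∧
    chernCharge (g7 Γ) = 1 ∧
    -- the charge `q̃`, in spinor bases of the same orientation as that of the standard matrices
    (∀ R ∈ Matrix.specialOrthogonalGroup (Fin 8) ℝ,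
      (∀ m, Γ m = R.map Complex.ofReal * standardGamma m * (R.map Complex.ofReal)ᵀ) →
      (∀ (x : S7) (α : ℝ), x.1 7 = Real.cos α →
        (volS6 : ℂ) * eulerDensity (g7 Γ) x =
          ((-(512 / (25 * Real.pi)) *
            (Real.cos α ^ 2 * (2 * Real.cos α ^ 4 + 5 * Real.cos α ^ 2 + 2)) : ℝ) : ℂ)) ∧
      eulerCharge (g7 Γ) =
        ((-(512 / (25 * Real.pi)) * ∫ α in (0 : ℝ)..Real.pi, Real.sin α ^ 6 * Real.cos α ^ 2 *
          (2 * Real.cos α ^ 4 + 5 * Real.cos α ^ 2 + 2) : ℝ) : ℂ) ∧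
      eulerCharge (g7 Γ) = -3) := by
  have hpi : Real.pi ≠ 0 := Real.pi_ne_zero
  refine ⟨fun a _ x hx hx7 => g7_eq_expMap hΓ a x hx hx7, contDiffOn_radialExt_g7 hΓ, g7_mem_spin7 Γ,
    fun O hO => spin7_le hΓ hO, volS6_mul_chernDensity hΓ, ?_, chernCharge_g7 hΓ,
    fun R hR hRΓ => ⟨fun x α hx => ?_, ?_, eulerCharge_g7 hΓ hR hRΓ⟩⟩
  -- The charge is already known from the sphere moments; the polar integral is evaluated
  -- independently and compared.
  · rw [chernCharge_g7 hΓ, integral_polar, ← Complex.ofReal_one]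
    congr 1
    field_simp
  · rw [eulerDensity_g7 hΓ hR hRΓ, mul_left_comm, volS6_mul_chernDensity hΓ x α hx]
    push_cast
    have hpi' : (Real.pi : ℂ) ≠ 0 := Complex.ofReal_ne_zero.2 hpi
    field_simp
    ring
  · have h3 : (-3 : ℂ) = ((-3 : ℝ) : ℂ) := by push_cast; rfl
    rw [eulerCharge_g7 hΓ hR hRΓ, integral_polar, h3]
    congr 1
    field_simp
    norm_num
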